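/- Let $n\ge 3$, let $E_n$ be Euclidean space with Cartesian coordinates, and let $S_{n-1}$ be the area of its unit sphere. For a differential form $\omega$ write $dx^i\wedge\omega$ for the exterior product and $dx^i\cdot\omega=\iota_{\partial_i}\omega$ for the interior product, and put $$d\omega=\sum_i dx^i\wedge\partial_i\omega,\qquad \delta\omega=\sum_i dx^i\cdot\partial_i\omega$$ (so that $\delta d+d\delta=\sum_i\partial_i^2$; forms of degree $-1$ are zero). For a form $\beta=\sum_A\beta_A\,dx^A$ on a set $D$ put $$\Big(\int_{D}\frac{\beta'}{r_{12}^{n-2}}\Big)(x)=\sum_A dx^A\int_{D}\frac{\beta_A(x')}{|x-x'|^{n-2}}\,dx' .$$ Let $R\subset E_n$ be a compact set with boundary of class $C^1$ (locally $R$ is the closed region on one side of a $C^1$ graph), with outward unit normal $\nu$ and surface element $dS$ on $\partial R$. Let $\alpha$ be a $k$-form of class $C^2$ on $R$ (up to the boundary), and let $A$ be any prolongation of $\alpha$, i.e. a $k$-form of class $C^1$ on $E_n$ with $A=\alpha$ on $R$, which vanishes sufficiently fast at infinity: $A(x)\to 0$ as $|x|\to\infty$, and $(1+|x|)^{-(n-2)}|dA|$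 and $(1+|x|)^{-(n-2)}|\delta A|$ are integrable over $E_n$. Then the integrals below converge absolutely for every $x \in E_n$ and define differentiable forms on $E_n$, and with $$\mathcal F=d\Big[\int_{E_n\setminus R}\frac{\delta' A'}{r_{12}^{n-2}}\Big]+\delta\Big[\int_{E_n\setminus R}\frac{d' A'}{r_{12}^{n-2}}\Big]$$ the following hold. 1. On $R$, $$-(n-2)S_{n-1}\,\alpha=d\Big[\int_{R}\frac{\delta'\alpha'}{r_{12}^{n-2}}\Big]+\delta\Big[\int_{R}\frac{d'\alpha'}{r_{12}^{n-2}}\Big]+\mathcal F .$$ 2. $\mathcal F$ is of class $C^2$ in the interior of $R$ and satisfies there the boundary-integral system $$\delta\mathcal F=\sum_{i,l}dx^l\wedge\Big(dx^i\cdot\int_{\partial R}\frac{\partial}{\partial x'^l}\Big(\frac1{r_{12}^{n-2}}\Big)\,\delta'\alpha'\;\nu_i\,dS'\Big),$$ $$d\mathcal F=\sum_{i,l}dx^l\cdot\Big(dx^i\wedge\int_{\partial R}\frac{\partial}{\partial x'^l}\Big(\frac1{r_{12}^{n-2}}\Big)\,d'\alpha'\;\nu_i\,dS'\Big),$$ where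 the integrals over $\partial R$ are taken coefficient by coefficient. 3. $\mathcal F$ is hyper-harmonic in the interior of $R$: $\delta d\mathcal F=0$ and $d\delta\mathcal F=0$ there. -/

import Mathlib

open MeasureTheory Set Filter Topology

noncomputable section

namespace HodgeRegion

/-- Euclidean space `E_n` with its Cartesian coordinates. -/
abbrev Euc (n : ℕ) := EuclideanSpace ℝ (Fin n)

/-- The values of differential `k`-forms on `E_n`: a differential `k`-form is a map
`Euc n → Form n k`. -/
abbrev Form (n k : ℕ) := Euc n [⋀^Fin k]→L[ℝ] ℝ

/-- The `i`-th vector of the standard orthonormal basis. -/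
def basisVec {n : ℕ} (i : Fin n) : Euc n := EuclideanSpace.single i 1

/-! ### Algebra: the products of `dx^i` with a form -/

/-- The interior product `dx^i · ω`, that is, `ω(e_i, …)`. -/
def dot {n k : ℕ} (i : Fin n) (ω : Form n (k + 1)) : Form n k :=
  ω.curryLeft (basisVec i)

/-- The exterior product `dx^i ∧ ω`, that is,
`(v_0, …, v_k) ↦ ∑ j, (-1)^j (v_j)_i ω(v_0, …, v̂_j, …, v_k)`. -/
def wedge {n k : ℕ} (i : Fin n) (ω : Form n k) : Form n (k + 1) :=
  ContinuousAlternatingMap.alternatizeUncurryFin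
    ((EuclideanSpace.proj i : Euc n →L[ℝ] ℝ).smulRight ω)

/-- `dx^i · ω` as a form of degree one less; it vanishes for `0`-forms. -/
def dotPred {n : ℕ} : (k : ℕ) → Fin n → Form n k → Form n (k - 1)
  | 0, _, _ => 0
  | _ + 1, i, ω => dot i ω

/-- `dx^i ∧ ω` for a form `ω` of degree `k - 1`; there are no nonzero forms of degree `-1`, so
it vanishes for `k = 0`. -/
def wedgePred {n : ℕ} : (k : ℕ) → Fin n → Form n (k - 1) → Form n k
  | 0, _, _ => 0
  | _ + 1, i, ω => wedge i ω

/-! ### The interior derivative `δ` and the exterior derivative `d` -/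

/-- The interior derivative `δω = ∑ h, dx^h · ∂ω/∂x^h`, with derivatives taken within `s`. -/
def intDerivWithin {n k : ℕ} (ω : Euc n → Form n (k + 1)) (s : Set (Euc n)) (x : Euc n) :
    Form n k :=
  ∑ h : Fin n, dot h (fderivWithin ℝ ω s x (basisVec h))

/-- The interior derivative `δω = ∑ h, dx^h · ∂ω/∂x^h`. -/
def intDeriv {n k : ℕ} (ω : Euc n → Form n (k + 1)) (x : Euc n) : Form n k :=
  ∑ h : Fin n, dot h (fderiv ℝ ω x (basisVec h))

/-- `δω` within `s` for a `k`-form `ω`, of degree `k - 1`; it vanishes for `k = 0`. -/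
def intDerivWithinPred {n : ℕ} : (k : ℕ) → (Euc n → Form n k) → Set (Euc n) → Euc n →
    Form n (k - 1)
  | 0, _, _, _ => 0
  | _ + 1, ω, s, x => intDerivWithin ω s x

/-- `δω` for a `k`-form `ω`, of degree `k - 1`; it vanishes for `k = 0`. -/
def intDerivPred {n : ℕ} : (k : ℕ) → (Euc n → Form n k) → Euc n → Form n (k - 1)
  | 0, _, _ => 0
  | _ + 1, ω, x => intDeriv ω x

/-- `dω` for a form `ω` of degree `k - 1`; it vanishes for `k = 0`. -/
def extDerivPred {n : ℕ} : (k : ℕ) → (Euc n → Form n (k - 1)) → Euc n → Form n k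
  | 0, _, _ => 0
  | _ + 1, ω, x => extDeriv ω x

/-! ### Integrals against `1 / r₁₂ ^ (n - 2)` -/

/-- The kernel `1 / r₁₂ ^ (n - 2)`, where `r₁₂ = |x - y|`. -/
def kernel {n : ℕ} (x y : Euc n) : ℝ := (‖x - y‖ ^ (n - 2))⁻¹

/-- The solid angle `S_{n-1}`: the area of the unit sphere of `E_n`. -/
def solidAngle (n : ℕ) : ℝ := (volume : Measure (Euc n)).toSphere.real univ

/-- The form `dx^A ∫_D β(y)_A / r₁₂ ^ (n - 2) dy`, summed over a Cartesian basis `dx^A` of the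
forms: the integral is taken in the finite-dimensional space of constant forms. -/
def potential {n k : ℕ} (D : Set (Euc n)) (β : Euc n → Form n k) (x : Euc n) : Form n k :=
  ∫ y in D, kernel x y • β y

/-- The term `F` that comes from the prolongation `A` outside `R`:
`d ∫_{E_n - R} δA / r₁₂ ^ (n - 2) + δ ∫_{E_n - R} dA / r₁₂ ^ (n - 2)`. -/
def prolongationTerm {n : ℕ} (k : ℕ) (R : Set (Euc n)) (A : Euc n → Form n k) (x : Euc n) :
    Form n k :=
  extDerivPred k (potential Rᶜ (intDerivPred k A)) x +
    intDeriv (potential Rᶜ (extDeriv A)) x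

/-! ### Boundaries of class `C^1` and integrals over them -/

/-- A description of the boundary of `R` near some of its points as the graph of a `C^1` function,
in suitable orthonormal coordinates: every point of `E_n` is `frame y + t • up` for unique
`y ∈ ℝ^{n-1}` and `t ∈ ℝ`, and inside the open set `U` the set `R` is given by `t ≤ γ y`. -/
structure GraphPatch {n : ℕ} (R : Set (Euc n)) where
  U : Set (Euc n)
  isOpen : IsOpen U
  frame : Euc (n - 1) →ₗᵢ[ℝ] Euc n
  up : Euc n
  norm_up : ‖up‖ = 1
  orthogonal : ∀ y, inner ℝ (frame y) up = 0
  γ : Euc (n - 1) → ℝ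
  contDiff : ContDiff ℝ 1 γ
  mem_iff : ∀ y t, frame y + t • up ∈ U → (frame y + t • up ∈ R ↔ t ≤ γ y)

/-- The parametrization `y ↦ (y, γ y)` of the graph. -/
def GraphPatch.param {n : ℕ} {R : Set (Euc n)} (P : GraphPatch R) (y : Euc (n - 1)) : Euc n :=
  P.frame y + P.γ y • P.up

/-- The density of the outward vector element of area `ν dS` with respect to `dy`, namely
`(-∇γ, 1)`; here `ν = (-∇γ, 1) / √(1 + |∇γ|²)` is the outward unit normal and
`dS = √(1 + |∇γ|²) dy` is the element of area. -/
def GraphPatch.areaElement {n : ℕ} {R : Set (Euc n)} (P : GraphPatch R) (y : Euc (n - 1)) :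
    Euc n :=
  P.up - P.frame (gradient P.γ y)

/-- A finite system of graph patches that covers the boundary of `R`, with a smooth partition of
unity subordinate to it. A compact set admits one exactly if its boundary is of class `C^1`, the set
lying locally on one side of the boundary. -/
structure BoundaryPatches {n : ℕ} (R : Set (Euc n)) where
  m : ℕ
  patch : Fin m → GraphPatch R
  ρ : Fin m → Euc n → ℝ
  smooth : ∀ j, ContDiff ℝ (⊤ : ℕ∞) (ρ j)
  nonneg : ∀ j x, 0 ≤ ρ j x
  compact_support : ∀ j, HasCompactSupport (ρ j)
  subordinate : ∀ j, tsupport (ρ j) ⊆ (patch j).U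
  sum_eq_one : ∀ᶠ x in 𝓝ˢ (frontier R), ∑ j, ρ j x = 1

/-- The integral `∫_{∂R} f (dx^i · z) = ∫_{∂R} f ν_i dS`, where `z` is the volume form, `ν` the
outward unit normal and `dS` the element of area of `∂R`; computed in the parametrizations of the
patches with the help of the partition of unity. -/
def BoundaryPatches.integral {n : ℕ} {R : Set (Euc n)} (P : BoundaryPatches R)
    {V : Type*} [NormedAddCommGroup V] [NormedSpace ℝ V] (i : Fin n) (f : Euc n → V) : V :=
  ∑ j, ∫ y : Euc (n - 1),
    (P.ρ j ((P.patch j).param y) * (P.patch j).areaElement y i) • f ((P.patch j).param y)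

end HodgeRegion

end

/-!
The operators `d` and `δ` are first order operators with constant coefficients,
`firstOrder c ω = ∑ i, c_i (∂ω/∂x^i)`, and the only algebra needed is that of their symbols:
`dx^i ∧` and `dx^i ·` anticommute among themselves, and
`dx^i ∧ (dx^j · ω) + dx^j · (dx^i ∧ ω) = δ_ij ω` (`wedgePredL_dotPredL_add`). The analysis is done
for general operators with such relations.

Write `N β` for the potential `∫ β(y) / |x - y| ^ (n - 2) dy` (`newtonPot`). It is differentiable for
locally bounded `β` integrable against `(1 + |y|) ^ (-(n - 2))`, with derivative computed under the
integral sign (`IsAdmissible.hasFDerivAt_newtonPot`). For `A` of class `C^1` with compact support the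
second derivatives of `N A` exist, are symmetric, and have trace `-(n - 2) S_{n-1} A`
(`sum_newtonGrad_fderiv`, in polar coordinates). Hence `d N (δA) + δ N (dA) = -(n - 2) S_{n-1} A`, and
also `δ N (δA) = 0` and `d N (dA) = 0` although `A` has no second derivatives. Cutting off at radius
`j` and letting `j → ∞` extends these identities to `A` vanishing at infinity
(`firstOrder_newtonPot_add_eq`, `firstOrder_newtonPot_eq_zero`). Splitting the integrals over
`R` and its complement gives the decomposition of `α`.

In the interior of `R` the potentials `φ` of `δA` and `ψ` of `dA` over the complement of `R` are smooth
and harmonic, and `F = dφ + δψ`; thus `δF = δdφ` and `dF = dδψ`, and `dδF` and `δdF` vanish because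
`δd = -dδ` on harmonic forms. For the boundary integrals, `δdφ = -dδφ`, where `δφ` is the negative of
`δ` of the potential of `δα` over `R`. In the latter the derivative is moved from the kernel to
`δα` (`newtonGrad_indicator`); the volume term is the potential of `δδα = 0`, so that only an integral
over `∂R` is left (`firstOrder_newtonPot_compl`), and it can be differentiated once more under the
integral sign. The same argument, with `d` and `δ` exchanged, applies to `dδψ`.

The integration by parts rests on the divergence theorem for regions with boundary of class `C^1`
(`setIntegral_fderivWithin_eq`). In a patch, the volume preserving shear `(y, s) ↦ (y, γ y + s)`
flattens the boundary; derivatives along the surfaces `s = const` integrate to zero, and the derivative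
along `up` is integrated by the fundamental theorem of calculus.
-/

noncomputable section

namespace HodgeRegion

/-! ### The algebra of interior and exterior products -/

section Symbols

/-- The interior product `dx^i ·` as a continuous linear map. -/
def dotL {n k : ℕ} (i : Fin n) : Form n (k + 1) →L[ℝ] Form n k :=
  ContinuousLinearMap.apply ℝ _ (basisVec i) ∘L
    (ContinuousAlternatingMap.curryLeftLI (𝕜 := ℝ) (E := Euc n) (F := ℝ) (n := k)
      ).toContinuousLinearMap

/-- The interior product `dx^i ·` with values in the forms of degree `k - 1`, zero if `k = 0`. -/
def dotPredL {n : ℕ} : (k : ℕ) → Fin n → Form n k →L[ℝ] Form n (k - 1)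
  | 0, _ => 0
  | _ + 1, i => dotL i

/-- The exterior product `dx^i ∧` as a continuous linear map. -/
def wedgeL {n k : ℕ} (i : Fin n) : Form n k →L[ℝ] Form n (k + 1) :=
  ContinuousAlternatingMap.alternatizeUncurryFinCLM ℝ (Euc n) ℝ ∘L
    ContinuousLinearMap.smulRightL ℝ (Euc n) (Form n k) (EuclideanSpace.proj i)

/-- The exterior product `dx^i ∧` on forms of degree `k - 1`, zero if `k = 0`. -/
def wedgePredL {n : ℕ} : (k : ℕ) → Fin n → Form n (k - 1) →L[ℝ] Form n k
  | 0, _ => 0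
  | _ + 1, i => wedgeL i

/-- The differential operator `ω ↦ ∑ i, c_i (∂ω/∂x^i)` with constant coefficients. Both `d` and `δ`
are of this kind. -/
def firstOrder {n : ℕ} {V W : Type*} [NormedAddCommGroup V] [NormedSpace ℝ V]
    [NormedAddCommGroup W] [NormedSpace ℝ W] (c : Fin n → V →L[ℝ] W) (ω : Euc n → V) (x : Euc n) :
    W :=
  ∑ i, c i (fderiv ℝ ω x (basisVec i))

variable {n k : ℕ}

theorem dotPred_eq_dotPredL (k : ℕ) (i : Fin n) (ω : Form n k) :
    dotPred k i ω = dotPredL k i ω := by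
  cases k <;> rfl

theorem dot_eq_dotL (i : Fin n) (ω : Form n (k + 1)) : dot i ω = dotL i ω := rfl

theorem wedge_eq_wedgeL (i : Fin n) (ω : Form n k) : wedge i ω = wedgeL i ω := rfl

theorem wedgePred_eq_wedgePredL (k : ℕ) (i : Fin n) (ω : Form n (k - 1)) :
    wedgePred k i ω = wedgePredL k i ω := by
  cases k <;> rfl

theorem sum_proj_smulRight_basisVec {V : Type*} [NormedAddCommGroup V] [NormedSpace ℝ V]
    (f : Euc n →L[ℝ] V) :
    ∑ i, (EuclideanSpace.proj i : Euc n →L[ℝ] ℝ).smulRight (f (basisVec i)) = f := by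
  ext v
  have hv : v = ∑ i, v i • basisVec i := by
    ext j
    simp [basisVec, Finset.sum_apply, Pi.single_apply]
  conv_rhs => rw [hv, map_sum]
  simp

theorem alternatizeUncurryFin_eq_sum_wedgeL (f : Euc n →L[ℝ] Form n k) :
    ContinuousAlternatingMap.alternatizeUncurryFin f = ∑ i, wedgeL i (f (basisVec i)) := by
  conv_lhs => rw [← sum_proj_smulRight_basisVec f,
    ← ContinuousAlternatingMap.alternatizeUncurryFinCLM_apply, map_sum]
  rfl

theorem extDeriv_eq_firstOrder (ω : Euc n → Form n k) : extDeriv ω = firstOrder wedgeL ω := by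
  ext1 x
  exact alternatizeUncurryFin_eq_sum_wedgeL _

theorem extDerivPred_eq_firstOrder (k : ℕ) (ω : Euc n → Form n (k - 1)) :
    extDerivPred k ω = firstOrder (wedgePredL k) ω := by
  cases k with
  | zero => ext1 x; simp [extDerivPred, firstOrder, wedgePredL]
  | succ k => exact extDeriv_eq_firstOrder ω

theorem intDeriv_eq_firstOrder (ω : Euc n → Form n (k + 1)) :
    intDeriv ω = firstOrder dotL ω := rfl

theorem intDerivPred_eq_firstOrder (k : ℕ) (ω : Euc n → Form n k) :
    intDerivPred k ω = firstOrder (dotPredL k) ω := by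
  cases k with
  | zero => ext1 x; simp [intDerivPred, firstOrder, dotPredL]
  | succ k => rfl

/-- `dx^i ∧ (dx^j · ω) + dx^j · (dx^i ∧ ω) = δ_ij ω`: the reason for `dδ + δd = Δ`. -/
theorem wedgePredL_dotPredL_add (k : ℕ) (i j : Fin n) (ω : Form n k) :
    wedgePredL k i (dotPredL k j ω) + dotL j (wedgeL i ω) = if i = j then ω else 0 := by
  have hij : (basisVec j : Euc n) i = if i = j then 1 else 0 := by
    simp [basisVec]
  rw [← wedge_eq_wedgeL, ← dot_eq_dotL, ← wedgePred_eq_wedgePredL, ← dotPred_eq_dotPredL]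
  ext v
  have h : (dot j (wedge i ω)) v = (basisVec j : Euc n) i * ω v +
      ∑ l : Fin k, (-1) ^ ((l : ℕ) + 1) *
        (v l i * ω ((Fin.succ l).removeNth (Matrix.vecCons (basisVec j) v))) := by
    simp only [dot, wedge, ContinuousAlternatingMap.curryLeft_apply_apply,
      ContinuousAlternatingMap.alternatizeUncurryFin_apply, Fin.sum_univ_succ]
    simp [Matrix.vecCons, Fin.removeNth_zero]
  rw [ContinuousAlternatingMap.add_apply, h, hij]
  have h2 : (wedgePred k i (dotPred k j ω)) v = ∑ l : Fin k, (-1) ^ (l : ℕ) *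
        (v l i * ω ((Fin.succ l).removeNth (Matrix.vecCons (basisVec j) v))) := by
    cases k with
    | zero => simp [wedgePred]
    | succ k =>
      simp only [wedgePred, dotPred, wedge, dot,
        ContinuousAlternatingMap.alternatizeUncurryFin_apply]
      refine Finset.sum_congr rfl fun l _ => ?_
      have : (Fin.succ l).removeNth (Matrix.vecCons (basisVec j) v) =
          Matrix.vecCons (basisVec j) (l.removeNth v) := by
        ext m
        refine Fin.cases ?_ (fun m => ?_) m
        · simp [Fin.removeNth]
        · simp [Fin.removeNth, Fin.succ_succAbove_succ]
      simp [this, ContinuousAlternatingMap.curryLeft_apply_apply]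
  rw [h2]
  have h3 : ∀ a b c : ℝ, a = -c → a + (b + c) = b := by intros; linarith
  rw [h3]
  · split_ifs <;> simp
  · rw [← Finset.sum_neg_distrib]
    exact Finset.sum_congr rfl fun l _ => by ring

theorem exists_symmetric_bilinear {E V : Type*} [NormedAddCommGroup E] [NormedSpace ℝ E]
    [NormedAddCommGroup V] [NormedSpace ℝ V] (p q : E →L[ℝ] ℝ) (v : V) :
    ∃ f : E →L[ℝ] E →L[ℝ] V, ∀ x y, f x y = (p x * q y + q x * p y) • v :=
  ⟨p.smulRight (q.smulRight v) + q.smulRight (p.smulRight v), fun x y => by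
    simp [smul_smul, add_smul]⟩

theorem alternatizeUncurryFin_smulRight_add {E : Type*} [NormedAddCommGroup E] [NormedSpace ℝ E]
    (p q : E →L[ℝ] ℝ) (ω : E [⋀^Fin k]→L[ℝ] ℝ) :
    ContinuousAlternatingMap.alternatizeUncurryFin
        (p.smulRight (ContinuousAlternatingMap.alternatizeUncurryFin (q.smulRight ω))) +
      ContinuousAlternatingMap.alternatizeUncurryFin
        (q.smulRight (ContinuousAlternatingMap.alternatizeUncurryFin (p.smulRight ω))) = 0 := by
  -- the symmetric bilinear map `(v, w) ↦ (p v * q w + q v * p w) ω` is killed by alternatization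
  obtain ⟨f, hf⟩ := exists_symmetric_bilinear p q ω
  have h :=
    ContinuousAlternatingMap.alternatizeUncurryFin_alternatizeUncurryFinCLM_comp_of_symmetric
      (f := f) (fun x y => by rw [hf, hf]; ring_nf)
  rw [← ContinuousAlternatingMap.alternatizeUncurryFin_add, ← h]
  congr 1
  ext1 x
  have hfx : f x = p x • q.smulRight ω + q x • p.smulRight ω := by
    ext1 y
    simp [hf, add_smul, mul_smul]
  simp [hfx, ContinuousAlternatingMap.alternatizeUncurryFin_smul,
    ContinuousAlternatingMap.alternatizeUncurryFin_add]

theorem wedgeL_wedgeL_add (i j : Fin n) (ω : Form n k) :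
    wedgeL i (wedgeL j ω) + wedgeL j (wedgeL i ω) = 0 :=
  alternatizeUncurryFin_smulRight_add _ _ _

theorem wedgeL_wedgePredL_add (k : ℕ) (i j : Fin n) (ω : Form n (k - 1)) :
    wedgeL i (wedgePredL k j ω) + wedgeL j (wedgePredL k i ω) = 0 := by
  cases k with
  | zero => simp [wedgePredL]
  | succ k => exact wedgeL_wedgeL_add i j ω

theorem dotL_dotL_add (i j : Fin n) (ω : Form n (k + 2)) :
    dotL i (dotL j ω) + dotL j (dotL i ω) = 0 := by
  ext v
  have h := ω.map_swap (Matrix.vecCons (basisVec j) (Matrix.vecCons (basisVec i) v))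
    (i := 0) (j := 1) (by simp)
  have hs : (Matrix.vecCons (basisVec j) (Matrix.vecCons (basisVec i) v)) ∘ Equiv.swap 0 1 =
      (Matrix.vecCons (basisVec i) (Matrix.vecCons (basisVec j) v) : Fin (k + 2) → Euc n) := by
    ext1 m
    refine Fin.cases (by simp) (fun m => ?_) m
    refine Fin.cases (by simp) (fun m => ?_) m
    rw [Function.comp_apply, Equiv.swap_apply_of_ne_of_ne]
    · simp
    · simp [Fin.ext_iff]
    · simp [Fin.ext_iff]
  rw [hs] at h
  have h' : ω (Matrix.vecCons (basisVec j) (Matrix.vecCons (basisVec i) v)) +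
      ω (Matrix.vecCons (basisVec i) (Matrix.vecCons (basisVec j) v)) = 0 :=
    add_eq_zero_iff_eq_neg'.2 h
  exact h'

theorem dotPredL_dotL_add (k : ℕ) (i j : Fin n) (ω : Form n (k + 1)) :
    dotPredL k i (dotL j ω) + dotPredL k j (dotL i ω) = 0 := by
  cases k with
  | zero => simp [dotPredL]
  | succ k => exact dotL_dotL_add i j ω

end Symbols

/-! ### Homogeneous kernels and integrals away from the singularity -/

section Kernels

/-- `κ` is a kernel that is smooth away from the origin and homogeneous of degree `-d`. -/
structure IsHomKernel {n : ℕ} {W : Type*} [NormedAddCommGroup W] [NormedSpace ℝ W] (d : ℕ)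
    (κ : Euc n → W) : Prop where
  contDiffOn : ContDiffOn ℝ (⊤ : ℕ∞) κ {0}ᶜ
  homogeneous : ∀ t : ℝ, 0 < t → ∀ z, z ≠ 0 → κ (t • z) = (t ^ d)⁻¹ • κ z

/-- The kernel `1 / |z| ^ (n - 2)`. -/
def newton {n : ℕ} (z : Euc n) : ℝ := (‖z‖ ^ (n - 2))⁻¹

variable {n d m : ℕ} {V W W' : Type*} [NormedAddCommGroup V] [NormedSpace ℝ V]
  [NormedAddCommGroup W] [NormedSpace ℝ W] [NormedAddCommGroup W'] [NormedSpace ℝ W']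

theorem isHomKernel_newton : IsHomKernel (n - 2) (newton (n := n)) where
  contDiffOn z hz :=
    (((contDiffAt_norm ℝ hz).pow _).inv (pow_ne_zero _ (norm_ne_zero_iff.2 hz))).contDiffWithinAt
  homogeneous t ht z hz := by
    simp [newton, norm_smul, abs_of_pos ht, mul_pow, mul_comm]

theorem IsHomKernel.clm_comp {κ : Euc n → W} (hκ : IsHomKernel d κ) (L : W →L[ℝ] W') :
    IsHomKernel d (fun z => L (κ z)) where
  contDiffOn := L.contDiff.comp_contDiffOn hκ.contDiffOn
  homogeneous t ht z hz := by simp [hκ.homogeneous t ht z hz]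

theorem IsHomKernel.differentiableAt {κ : Euc n → W} (hκ : IsHomKernel d κ) {z : Euc n}
    (hz : z ≠ 0) : DifferentiableAt ℝ κ z :=
  (hκ.contDiffOn.contDiffAt (isOpen_compl_singleton.mem_nhds hz)).differentiableAt (by simp)

theorem IsHomKernel.fderiv {κ : Euc n → W} (hκ : IsHomKernel d κ) :
    IsHomKernel (d + 1) (fderiv ℝ κ) where
  contDiffOn := hκ.contDiffOn.fderiv_of_isOpen isOpen_compl_singleton (by simp)
  homogeneous t ht z hz := by
    have h1 : HasFDerivAt (fun z => κ (t • z)) ((_root_.fderiv ℝ κ (t • z)).comp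
        (t • ContinuousLinearMap.id ℝ (Euc n))) z :=
      (hκ.differentiableAt (smul_ne_zero ht.ne' hz)).hasFDerivAt.comp z
        ((hasFDerivAt_id z).const_smul t)
    have h2 : HasFDerivAt (fun z => κ (t • z)) ((t ^ d)⁻¹ • _root_.fderiv ℝ κ z) z := by
      refine ((hκ.differentiableAt hz).hasFDerivAt.const_smul ((t ^ d)⁻¹)).congr_of_eventuallyEq ?_
      filter_upwards [isOpen_compl_singleton.mem_nhds hz] with y hy
      exact hκ.homogeneous t ht y hy
    have h3 := h1.unique h2
    have h4 : _root_.fderiv ℝ κ (t • z) = t⁻¹ • ((t ^ d)⁻¹ • _root_.fderiv ℝ κ z) := by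
      rw [← h3]
      ext v
      simp [smul_smul, inv_mul_cancel₀ ht.ne']
    rw [h4, smul_smul, pow_succ, mul_inv, mul_comm]

/-- By homogeneity the bound follows from the one on the unit sphere. -/
theorem IsHomKernel.exists_bound {κ : Euc n → W} (hκ : IsHomKernel d κ) :
    ∃ C, 0 ≤ C ∧ ∀ z, z ≠ 0 → ‖κ z‖ ≤ C * (‖z‖ ^ d)⁻¹ := by
  have hs : ContinuousOn κ (Metric.sphere 0 1) := hκ.contDiffOn.continuousOn.mono fun z hz h0 => by
    simp [mem_singleton_iff.1 h0] at hz
  obtain ⟨C, hC⟩ := (isCompact_sphere (0 : Euc n) 1).exists_bound_of_continuousOn hs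
  refine ⟨max C 0, le_max_right _ _, fun z hz => ?_⟩
  have hz' := norm_pos_iff.2 hz
  have h : z = ‖z‖ • (‖z‖⁻¹ • z) := by rw [smul_smul, mul_inv_cancel₀ hz'.ne', one_smul]
  have hu : ‖‖z‖⁻¹ • z‖ = 1 := by rw [norm_smul, norm_inv, norm_norm, inv_mul_cancel₀ hz'.ne']
  conv_lhs => rw [h, hκ.homogeneous _ hz' _ (norm_ne_zero_iff.1 (by rw [hu]; exact one_ne_zero))]
  rw [norm_smul, norm_inv, norm_pow, norm_norm, mul_comm]
  gcongr
  exact (hC _ (by simpa using hu)).trans (le_max_left _ _)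

theorem IsHomKernel.stronglyMeasurable {κ : Euc n → W} (hκ : IsHomKernel d κ) :
    StronglyMeasurable κ := by
  refine stronglyMeasurable_of_restrict_of_restrict_compl (s := {0}ᶜ)
    (measurableSet_singleton _).compl ?_ ?_
  · exact (continuousOn_iff_continuous_domRestrict.1 hκ.contDiffOn.continuousOn).stronglyMeasurable
  · refine stronglyMeasurable_const' fun x y => ?_
    have hx := x.2
    have hy := y.2
    simp only [compl_compl, mem_singleton_iff] at hx hy
    simp [hx, hy]

/-- For points `p` at distance at least `r` from `x`, the distance `|x - p|` controls `1 + |p|`. -/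
theorem one_add_norm_le_of_le_norm_sub {E : Type*} [NormedAddCommGroup E] {x p : E} {r : ℝ}
    (hr : 0 < r) (h : r ≤ ‖x - p‖) : 1 + ‖p‖ ≤ (1 + (1 + ‖x‖) / r) * ‖x - p‖ := by
  have h1 : ‖p‖ ≤ ‖x‖ + ‖x - p‖ := by
    have := norm_sub_le x (x - p)
    simpa using this
  have h2 : 1 + ‖x‖ ≤ (1 + ‖x‖) / r * ‖x - p‖ := by
    rw [div_mul_eq_mul_div, le_div_iff₀ hr]
    gcongr
  linarith

theorem inv_norm_sub_pow_le {E : Type*} [NormedAddCommGroup E] {x p : E} {r : ℝ} (hr : 0 < r)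
    (h : r ≤ ‖x - p‖) (hmd : m ≤ d) :
    (‖x - p‖ ^ d)⁻¹ ≤ (1 + (1 + ‖x‖) / r) ^ d * ((1 + ‖p‖) ^ m)⁻¹ := by
  have h1 := one_add_norm_le_of_le_norm_sub hr h
  have hp : 0 < ‖x - p‖ := hr.trans_le h
  have hL : 0 < 1 + (1 + ‖x‖) / r := by positivity
  have h2 : (1 + ‖p‖) ^ m ≤ (1 + (1 + ‖x‖) / r) ^ d * ‖x - p‖ ^ d := by
    rw [← mul_pow]
    exact (pow_le_pow_right₀ (by linarith [norm_nonneg p]) hmd).trans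
      (pow_le_pow_left₀ (by positivity) h1 _)
  rw [← div_eq_mul_inv, le_div_iff₀ (by positivity), inv_mul_le_iff₀ (by positivity), mul_comm]
  exact h2

variable {Ω : Type*} [MeasurableSpace Ω] {μ : Measure Ω} {τ : Ω → Euc n} {β : Ω → V}

theorem aestronglyMeasurable_of_weight (hτ : Measurable τ)
    (hβ : Integrable (fun ω => ((1 + ‖τ ω‖) ^ m)⁻¹ • β ω) μ) : AEStronglyMeasurable β μ := by
  have h : AEStronglyMeasurable
      (fun ω => (1 + ‖τ ω‖) ^ m • (((1 + ‖τ ω‖) ^ m)⁻¹ • β ω)) μ :=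
    ((measurable_const.add hτ.norm).pow_const m).aestronglyMeasurable.smul hβ.1
  refine h.congr (.of_forall fun ω => ?_)
  have : (1 + ‖τ ω‖) ^ m ≠ 0 := by positivity
  simp [smul_smul, this]

theorem IsHomKernel.aestronglyMeasurable_apply {κ : Euc n → V →L[ℝ] W} (hκ : IsHomKernel d κ)
    (hτ : Measurable τ) (hβ : AEStronglyMeasurable β μ) (x : Euc n) :
    AEStronglyMeasurable (fun ω => κ (x - τ ω) (β ω)) μ := by
  have h1 : AEStronglyMeasurable (fun ω => κ (x - τ ω)) μ :=
    (hκ.stronglyMeasurable.comp_measurable (measurable_const.sub hτ)).aestronglyMeasurable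
  exact (ContinuousLinearMap.apply ℝ W).flip.aestronglyMeasurable_comp₂ h1 hβ

theorem IsHomKernel.norm_apply_le {κ : Euc n → V →L[ℝ] W} {C : ℝ} (hC0 : 0 ≤ C)
    (hC : ∀ z, z ≠ 0 → ‖κ z‖ ≤ C * (‖z‖ ^ d)⁻¹) {r : ℝ} (hr : 0 < r) (hmd : m ≤ d) {x : Euc n}
    {p : Euc n} {b : V} (hfar : b ≠ 0 → r ≤ ‖x - p‖) :
    ‖κ (x - p) b‖ ≤ C * (1 + (1 + ‖x‖) / r) ^ d * ‖((1 + ‖p‖) ^ m)⁻¹ • b‖ := by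
  rcases eq_or_ne b 0 with rfl | hb
  · simp
  have h := hfar hb
  have hz : x - p ≠ 0 := norm_pos_iff.1 (hr.trans_le h)
  have hw : ‖((1 + ‖p‖) ^ m)⁻¹‖ = ((1 + ‖p‖) ^ m)⁻¹ := by
    rw [Real.norm_of_nonneg]; positivity
  rw [norm_smul, hw]
  calc ‖κ (x - p) b‖ ≤ ‖κ (x - p)‖ * ‖b‖ := (κ (x - p)).le_opNorm b
    _ ≤ (C * ((1 + (1 + ‖x‖) / r) ^ d * ((1 + ‖p‖) ^ m)⁻¹)) * ‖b‖ := by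
      gcongr
      exact (hC _ hz).trans (by gcongr; exact inv_norm_sub_pow_le hr h hmd)
    _ = _ := by ring

theorem IsHomKernel.integrable_apply {κ : Euc n → V →L[ℝ] W} (hκ : IsHomKernel d κ)
    (hmd : m ≤ d) (hτ : Measurable τ) (hβ : Integrable (fun ω => ((1 + ‖τ ω‖) ^ m)⁻¹ • β ω) μ)
    {x : Euc n} {r : ℝ} (hr : 0 < r) (hfar : ∀ ω, β ω ≠ 0 → r ≤ ‖x - τ ω‖) :
    Integrable (fun ω => κ (x - τ ω) (β ω)) μ := by
  obtain ⟨C, hC0, hC⟩ := hκ.exists_bound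
  exact (hβ.norm.const_mul (C * (1 + (1 + ‖x‖) / r) ^ d)).mono'
    (hκ.aestronglyMeasurable_apply hτ (aestronglyMeasurable_of_weight hτ hβ) x)
    (.of_forall fun ω => norm_apply_le hC0 hC hr hmd (hfar ω))

/-- The derivative of a kernel with values in operators, acting on the same densities. -/
theorem IsHomKernel.fderiv_flip {κ : Euc n → V →L[ℝ] W} (hκ : IsHomKernel d κ) :
    IsHomKernel (d + 1) (fun z => (_root_.fderiv ℝ κ z).flip) := by
  exact IsHomKernel.clm_comp (W := Euc n →L[ℝ] V →L[ℝ] W) (W' := V →L[ℝ] Euc n →L[ℝ] W) hκ.fderiv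
    (ContinuousLinearMap.flipₗᵢ ℝ (Euc n) V W).toContinuousLinearEquiv.toContinuousLinearMap

/-- Differentiation under the integral sign, at points away from the carrier of the density. -/
theorem IsHomKernel.hasFDerivAt_integral {κ : Euc n → V →L[ℝ] W}
    (hκ : IsHomKernel d κ) (hmd : m ≤ d) (hτ : Measurable τ)
    (hβ : Integrable (fun ω => ((1 + ‖τ ω‖) ^ m)⁻¹ • β ω) μ)
    {x₀ : Euc n} {r : ℝ} (hr : 0 < r) (hfar : ∀ ω, β ω ≠ 0 → r ≤ ‖x₀ - τ ω‖) :
    HasFDerivAt (fun x => ∫ ω, κ (x - τ ω) (β ω) ∂μ)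
      (∫ ω, (_root_.fderiv ℝ κ (x₀ - τ ω)).flip (β ω) ∂μ) x₀ := by
  obtain ⟨C, hC0, hC⟩ := hκ.fderiv_flip.exists_bound
  have hm := aestronglyMeasurable_of_weight hτ hβ
  have hfar' : ∀ x ∈ Metric.ball x₀ (r / 2), ∀ ω, β ω ≠ 0 → r / 2 ≤ ‖x - τ ω‖ := by
    intro x hx ω hω
    have h1 := hfar ω hω
    have h2 : ‖x₀ - τ ω‖ ≤ ‖x₀ - x‖ + ‖x - τ ω‖ := norm_sub_le_norm_sub_add_norm_sub _ _ _
    rw [Metric.mem_ball', dist_eq_norm] at hx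
    linarith
  refine hasFDerivAt_integral_of_dominated_of_fderiv_le
    (F' := fun x ω => (_root_.fderiv ℝ κ (x - τ ω)).flip (β ω))
    (bound := fun ω => C * (1 + (1 + (‖x₀‖ + r / 2)) / (r / 2)) ^ (d + 1) *
      ‖((1 + ‖τ ω‖) ^ m)⁻¹ • β ω‖)
    (Metric.ball_mem_nhds x₀ (half_pos hr))
    (.of_forall fun x => hκ.aestronglyMeasurable_apply hτ hm x)
    (hκ.integrable_apply hmd hτ hβ hr hfar)
    (hκ.fderiv_flip.aestronglyMeasurable_apply hτ hm x₀) ?_ (hβ.norm.const_mul _) ?_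
  · refine .of_forall fun ω x hx => ?_
    refine (norm_apply_le hC0 hC (half_pos hr) (hmd.trans (Nat.le_succ d))
      (hfar' x hx ω)).trans ?_
    have hx' : ‖x‖ ≤ ‖x₀‖ + r / 2 := by
      rw [Metric.mem_ball, dist_eq_norm] at hx
      have := norm_le_norm_add_norm_sub x₀ x
      rw [norm_sub_rev] at this
      linarith
    gcongr
  · refine .of_forall fun ω x hx => ?_
    rcases eq_or_ne (β ω) 0 with h0 | h0
    · simp only [h0, map_zero]
      exact hasFDerivAt_const _ _
    · have hz : x - τ ω ≠ 0 := norm_pos_iff.1 ((half_pos hr).trans_le (hfar' x hx ω h0))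
      have h1 : HasFDerivAt (fun x => κ (x - τ ω)) (_root_.fderiv ℝ κ (x - τ ω)) x := by
        have := (hκ.differentiableAt hz).hasFDerivAt.comp x ((hasFDerivAt_id x).sub_const (τ ω))
        rwa [ContinuousLinearMap.comp_id] at this
      convert h1.clm_apply (hasFDerivAt_const (β ω) x) using 1
      ext v
      simp

/-- On an open set that the carrier of the density avoids, the integral is a smooth function. The
spaces live in `Type` because the induction replaces `W` by `Euc n →L[ℝ] W`. -/
theorem IsHomKernel.contDiffOn_integral {V W : Type} [NormedAddCommGroup V] [NormedSpace ℝ V]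
    [NormedAddCommGroup W] [NormedSpace ℝ W] {β : Ω → V} {κ : Euc n → V →L[ℝ] W}
    (hκ : IsHomKernel d κ) (hmd : m ≤ d) (hτ : Measurable τ)
    (hβ : Integrable (fun ω => ((1 + ‖τ ω‖) ^ m)⁻¹ • β ω) μ)
    {O : Set (Euc n)} (hO : IsOpen O) (hfar : ∀ ω, β ω ≠ 0 → τ ω ∉ O) (N : ℕ) :
    ContDiffOn ℝ N (fun x => ∫ ω, κ (x - τ ω) (β ω) ∂μ) O := by
  have hfar' : ∀ x ∈ O, ∃ r > 0, ∀ ω, β ω ≠ 0 → r ≤ ‖x - τ ω‖ := by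
    intro x hx
    obtain ⟨r, hr, hb⟩ := Metric.isOpen_iff.1 hO x hx
    refine ⟨r, hr, fun ω hω => ?_⟩
    by_contra! h
    exact hfar ω hω (hb (by rwa [Metric.mem_ball', dist_eq_norm]))
  induction N generalizing W d with
  | zero =>
    refine contDiffOn_zero.2 fun x hx => ?_
    obtain ⟨r, hr, h⟩ := hfar' x hx
    exact (hκ.hasFDerivAt_integral hmd hτ hβ hr h).continuousAt.continuousWithinAt
  | succ N ih =>
    have hd : ∀ x ∈ O, HasFDerivAt (fun x => ∫ ω, κ (x - τ ω) (β ω) ∂μ)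
      (∫ ω, (_root_.fderiv ℝ κ (x - τ ω)).flip (β ω) ∂μ) x := fun x hx => by
      obtain ⟨r, hr, h⟩ := hfar' x hx
      exact hκ.hasFDerivAt_integral hmd hτ hβ hr h
    rw [Nat.cast_succ, contDiffOn_succ_iff_fderiv_of_isOpen hO]
    refine ⟨fun x hx => (hd x hx).differentiableAt.differentiableWithinAt, by simp, ?_⟩
    exact (ih hκ.fderiv_flip (hmd.trans (Nat.le_succ d))).congr fun x hx => (hd x hx).fderiv

end Kernels

/-! ### Newtonian potentials of locally bounded densities -/

section Potentials

/-- Densities with convergent Newtonian potentials: integrable against the weight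
`(1 + |y|) ^ (-(n - 2))` and locally bounded. -/
structure IsAdmissible {n : ℕ} {V : Type*} [NormedAddCommGroup V] [NormedSpace ℝ V]
    (β : Euc n → V) : Prop where
  integrable : Integrable fun y => ((1 + ‖y‖) ^ (n - 2))⁻¹ • β y
  bounded : ∀ r : ℝ, ∃ M, ∀ y, ‖y‖ ≤ r → ‖β y‖ ≤ M

/-- The Newtonian potential `∫ β(y) / |x - y| ^ (n - 2) dy` over the whole space. -/
def newtonPot {n : ℕ} {V : Type*} [NormedAddCommGroup V] [NormedSpace ℝ V] (β : Euc n → V)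
    (x : Euc n) : V :=
  ∫ y, newton (x - y) • β y

/-- The gradient of the Newtonian potential, computed under the integral sign. -/
def newtonGrad {n : ℕ} {V : Type*} [NormedAddCommGroup V] [NormedSpace ℝ V] (β : Euc n → V)
    (x : Euc n) : Euc n →L[ℝ] V :=
  ∫ y, (fderiv ℝ newton (x - y)).smulRight (β y)

variable {n d m : ℕ} {V W : Type*} [NormedAddCommGroup V] [NormedSpace ℝ V]
  [NormedAddCommGroup W] [NormedSpace ℝ W] {β : Euc n → V}

theorem IsAdmissible.aestronglyMeasurable (hβ : IsAdmissible β) :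
    AEStronglyMeasurable β volume :=
  aestronglyMeasurable_of_weight measurable_id hβ.integrable

theorem IsAdmissible.indicator (hβ : IsAdmissible β) {s : Set (Euc n)} (hs : MeasurableSet s) :
    IsAdmissible (s.indicator β) where
  integrable := by
    refine (hβ.integrable.indicator hs).congr (.of_forall fun y => ?_)
    by_cases hy : y ∈ s <;> simp [hy]
  bounded r := by
    obtain ⟨M, hM⟩ := hβ.bounded r
    exact ⟨M, fun y hy => (norm_indicator_le_norm_self _ _).trans (hM y hy)⟩

theorem IsAdmissible.add {β' : Euc n → V} (hβ : IsAdmissible β) (hβ' : IsAdmissible β') :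
    IsAdmissible (β + β') where
  integrable := by simpa [smul_add] using! hβ.integrable.add hβ'.integrable
  bounded r := by
    obtain ⟨M, hM⟩ := hβ.bounded r
    obtain ⟨M', hM'⟩ := hβ'.bounded r
    exact ⟨M + M', fun y hy => (norm_add_le _ _).trans (add_le_add (hM y hy) (hM' y hy))⟩

theorem IsAdmissible.clm_comp (hβ : IsAdmissible β) (L : V →L[ℝ] W) :
    IsAdmissible (fun y => L (β y)) where
  integrable := by simpa using L.integrable_comp hβ.integrable
  bounded r := by
    obtain ⟨M, hM⟩ := hβ.bounded r
    exact ⟨‖L‖ * M, fun y hy => (L.le_opNorm _).trans (by gcongr; exact hM y hy)⟩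

/-- A continuous function is locally bounded. -/
theorem IsAdmissible.of_continuous (hc : Continuous β)
    (hi : Integrable fun y => ((1 + ‖y‖) ^ (n - 2))⁻¹ • β y) : IsAdmissible β where
  integrable := hi
  bounded r := by
    obtain ⟨M, hM⟩ := (isCompact_closedBall (0 : Euc n) r).exists_bound_of_continuousOn
      hc.continuousOn
    exact ⟨M, fun y hy => hM y (by simpa using hy)⟩

theorem continuous_weight : Continuous fun y : Euc n => ((1 + ‖y‖) ^ m)⁻¹ :=
  ((continuous_const.add continuous_norm).pow _).inv₀ fun y => by
    have h : (0 : ℝ) < 1 + ‖y‖ := by positivity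
    exact pow_ne_zero _ h.ne'

theorem IsAdmissible.of_hasCompactSupport (hc : Continuous β) (hs : HasCompactSupport β) :
    IsAdmissible β :=
  .of_continuous hc ((continuous_weight.smul hc).integrable_of_hasCompactSupport hs.smul_left)

theorem nontrivial_euc (hn : 0 < n) : Nontrivial (Euc n) := by
  have : Nonempty (Fin n) := ⟨⟨0, hn⟩⟩
  infer_instance

theorem integrableOn_inv_norm_pow (hd : d < n) (r : ℝ) :
    IntegrableOn (fun z : Euc n => (‖z‖ ^ d)⁻¹) (Metric.ball 0 r) := by
  have := nontrivial_euc (Nat.zero_lt_of_lt hd)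
  refine (integrableOn_fun_norm_addHaar volume (f := fun y : ℝ => (y ^ d)⁻¹)).2 ?_
  have h : IntegrableOn (fun y : ℝ => y ^ (n - 1 - d)) (Ioo 0 r) :=
    ((continuous_pow (n - 1 - d)).continuousOn.integrableOn_compact isCompact_Icc).mono_set
      Ioo_subset_Icc_self
  refine h.congr_fun (fun y hy => ?_) measurableSet_Ioo
  have hy0 : y ^ d ≠ 0 := pow_ne_zero _ hy.1.ne'
  simp only [finrank_euclideanSpace_fin, smul_eq_mul]
  rw [eq_mul_inv_iff_mul_eq₀ hy0, ← pow_add]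
  congr 1
  omega

/-- The integral of `1 / |z| ^ d` over a ball about the origin. -/
def ballIntegral (n d : ℕ) (r : ℝ) : ℝ := ∫ z in Metric.ball (0 : Euc n) r, (‖z‖ ^ d)⁻¹

theorem tendsto_ballIntegral (hd : d < n) :
    Tendsto (fun r => ballIntegral n d (2 * r)) (𝓝 0) (𝓝 0) := by
  have := nontrivial_euc (Nat.zero_lt_of_lt hd)
  have hi := (integrable_indicator_iff Metric.isOpen_ball.measurableSet).2
    (integrableOn_inv_norm_pow hd 1)
  have hv : Tendsto (volume ∘ fun r => Metric.ball (0 : Euc n) (2 * r)) (𝓝 (0 : ℝ)) (𝓝 0) := by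
    have h1 : Tendsto (fun r : ℝ => ENNReal.ofReal ((2 * r) ^ n) *
        volume (Metric.ball (0 : Euc n) 1)) (𝓝 0) (𝓝 0) := by
      have h2 : Tendsto (fun r : ℝ => ENNReal.ofReal ((2 * r) ^ n)) (𝓝 0) (𝓝 0) := by
        have : Continuous fun r : ℝ => ENNReal.ofReal ((2 * r) ^ n) :=
          ENNReal.continuous_ofReal.comp (by fun_prop)
        have h := this.tendsto 0
        simpa [(Nat.zero_lt_of_lt hd).ne'] using h
      have := ENNReal.Tendsto.mul_const (b := volume (Metric.ball (0 : Euc n) 1)) h2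
        (Or.inr measure_ball_lt_top.ne)
      simpa using this
    refine tendsto_of_tendsto_of_tendsto_of_le_of_le tendsto_const_nhds h1
      (fun r => zero_le) (fun r => ?_)
    rcases le_or_gt (2 * r) 0 with hr | hr
    · simp [Metric.ball_eq_empty.2 hr]
    · have := Measure.addHaar_ball (volume : Measure (Euc n)) 0 hr.le
      simp only [finrank_euclideanSpace_fin] at this
      exact this.le
  refine (hi.tendsto_setIntegral_nhds_zero hv).congr' ?_
  have : ∀ᶠ r : ℝ in 𝓝 0, 2 * r < 1 := by
    have h : Continuous fun r : ℝ => 2 * r := by fun_prop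
    exact h.continuousAt.eventually_lt continuousAt_const (by simp)
  filter_upwards [this] with r hr
  refine setIntegral_congr_fun Metric.isOpen_ball.measurableSet fun z hz => ?_
  exact indicator_of_mem (Metric.ball_subset_ball hr.le hz) _

theorem integrable_indicator_ball_inv_norm_sub_pow (hd : d < n) {x₀ x : Euc n} (r : ℝ) :
    Integrable ((Metric.ball x₀ r).indicator fun y => (‖x - y‖ ^ d)⁻¹) := by
  rw [integrable_indicator_iff Metric.isOpen_ball.measurableSet]
  have h1 : Integrable (fun y => (Metric.ball (0 : Euc n) (r + dist x x₀)).indicator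
      (fun z => (‖z‖ ^ d)⁻¹) (x - y)) :=
    ((integrable_indicator_iff Metric.isOpen_ball.measurableSet).2
      (integrableOn_inv_norm_pow hd _)).comp_sub_left x
  refine h1.integrableOn.congr_fun (fun y hy => ?_) Metric.isOpen_ball.measurableSet
  refine indicator_of_mem ?_ _
  have h2 := dist_triangle x x₀ y
  rw [Metric.mem_ball'] at hy
  rw [mem_ball_zero_iff, ← dist_eq_norm]
  linarith

theorem integral_indicator_ball_inv_norm_sub_pow_le (hd : d < n) {x₀ x : Euc n} {r : ℝ}
    (hx : dist x x₀ ≤ r) :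
    ∫ y, (Metric.ball x₀ r).indicator (fun y => (‖x - y‖ ^ d)⁻¹) y ≤ ballIntegral n d (2 * r) := by
  rw [ballIntegral, ← integral_indicator Metric.isOpen_ball.measurableSet,
    ← integral_sub_left_eq_self (μ := volume)
      ((Metric.ball (0 : Euc n) (2 * r)).indicator fun z => (‖z‖ ^ d)⁻¹) x]
  refine integral_mono (integrable_indicator_ball_inv_norm_sub_pow hd r)
    (((integrable_indicator_iff Metric.isOpen_ball.measurableSet).2
      (integrableOn_inv_norm_pow hd _)).comp_sub_left x) fun y => ?_
  by_cases hy : y ∈ Metric.ball x₀ r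
  · have h2 := dist_triangle x x₀ y
    have : x - y ∈ Metric.ball (0 : Euc n) (2 * r) := by
      rw [mem_ball_zero_iff, ← dist_eq_norm]
      rw [Metric.mem_ball'] at hy
      linarith
    simp [hy, this]
  · simp only [hy, not_false_eq_true, indicator_of_notMem]
    exact indicator_nonneg (fun z _ => by positivity) _

theorem hasDerivAt_inv_pow {x : ℝ} (hx : x ≠ 0) (m : ℕ) :
    HasDerivAt (fun x : ℝ => (x ^ m)⁻¹) (-(m * (x ^ (m + 1))⁻¹)) x := by
  refine ((hasDerivAt_pow m x).inv (pow_ne_zero _ hx)).congr_deriv ?_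
  rcases m with _ | m
  · simp
  · rw [add_tsub_cancel_right, neg_div, neg_inj, div_eq_iff (by positivity), mul_assoc, ← pow_mul]
    congr 1
    rw [eq_comm, inv_mul_eq_iff_eq_mul₀ (by positivity), ← pow_add]
    congr 1
    ring

theorem abs_inv_pow_sub_inv_pow_le {u v : ℝ} (hu : 0 < u) (hv : 0 < v) (m : ℕ) :
    |(u ^ m)⁻¹ - (v ^ m)⁻¹| ≤ m * |u - v| * ((u ^ (m + 1))⁻¹ + (v ^ (m + 1))⁻¹) := by
  wlog h : u ≤ v generalizing u v
  · have := this hv hu (le_of_not_ge h)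
    rwa [abs_sub_comm, abs_sub_comm u v, add_comm (u ^ (m + 1))⁻¹]
  have h1 : ∀ x ∈ Icc u v, HasDerivWithinAt (fun x : ℝ => (x ^ m)⁻¹)
      (-(m * (x ^ (m + 1))⁻¹)) (Icc u v) x := fun x hx =>
    (hasDerivAt_inv_pow (hu.trans_le hx.1).ne' m).hasDerivWithinAt
  have h2 : ∀ x ∈ Icc u v, ‖-(m * (x ^ (m + 1))⁻¹)‖ ≤ m * (u ^ (m + 1))⁻¹ := by
    intro x hx
    have hx0 := hu.trans_le hx.1
    rw [norm_neg, Real.norm_of_nonneg (by positivity)]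
    have := hx.1
    gcongr
  have h3 := (convex_Icc u v).norm_image_sub_le_of_norm_hasDerivWithin_le h1 h2
    (left_mem_Icc.2 h) (right_mem_Icc.2 h)
  rw [abs_sub_comm]
  refine h3.trans ?_
  rw [Real.norm_eq_abs, abs_sub_comm v u]
  have : 0 ≤ (v ^ (m + 1))⁻¹ := by positivity
  have h4 : 0 ≤ (m : ℝ) * |u - v| := by positivity
  nlinarith

theorem abs_newton_sub_newton_le {a b : Euc n} (ha : a ≠ 0) (hb : b ≠ 0) :
    |newton a - newton b| ≤ (n - 2 : ℕ) * ‖a - b‖ *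
      ((‖a‖ ^ (n - 2 + 1))⁻¹ + (‖b‖ ^ (n - 2 + 1))⁻¹) := by
  refine (abs_inv_pow_sub_inv_pow_le (norm_pos_iff.2 ha) (norm_pos_iff.2 hb) (n - 2)).trans ?_
  gcongr
  exact abs_norm_sub_norm_le a b

/-- A kernel of degree `-d` with `n - 2 ≤ d < n` is integrable against an admissible density. -/
theorem IsHomKernel.integrable_apply_of_lt {κ : Euc n → V →L[ℝ] W} (hκ : IsHomKernel d κ)
    (hd : n - 2 ≤ d) (hdn : d < n) (hβ : IsAdmissible β) (x : Euc n) :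
    Integrable (fun y => κ (x - y) (β y)) := by
  have := nontrivial_euc (Nat.zero_lt_of_lt hdn)
  have hB : MeasurableSet (Metric.ball x 1) := Metric.isOpen_ball.measurableSet
  obtain ⟨C, hC0, hC⟩ := hκ.exists_bound
  obtain ⟨M, hM⟩ := hβ.bounded (‖x‖ + 1)
  have h1 : Integrable (fun y => κ (x - y) ((Metric.ball x 1).indicator β y)) := by
    refine ((integrable_indicator_ball_inv_norm_sub_pow hdn 1 (x := x) (x₀ := x)).const_mul
      (C * M)).mono' (hκ.aestronglyMeasurable_apply measurable_id
        (hβ.indicator hB).aestronglyMeasurable x) ?_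
    filter_upwards [Measure.ae_ne volume x] with y hy
    by_cases hyB : y ∈ Metric.ball x 1
    · have hz : x - y ≠ 0 := sub_ne_zero.2 hy.symm
      have hyn : ‖y‖ ≤ ‖x‖ + 1 := by
        rw [Metric.mem_ball, dist_eq_norm] at hyB
        have := norm_le_norm_add_norm_sub x y
        rw [norm_sub_rev] at this
        linarith
      simp only [hyB, indicator_of_mem]
      calc ‖κ (x - y) (β y)‖ ≤ ‖κ (x - y)‖ * ‖β y‖ := (κ (x - y)).le_opNorm _
        _ ≤ (C * (‖x - y‖ ^ d)⁻¹) * M := by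
          have := hM y hyn
          gcongr
          exact hC _ hz
        _ = _ := by ring
    · simp [hyB]
  have h2 : Integrable (fun y => κ (x - y) ((Metric.ball x 1)ᶜ.indicator β y)) := by
    refine hκ.integrable_apply hd measurable_id (hβ.indicator hB.compl).integrable one_pos
      fun y hy => ?_
    have : y ∈ (Metric.ball x 1)ᶜ := by
      by_contra h
      simp [indicator_of_notMem h] at hy
    simpa [dist_eq_norm, norm_sub_rev] using this
  refine (h1.add h2).congr (.of_forall fun y => ?_)
  by_cases hy : y ∈ Metric.ball x 1 <;> simp [hy]

/-- The kernel `1 / |z| ^ (n - 2)` as a multiple of the identity operator. -/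
def newtonOp (V : Type*) [NormedAddCommGroup V] [NormedSpace ℝ V] (z : Euc n) : V →L[ℝ] V :=
  newton z • ContinuousLinearMap.id ℝ V

theorem isHomKernel_newtonOp : IsHomKernel (n - 2) (newtonOp V (n := n)) :=
  isHomKernel_newton.clm_comp
    ((ContinuousLinearMap.id ℝ ℝ).smulRight (ContinuousLinearMap.id ℝ V))

theorem isHomKernel_newtonGradOp : IsHomKernel (n - 2 + 1)
    (fun z : Euc n => (ContinuousLinearMap.smulRightL ℝ (Euc n) V) (fderiv ℝ newton z)) :=
  IsHomKernel.clm_comp (W := Euc n →L[ℝ] ℝ) (W' := V →L[ℝ] Euc n →L[ℝ] V) isHomKernel_newton.fderiv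
    (ContinuousLinearMap.smulRightL ℝ (Euc n) V)

theorem fderiv_newtonOp_flip {z : Euc n} (hz : z ≠ 0) (b : V) :
    (fderiv ℝ (newtonOp V) z).flip b = (fderiv ℝ newton z).smulRight b := by
  have h : HasFDerivAt (newtonOp V)
      ((fderiv ℝ newton z).smulRight (ContinuousLinearMap.id ℝ V)) z :=
    HasFDerivAt.smul_const (𝕜' := ℝ) (F := V →L[ℝ] V)
      (isHomKernel_newton.differentiableAt hz).hasFDerivAt _
  rw [h.fderiv]
  ext v
  simp

theorem IsAdmissible.integrable_newton_smul (hn : 3 ≤ n) (hβ : IsAdmissible β) (x : Euc n) :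
    Integrable (fun y => newton (x - y) • β y) :=
  isHomKernel_newtonOp.integrable_apply_of_lt le_rfl (by omega) hβ x

theorem IsAdmissible.integrable_newtonGrad (hn : 3 ≤ n) (hβ : IsAdmissible β) (x : Euc n) :
    Integrable (fun y => (fderiv ℝ newton (x - y)).smulRight (β y)) :=
  isHomKernel_newtonGradOp.integrable_apply_of_lt (Nat.le_succ _) (by omega) hβ x

theorem newtonPot_add (hn : 3 ≤ n) {β' : Euc n → V} (hβ : IsAdmissible β)
    (hβ' : IsAdmissible β') (x : Euc n) :
    newtonPot (β + β') x = newtonPot β x + newtonPot β' x := by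
  rw [newtonPot, newtonPot, newtonPot,
    ← integral_add (hβ.integrable_newton_smul hn x) (hβ'.integrable_newton_smul hn x)]
  simp

theorem newtonGrad_add (hn : 3 ≤ n) {β' : Euc n → V} (hβ : IsAdmissible β)
    (hβ' : IsAdmissible β') (x : Euc n) :
    newtonGrad (β + β') x = newtonGrad β x + newtonGrad β' x := by
  rw [newtonGrad, newtonGrad, newtonGrad,
    ← integral_add (hβ.integrable_newtonGrad hn x) (hβ'.integrable_newtonGrad hn x)]
  refine integral_congr_ae (.of_forall fun y => ?_)
  ext v
  simp

/-- Away from the carrier of the density, the potential can be differentiated under the integral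
sign. -/
theorem hasFDerivAt_newtonPot_of_far (hβ : IsAdmissible β) {x₀ : Euc n} {r : ℝ}
    (hr : 0 < r) (hfar : ∀ y, β y ≠ 0 → r ≤ ‖x₀ - y‖) :
    HasFDerivAt (newtonPot β) (newtonGrad β x₀) x₀ := by
  have h := isHomKernel_newtonOp.hasFDerivAt_integral le_rfl measurable_id hβ.integrable hr hfar
  convert! h using 1
  refine integral_congr_ae (.of_forall fun y => ?_)
  rcases eq_or_ne (β y) 0 with h0 | h0
  · ext v
    simp [h0]
  · exact (fderiv_newtonOp_flip (norm_pos_iff.1 (hr.trans_le (hfar y h0))) _).symm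

/-- The Newtonian potential of a density carried by a small ball is Lipschitz with a small
constant. -/
theorem norm_newtonPot_sub_le (hn : 3 ≤ n) (hβ : IsAdmissible β) {x₀ x : Euc n} {r M : ℝ}
    (hM0 : 0 ≤ M) (hx : dist x x₀ < r) (hM : ∀ y ∈ Metric.ball x₀ r, ‖β y‖ ≤ M)
    (hsupp : ∀ y ∉ Metric.ball x₀ r, β y = 0) :
    ‖newtonPot β x - newtonPot β x₀‖ ≤
      (n - 2 : ℕ) * M * (2 * ballIntegral n (n - 2 + 1) (2 * r)) * ‖x - x₀‖ := by
  have := nontrivial_euc (n := n) (by omega)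
  have hd : n - 2 + 1 < n := by omega
  have hr : 0 ≤ r := dist_nonneg.trans hx.le
  rw [newtonPot, newtonPot, ← integral_sub (hβ.integrable_newton_smul hn x)
    (hβ.integrable_newton_smul hn x₀)]
  have hi1 := integrable_indicator_ball_inv_norm_sub_pow hd r (x := x) (x₀ := x₀)
  have hi2 := integrable_indicator_ball_inv_norm_sub_pow hd r (x := x₀) (x₀ := x₀)
  have hb := norm_integral_le_of_norm_le
    (f := fun y => newton (x - y) • β y - newton (x₀ - y) • β y)
    ((hi1.add hi2).const_mul ((n - 2 : ℕ) * M * ‖x - x₀‖)) ?_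
  · refine hb.trans ?_
    rw [integral_const_mul]
    have h1 := integral_indicator_ball_inv_norm_sub_pow_le hd hx.le
    have h2 := integral_indicator_ball_inv_norm_sub_pow_le hd (x₀ := x₀) (x := x₀) (r := r)
      (by simpa using hr)
    have h3 := integral_add hi1 hi2
    simp only [Pi.add_apply]
    rw [h3]
    calc (n - 2 : ℕ) * M * ‖x - x₀‖ * _ ≤ (n - 2 : ℕ) * M * ‖x - x₀‖ *
        (ballIntegral n (n - 2 + 1) (2 * r) + ballIntegral n (n - 2 + 1) (2 * r)) := by gcongr
      _ = _ := by ring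
  · filter_upwards [Measure.ae_ne volume x, Measure.ae_ne volume x₀] with y hy hy₀
    by_cases hyB : y ∈ Metric.ball x₀ r
    · rw [← sub_smul, norm_smul, Real.norm_eq_abs]
      have h1 := abs_newton_sub_newton_le (sub_ne_zero.2 hy.symm) (sub_ne_zero.2 hy₀.symm)
      have h2 := hM y hyB
      simp only [Pi.add_apply, hyB, indicator_of_mem]
      rw [sub_sub_sub_cancel_right] at h1
      calc _ ≤ ((n - 2 : ℕ) * ‖x - x₀‖ * ((‖x - y‖ ^ (n - 2 + 1))⁻¹ +
            (‖x₀ - y‖ ^ (n - 2 + 1))⁻¹)) * M := by gcongr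
        _ = _ := by ring
    · simp [hsupp y hyB, hyB]

/-- The gradient of the potential of a density carried by a small ball is small at the centre. -/
theorem exists_norm_newtonGrad_le (hn : 3 ≤ n) : ∃ C, 0 ≤ C ∧
    ∀ (β : Euc n → V) (x₀ : Euc n) (r M : ℝ), 0 < r → 0 ≤ M →
      (∀ y ∈ Metric.ball x₀ r, ‖β y‖ ≤ M) → (∀ y ∉ Metric.ball x₀ r, β y = 0) →
      ‖newtonGrad β x₀‖ ≤ C * M * ballIntegral n (n - 2 + 1) (2 * r) := by
  have := nontrivial_euc (n := n) (by omega)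
  have hd : n - 2 + 1 < n := by omega
  obtain ⟨C, hC0, hC⟩ := (isHomKernel_newton (n := n)).fderiv.exists_bound
  refine ⟨C, hC0, fun β x₀ r M hr hM0 hM hsupp => ?_⟩
  have hi := integrable_indicator_ball_inv_norm_sub_pow hd r (x := x₀) (x₀ := x₀)
  have hb := norm_integral_le_of_norm_le (f := fun y => (fderiv ℝ newton (x₀ - y)).smulRight (β y))
    (hi.const_mul (C * M)) ?_
  · refine hb.trans ?_
    rw [integral_const_mul]
    have := integral_indicator_ball_inv_norm_sub_pow_le hd (x₀ := x₀) (x := x₀) (r := r)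
      (by simpa using hr.le)
    gcongr
  · filter_upwards [Measure.ae_ne volume x₀] with y hy
    by_cases hyB : y ∈ Metric.ball x₀ r
    · rw [ContinuousLinearMap.norm_smulRight_apply]
      have h1 := hC _ (sub_ne_zero.2 hy.symm)
      have h2 := hM y hyB
      simp only [hyB, indicator_of_mem]
      calc _ ≤ (C * (‖x₀ - y‖ ^ (n - 2 + 1))⁻¹) * M := by gcongr
        _ = _ := by ring
    · have : (fderiv ℝ newton (x₀ - y)).smulRight (0 : V) = 0 := by ext; simp
      simp [hsupp y hyB, hyB, this]

/-- The Newtonian potential of an admissible density is differentiable everywhere: the part of the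
density outside a small ball about the point gives a smooth potential, and the part in the ball
contributes to the difference quotients an amount that tends to zero with the radius. -/
theorem IsAdmissible.hasFDerivAt_newtonPot (hn : 3 ≤ n) (hβ : IsAdmissible β) (x₀ : Euc n) :
    HasFDerivAt (newtonPot β) (newtonGrad β x₀) x₀ := by
  obtain ⟨M', hM'⟩ := hβ.bounded (‖x₀‖ + 1)
  obtain ⟨M, hM0, hM⟩ : ∃ M, 0 ≤ M ∧ ∀ y ∈ Metric.ball x₀ 1, ‖β y‖ ≤ M := by
    refine ⟨max M' 0, le_max_right _ _, fun y hy => (hM' y ?_).trans (le_max_left _ _)⟩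
    rw [Metric.mem_ball, dist_eq_norm] at hy
    have := norm_le_norm_add_norm_sub x₀ y
    rw [norm_sub_rev] at this
    linarith
  obtain ⟨C, hC0, hC⟩ := exists_norm_newtonGrad_le (V := V) hn
  rw [hasFDerivAt_iff_isLittleO, Asymptotics.isLittleO_iff]
  intro ε hε
  -- the radius of the ball, chosen so that its part is negligible
  obtain ⟨r, hr0, hr1, hrε⟩ : ∃ r : ℝ, 0 < r ∧ r ≤ 1 ∧
      ((n - 2 : ℕ) * M * 2 + C * M) * ballIntegral n (n - 2 + 1) (2 * r) < ε / 2 := by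
    have h1 := (tendsto_ballIntegral (n := n) (d := n - 2 + 1) (by omega)).const_mul
      ((n - 2 : ℕ) * M * 2 + C * M)
    rw [mul_zero] at h1
    have h2 := (h1.mono_left (nhdsWithin_le_nhds (s := Ioi 0))).eventually_lt_const
      (half_pos hε)
    have h3 : ∀ᶠ r : ℝ in 𝓝[>] 0, r ≤ 1 :=
      nhdsWithin_le_nhds (Iic_mem_nhds one_pos)
    obtain ⟨r, h, h', h''⟩ := (h2.and (h3.and self_mem_nhdsWithin)).exists
    exact ⟨r, h'', h', h⟩
  have hB : MeasurableSet (Metric.ball x₀ r) := Metric.isOpen_ball.measurableSet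
  have hβ1 := hβ.indicator hB
  have hβ2 := hβ.indicator hB.compl
  have hsum : β = (Metric.ball x₀ r).indicator β + (Metric.ball x₀ r)ᶜ.indicator β :=
    (indicator_self_add_compl _ _).symm
  have hM1 : ∀ y ∈ Metric.ball x₀ r, ‖(Metric.ball x₀ r).indicator β y‖ ≤ M := fun y hy => by
    rw [indicator_of_mem hy]
    exact hM y (Metric.ball_subset_ball hr1 hy)
  have hfar : HasFDerivAt (newtonPot ((Metric.ball x₀ r)ᶜ.indicator β))
      (newtonGrad ((Metric.ball x₀ r)ᶜ.indicator β) x₀) x₀ := by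
    refine hasFDerivAt_newtonPot_of_far hβ2 hr0 fun y hy => ?_
    have : y ∈ (Metric.ball x₀ r)ᶜ := by
      by_contra h
      simp [indicator_of_notMem h] at hy
    simpa [dist_eq_norm, norm_sub_rev] using this
  rw [hasFDerivAt_iff_isLittleO, Asymptotics.isLittleO_iff] at hfar
  have hG := hC ((Metric.ball x₀ r).indicator β) x₀ r M hr0 hM0 hM1
    fun y hy => indicator_of_notMem hy _
  filter_upwards [hfar (half_pos hε), Metric.ball_mem_nhds x₀ hr0] with x h2 hx
  have h1 := norm_newtonPot_sub_le hn hβ1 hM0 hx hM1 fun y hy => indicator_of_notMem hy _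
  have h3 := ((newtonGrad ((Metric.ball x₀ r).indicator β) x₀).le_opNorm (x - x₀)).trans
    (mul_le_mul_of_nonneg_right hG (norm_nonneg _))
  -- what remains is the triangle inequality for the two parts
  rw [hsum, newtonPot_add hn hβ1 hβ2, newtonPot_add hn hβ1 hβ2, newtonGrad_add hn hβ1 hβ2]
  generalize newtonPot ((Metric.ball x₀ r).indicator β) x = a at *
  generalize newtonPot ((Metric.ball x₀ r).indicator β) x₀ = a₀ at *
  generalize newtonPot ((Metric.ball x₀ r)ᶜ.indicator β) x = b at *
  generalize newtonPot ((Metric.ball x₀ r)ᶜ.indicator β) x₀ = b₀ at *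
  rw [add_apply]
  generalize newtonGrad ((Metric.ball x₀ r).indicator β) x₀ (x - x₀) = g at *
  generalize newtonGrad ((Metric.ball x₀ r)ᶜ.indicator β) x₀ (x - x₀) = g' at *
  have h4 : a + b - (a₀ + b₀) - (g + g') = (a - a₀) - g + (b - b₀ - g') := by abel
  rw [h4]
  refine (norm_add_le _ _).trans ?_
  have h5 := norm_sub_le (a - a₀) g
  have h6 := mul_le_mul_of_nonneg_right hrε.le (norm_nonneg (x - x₀))
  nlinarith

theorem IsAdmissible.newtonGrad_apply [CompleteSpace V] (hn : 3 ≤ n) (hβ : IsAdmissible β)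
    (x v : Euc n) : newtonGrad β x v = ∫ y, fderiv ℝ newton (x - y) v • β y := by
  rw [newtonGrad, ContinuousLinearMap.integral_apply (hβ.integrable_newtonGrad hn x)]
  rfl

theorem IsAdmissible.integrable_fderiv_newton_smul (hn : 3 ≤ n) (hβ : IsAdmissible β)
    (x v : Euc n) : Integrable fun y => fderiv ℝ newton (x - y) v • β y :=
  (ContinuousLinearMap.apply ℝ V v).integrable_comp (hβ.integrable_newtonGrad hn x)

end Potentials

/-! ### Potentials of derivatives of compactly supported functions -/

section CompactSupport

variable {n : ℕ} {V : Type*} [NormedAddCommGroup V] [NormedSpace ℝ V]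

theorem locallyIntegrable_newton (hn : 3 ≤ n) : LocallyIntegrable (newton (n := n)) volume := by
  refine (locallyIntegrable_iff).2 fun K hK => ?_
  obtain ⟨r, hr⟩ := hK.isBounded.subset_ball (0 : Euc n)
  exact (integrableOn_inv_norm_pow (by omega) r).mono_set hr

/-- For a compactly supported density of class `C^1` the derivative may fall on the density, the
potential being a convolution. -/
theorem hasFDerivAt_newtonPot_of_contDiff (hn : 3 ≤ n) {A : Euc n → V}
    (hA : ContDiff ℝ 1 A) (hs : HasCompactSupport A) (x : Euc n) :
    HasFDerivAt (newtonPot A) (newtonPot (fderiv ℝ A) x) x := by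
  have h := hs.hasFDerivAt_convolution_right (ContinuousLinearMap.lsmul ℝ ℝ)
    (locallyIntegrable_newton hn) hA x
  -- `newtonPot` has the kernel at `x - y`, the convolution at `y`
  have h1 : ∀ {U : Type _} [NormedAddCommGroup U] [NormedSpace ℝ U] (g : Euc n → U) (x : Euc n),
      newtonPot g x = ∫ t, newton t • g (x - t) := fun g x => by
    rw [newtonPot, ← integral_sub_left_eq_self (μ := volume) (fun t => newton t • g (x - t)) x]
    simp
  have h2 : newtonPot A = convolution newton A (ContinuousLinearMap.lsmul ℝ ℝ) volume := by
    ext1 x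
    rw [h1, convolution]
    rfl
  rw [h2]
  convert! h using 1
  rw [h1, convolution]
  rfl

theorem isAdmissible_fderiv {A : Euc n → V}
    (hA : ContDiff ℝ 1 A) (hs : HasCompactSupport A) : IsAdmissible (fderiv ℝ A) :=
  .of_hasCompactSupport (hA.continuous_fderiv one_ne_zero) (hs.fderiv ℝ)

/-- The second derivatives `∂_v ∂_w` of the potential of `A` are symmetric. -/
theorem newtonGrad_fderiv_symm (hn : 3 ≤ n) {A : Euc n → V}
    (hA : ContDiff ℝ 1 A) (hs : HasCompactSupport A) (x v w : Euc n) :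
    newtonGrad (fderiv ℝ A) x v w = newtonGrad (fderiv ℝ A) x w v :=
  second_derivative_symmetric (f := newtonPot A) (f' := newtonPot (fderiv ℝ A))
    (fun y => hasFDerivAt_newtonPot_of_contDiff hn hA hs y)
    ((isAdmissible_fderiv hA hs).hasFDerivAt_newtonPot hn x) v w

theorem hasFDerivAt_norm_of_ne_zero {z : Euc n} (hz : z ≠ 0) :
    HasFDerivAt (fun w : Euc n => ‖w‖) (‖z‖⁻¹ • innerSL ℝ z) z := by
  have h0 : ‖z‖ ≠ 0 := norm_ne_zero_iff.2 hz
  have h := (hasStrictFDerivAt_norm_sq z).hasFDerivAt.sqrt (pow_ne_zero 2 h0)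
  simp only [Real.sqrt_sq (norm_nonneg _)] at h
  convert! h using 1
  ext v
  simp
  field_simp

theorem hasFDerivAt_newton {z : Euc n} (hz : z ≠ 0) : HasFDerivAt newton
    (-((n - 2 : ℕ) * (‖z‖ ^ (n - 2 + 1))⁻¹ * ‖z‖⁻¹) • innerSL ℝ z) z := by
  have h0 : ‖z‖ ≠ 0 := norm_ne_zero_iff.2 hz
  have h1 := hasFDerivAt_norm_of_ne_zero hz
  refine ((hasDerivAt_inv_pow h0 (n - 2)).comp_hasFDerivAt z h1).congr_fderiv ?_
  ext v
  simp
  ring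

theorem fderiv_newton_apply {z : Euc n} (hz : z ≠ 0) (v : Euc n) : fderiv ℝ newton z v =
    -((n - 2 : ℕ) * (‖z‖ ^ (n - 2 + 1))⁻¹ * ‖z‖⁻¹) * inner ℝ z v := by
  rw [(hasFDerivAt_newton hz).fderiv]
  simp

/-- Integration in polar coordinates. -/
theorem integral_polar [Nontrivial (Euc n)] {f : Euc n → V} (hf : Integrable f) :
    ∫ z, f z = ∫ u : Metric.sphere (0 : Euc n) 1,
      (∫ r in Ioi (0 : ℝ), r ^ (n - 1) • f (r • (u : Euc n)))
        ∂(volume : Measure (Euc n)).toSphere := by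
  set μ : Measure (Euc n) := volume
  have hmp := μ.measurePreserving_homeomorphUnitSphereProd
  let g : Metric.sphere (0 : Euc n) 1 × Ioi (0 : ℝ) → V := fun p => f (p.2.1 • p.1.1)
  have hg : ∀ z : ({0}ᶜ : Set (Euc n)), g (homeomorphUnitSphereProd (Euc n) z) = f z := by
    intro z
    have hz : ‖(z : Euc n)‖ ≠ 0 := norm_ne_zero_iff.2 z.2
    simp [g, smul_smul, hz]
  have hgi : Integrable g (μ.toSphere.prod (.volumeIoiPow (n - 1))) := by
    have h := hmp.integrable_comp_emb (g := g) (Homeomorph.measurableEmbedding _)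
    rw [finrank_euclideanSpace_fin] at h
    refine h.1 ?_
    have h2 : g ∘ homeomorphUnitSphereProd (Euc n) = f ∘ Subtype.val := funext hg
    rw [h2, ← integrableOn_iff_comap_subtypeVal (measurableSet_singleton _).compl]
    exact hf.integrableOn
  calc ∫ z, f z = ∫ z : ({0}ᶜ : Set (Euc n)), f z.1 ∂(μ.comap (↑)) := by
        rw [integral_subtype_comap (measurableSet_singleton _).compl f,
          restrict_compl_singleton]
    _ = ∫ p, g p ∂μ.toSphere.prod (.volumeIoiPow (n - 1)) := by
        have h := hmp.integral_comp (Homeomorph.measurableEmbedding _) g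
        rw [finrank_euclideanSpace_fin] at h
        rw [← h]
        exact integral_congr_ae (.of_forall fun z => (hg z).symm)
    _ = _ := by
        rw [integral_prod g hgi]
        refine integral_congr_ae (.of_forall fun u => ?_)
        simp only [Measure.volumeIoiPow, ENNReal.ofReal, g]
        rw [integral_withDensity_eq_integral_smul,
          integral_subtype_comap measurableSet_Ioi
            fun a : ℝ => Real.toNNReal (a ^ (n - 1)) • f (a • (u : Euc n)),
          setIntegral_congr_fun measurableSet_Ioi fun x hx => ?_]
        · rw [NNReal.smul_def, Real.coe_toNNReal _ (pow_nonneg (le_of_lt hx) _)]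
        · exact (measurable_subtype_coe.pow_const _).real_toNNReal

theorem sum_inner_basisVec (z : Euc n) {U : Type*} [NormedAddCommGroup U] [NormedSpace ℝ U]
    (f : Euc n →L[ℝ] U) : ∑ i, inner ℝ z (basisVec i) • f (basisVec i) = f z := by
  conv_rhs => rw [← sum_proj_smulRight_basisVec f]
  simp [basisVec, EuclideanSpace.inner_single_right]

/-- The fundamental theorem of calculus along the ray from `x` in the direction of `-u`. -/
theorem integral_Ioi_fderiv_smul [CompleteSpace V] {A : Euc n → V} (hA : ContDiff ℝ 1 A)
    (hs : HasCompactSupport A) (x u : Euc n) (hu : u ≠ 0) :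
    ∫ r in Ioi (0 : ℝ), fderiv ℝ A (x - r • u) u = A x := by
  have hc : ContDiff ℝ 1 fun r : ℝ => A (x - r • u) := by fun_prop
  have hd : ∀ r : ℝ, deriv (fun r : ℝ => A (x - r • u)) r = -fderiv ℝ A (x - r • u) u := by
    intro r
    have h1 : HasDerivAt (fun r : ℝ => x - r • u) (-u) r := by
      simpa using ((hasDerivAt_id r).smul_const u).const_sub x
    have h2 := (hA.differentiable one_ne_zero (x - r • u)).hasFDerivAt.comp_hasDerivAt r h1
    rw [map_neg] at h2
    exact h2.deriv
  have hcs : HasCompactSupport fun r : ℝ => A (x - r • u) := by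
    have he : Topology.IsClosedEmbedding fun r : ℝ => x - r • u :=
      (Homeomorph.subLeft x).isClosedEmbedding.comp
        (isClosedEmbedding_smul_left hu)
    exact hs.comp_isClosedEmbedding he
  have h := HasCompactSupport.integral_Ioi_deriv_eq hc hcs 0
  simp only [hd, integral_neg, zero_smul, sub_zero, neg_inj] at h
  exact h

/-- The Laplacian of the potential of `A` is `-(n - 2) S_{n-1} A`. In polar coordinates about `x` the
volume factor `r ^ (n - 1)` cancels the singularity of the gradient of the kernel, and what is left
under the integral is the radial derivative of `A`. -/
theorem sum_newtonGrad_fderiv [CompleteSpace V] (hn : 3 ≤ n) {A : Euc n → V}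
    (hA : ContDiff ℝ 1 A) (hs : HasCompactSupport A) (x : Euc n) :
    ∑ i, newtonGrad (fderiv ℝ A) x (basisVec i) (basisVec i) =
      -(((n : ℝ) - 2) * solidAngle n) • A x := by
  have := nontrivial_euc (n := n) (by omega)
  have hadm := isAdmissible_fderiv hA hs
  have hi : ∀ i, Integrable fun y =>
      fderiv ℝ newton (x - y) (basisVec i) • fderiv ℝ A y (basisVec i) := fun i =>
    (ContinuousLinearMap.apply ℝ V (basisVec i)).integrable_comp
      (hadm.integrable_fderiv_newton_smul hn x (basisVec i))
  have h1 : ∀ i, newtonGrad (fderiv ℝ A) x (basisVec i) (basisVec i) =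
      ∫ y, fderiv ℝ newton (x - y) (basisVec i) • fderiv ℝ A y (basisVec i) := fun i => by
    rw [hadm.newtonGrad_apply hn, ContinuousLinearMap.integral_apply
      (hadm.integrable_fderiv_newton_smul hn x (basisVec i))]
    rfl
  have hsum := integrable_finsetSum Finset.univ fun i _ => hi i
  rw [Finset.sum_congr rfl fun i _ => h1 i, ← integral_finsetSum _ fun i _ => hi i]
  -- the integrand as a function of `z = x - y`
  let f : Euc n → V := fun z => ∑ i, fderiv ℝ newton z (basisVec i) • fderiv ℝ A (x - z) (basisVec i)
  have hf : Integrable f := by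
    exact (hsum.comp_sub_left x).congr (.of_forall fun z => by simp [f])
  have h2 : ∫ y, ∑ i, fderiv ℝ newton (x - y) (basisVec i) • fderiv ℝ A y (basisVec i) =
      ∫ z, f z := by
    rw [← integral_sub_left_eq_self (μ := volume) f x]
    simp [f]
  rw [h2, integral_polar hf]
  have h3 : ∀ u : Metric.sphere (0 : Euc n) 1,
      ∫ r in Ioi (0 : ℝ), r ^ (n - 1) • f (r • (u : Euc n)) = -((n : ℝ) - 2) • A x := by
    intro u
    have hu : ‖(u : Euc n)‖ = 1 := by simp
    have hu0 : (u : Euc n) ≠ 0 := norm_ne_zero_iff.1 (by rw [hu]; exact one_ne_zero)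
    rw [← integral_Ioi_fderiv_smul hA hs x u hu0, ← integral_smul]
    refine setIntegral_congr_fun measurableSet_Ioi fun r hr => ?_
    have hr0 : (0 : ℝ) < r := hr
    have hz : r • (u : Euc n) ≠ 0 := smul_ne_zero hr0.ne' hu0
    simp only [f, fderiv_newton_apply hz, mul_smul]
    rw [← Finset.smul_sum, sum_inner_basisVec, map_smul, norm_smul, hu, Real.norm_of_nonneg hr0.le,
      mul_one, smul_smul, smul_smul]
    congr 1
    have hn2 : ((n - 2 : ℕ) : ℝ) = n - 2 := by rw [Nat.cast_sub (by omega)]; simp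
    rw [hn2]
    have : n - 2 + 1 = n - 1 := by omega
    rw [this]
    field_simp
  rw [integral_congr_ae (.of_forall h3), integral_const, solidAngle, smul_smul]
  congr 1
  ring

end CompactSupport

/-! ### Representation of functions vanishing at infinity -/

section Representation

variable {n : ℕ} {V Y Y' U : Type*} [NormedAddCommGroup V] [NormedSpace ℝ V]
  [NormedAddCommGroup Y] [NormedSpace ℝ Y] [NormedAddCommGroup Y'] [NormedSpace ℝ Y']
  [NormedAddCommGroup U] [NormedSpace ℝ U]

/-- `firstOrder a` as a linear function of the derivative. -/
def firstOrderSymbol (a : Fin n → V →L[ℝ] Y) : (Euc n →L[ℝ] V) →L[ℝ] Y :=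
  ∑ h, a h ∘L ContinuousLinearMap.apply ℝ V (basisVec h)

theorem firstOrderSymbol_apply (a : Fin n → V →L[ℝ] Y) (T : Euc n →L[ℝ] V) :
    firstOrderSymbol a T = ∑ h, a h (T (basisVec h)) := by
  simp [firstOrderSymbol]

theorem firstOrder_eq (a : Fin n → V →L[ℝ] Y) (A : Euc n → V) :
    firstOrder a A = fun y => firstOrderSymbol a (fderiv ℝ A y) := by
  ext1 y
  rw [firstOrderSymbol_apply, firstOrder]

theorem continuous_firstOrder (a : Fin n → V →L[ℝ] Y) {A : Euc n → V} (hA : ContDiff ℝ 1 A) :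
    Continuous (firstOrder a A) := by
  rw [firstOrder_eq]
  exact (firstOrderSymbol a).continuous.comp (hA.continuous_fderiv one_ne_zero)

theorem hasCompactSupport_firstOrder (a : Fin n → V →L[ℝ] Y) {A : Euc n → V}
    (hs : HasCompactSupport A) : HasCompactSupport (firstOrder a A) := by
  rw [firstOrder_eq]
  exact (hs.fderiv ℝ).comp_left (map_zero _)

theorem firstOrder_newtonPot (hn : 3 ≤ n) (b : Fin n → Y →L[ℝ] U) {g : Euc n → Y}
    (hg : IsAdmissible g) (x : Euc n) :
    firstOrder b (newtonPot g) x = ∑ i, b i (newtonGrad g x (basisVec i)) := by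
  rw [firstOrder, (hg.hasFDerivAt_newtonPot hn x).fderiv]

theorem newtonGrad_clm_comp [CompleteSpace Y] [CompleteSpace U] (hn : 3 ≤ n) (L : Y →L[ℝ] U)
    {g : Euc n → Y} (hg : IsAdmissible g) (x v : Euc n) :
    newtonGrad (fun y => L (g y)) x v = L (newtonGrad g x v) := by
  rw [(hg.clm_comp L).newtonGrad_apply hn, hg.newtonGrad_apply hn,
    ← ContinuousLinearMap.integral_comp_comm L (hg.integrable_fderiv_newton_smul hn x v)]
  simp

/-- The derivatives of the potential of `a A` in terms of the second derivatives of the potential of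
`A`. -/
theorem newtonGrad_firstOrder [CompleteSpace V] [CompleteSpace Y] (hn : 3 ≤ n)
    (a : Fin n → V →L[ℝ] Y) {A : Euc n → V} (hA : ContDiff ℝ 1 A) (hs : HasCompactSupport A)
    (x v : Euc n) :
    newtonGrad (firstOrder a A) x v =
      ∑ h, a h (newtonGrad (fderiv ℝ A) x v (basisVec h)) := by
  rw [firstOrder_eq, newtonGrad_clm_comp hn _ (isAdmissible_fderiv hA hs), firstOrderSymbol_apply]

/-- A smooth function equal to `1` on the ball of radius `j + 1` and to `0` off the ball of
radius `2 (j + 1)`. -/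
def cutoff (n j : ℕ) (y : Euc n) : ℝ :=
  (⟨1, 2, one_pos, one_lt_two⟩ : ContDiffBump (0 : Euc n)) (((j : ℝ) + 1)⁻¹ • y)

theorem contDiff_cutoff (n j : ℕ) : ContDiff ℝ 1 (cutoff n j) :=
  (ContDiffBump.contDiff _).comp (contDiff_const_smul _)

theorem cutoff_mem_Icc (n j : ℕ) (y : Euc n) : cutoff n j y ∈ Icc (0 : ℝ) 1 :=
  ⟨ContDiffBump.nonneg _, ContDiffBump.le_one _⟩

theorem cutoff_eq_one {n j : ℕ} {y : Euc n} (hy : ‖y‖ ≤ j + 1) : cutoff n j y = 1 := by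
  have hj : (0 : ℝ) < j + 1 := by positivity
  refine ContDiffBump.one_of_mem_closedBall _ ?_
  rw [mem_closedBall_zero_iff, norm_smul, norm_inv, Real.norm_of_nonneg hj.le]
  exact (inv_mul_le_one₀ hj).2 hy

theorem cutoff_eq_zero {n j : ℕ} {y : Euc n} (hy : 2 * ((j : ℝ) + 1) ≤ ‖y‖) :
    cutoff n j y = 0 := by
  have hj : (0 : ℝ) < j + 1 := by positivity
  refine ContDiffBump.zero_of_le_dist _ ?_
  rw [dist_zero_right, norm_smul, norm_inv, Real.norm_of_nonneg hj.le,
    le_inv_mul_iff₀ hj, mul_comm]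
  exact hy

theorem hasCompactSupport_cutoff (n j : ℕ) : HasCompactSupport (cutoff n j) := by
  refine HasCompactSupport.intro (isCompact_closedBall (0 : Euc n) (2 * ((j : ℝ) + 1)))
    fun y hy => cutoff_eq_zero ?_
  rw [mem_closedBall_zero_iff, not_le] at hy
  exact hy.le

theorem exists_norm_fderiv_cutoff_le (n : ℕ) :
    ∃ C, 0 ≤ C ∧ ∀ j y, ‖fderiv ℝ (cutoff n j) y‖ ≤ C * ((j : ℝ) + 1)⁻¹ := by
  let χ : ContDiffBump (0 : Euc n) := ⟨1, 2, one_pos, one_lt_two⟩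
  have hχ : ContDiff ℝ 1 χ := χ.contDiff
  obtain ⟨C, hC⟩ := (hχ.continuous_fderiv one_ne_zero).bounded_above_of_compact_support
    (χ.hasCompactSupport.fderiv ℝ)
  refine ⟨C, (norm_nonneg _).trans (hC 0), fun j y => ?_⟩
  have hj : (0 : ℝ) < j + 1 := by positivity
  have h : fderiv ℝ (cutoff n j) y = ((j : ℝ) + 1)⁻¹ • fderiv ℝ χ (((j : ℝ) + 1)⁻¹ • y) :=
    fderiv_comp_smul _
  rw [h, norm_smul, norm_inv, Real.norm_of_nonneg hj.le, mul_comm]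
  gcongr
  exact hC _

theorem fderiv_cutoff_eq_zero {n j : ℕ} {y : Euc n}
    (hy : ‖y‖ < j + 1 ∨ 2 * ((j : ℝ) + 1) < ‖y‖) : fderiv ℝ (cutoff n j) y = 0 := by
  rcases hy with hy | hy
  · have h : cutoff n j =ᶠ[𝓝 y] fun _ => 1 := by
      filter_upwards [(isOpen_lt continuous_norm continuous_const).mem_nhds hy] with z hz
      exact cutoff_eq_one (le_of_lt hz)
    rw [h.fderiv_eq, fderiv_fun_const, Pi.zero_apply]
  · have h : cutoff n j =ᶠ[𝓝 y] fun _ => 0 := by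
      filter_upwards [(isOpen_lt continuous_const continuous_norm).mem_nhds hy] with z hz
      exact cutoff_eq_zero (le_of_lt hz)
    rw [h.fderiv_eq, fderiv_fun_const, Pi.zero_apply]

theorem firstOrder_smul (a : Fin n → V →L[ℝ] Y) {χ : Euc n → ℝ} {A : Euc n → V} {y : Euc n}
    (hχ : DifferentiableAt ℝ χ y) (hA : DifferentiableAt ℝ A y) :
    firstOrder a (fun y => χ y • A y) y =
      χ y • firstOrder a A y + firstOrderSymbol a ((fderiv ℝ χ y).smulRight (A y)) := by
  rw [firstOrder_eq, firstOrder_eq]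
  dsimp only
  rw [fderiv_fun_smul hχ hA, map_add, map_smul]

theorem exists_norm_fderiv_newton_le (n : ℕ) : ∃ C, 0 ≤ C ∧
    ∀ z : Euc n, z ≠ 0 → ‖fderiv ℝ newton z‖ ≤ C * (‖z‖ ^ (n - 2 + 1))⁻¹ :=
  (isHomKernel_newton (n := n)).fderiv.exists_bound

/-- The contribution of the derivative of the cutoff tends to zero: it is carried by a shell of
volume `O(j ^ n)`, on which the kernel is `O(j ^ (1 - n))` and the derivative `O(j ^ (-1))`. -/
theorem tendsto_newtonGrad_fderiv_cutoff [CompleteSpace Y] (hn : 3 ≤ n) (a : Fin n → V →L[ℝ] Y)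
    {A : Euc n → V} (hA : Continuous A) (hA0 : Tendsto A (cocompact (Euc n)) (𝓝 0))
    (x v : Euc n) :
    Tendsto (fun j : ℕ => newtonGrad
      (fun y => firstOrderSymbol a ((fderiv ℝ (cutoff n j) y).smulRight (A y))) x v)
      atTop (𝓝 0) := by
  obtain ⟨C₁, hC₁0, hC₁⟩ := exists_norm_fderiv_newton_le n
  obtain ⟨C₂, hC₂0, hC₂⟩ := exists_norm_fderiv_cutoff_le n
  set B : ℝ := C₁ * 2 ^ (n - 1) * ‖v‖ * (‖firstOrderSymbol a‖ * C₂) *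
    (2 ^ n * volume.real (Metric.ball (0 : Euc n) 1)) with hB
  have hB0 : 0 ≤ B := by positivity
  have hadm : ∀ j, IsAdmissible
      (fun y => firstOrderSymbol a ((fderiv ℝ (cutoff n j) y).smulRight (A y))) := fun j => by
    have hc := (contDiff_cutoff n j).continuous_fderiv one_ne_zero
    have hc' : Continuous fun y => (fderiv ℝ (cutoff n j) y).smulRight (A y) :=
      ((ContinuousLinearMap.smulRightL ℝ (Euc n) V).continuous.comp hc).clm_apply hA
    refine .of_hasCompactSupport ((firstOrderSymbol a).continuous.comp hc') ?_
    refine ((hasCompactSupport_cutoff n j).fderiv ℝ).mono fun y hy h0 => hy ?_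
    have : ((0 : Euc n →L[ℝ] ℝ).smulRight (A y)) = 0 := by ext; simp
    simp [h0, this]
  have hbound : ∀ ε > 0, ∀ᶠ j : ℕ in atTop, ‖newtonGrad
      (fun y => firstOrderSymbol a ((fderiv ℝ (cutoff n j) y).smulRight (A y))) x v‖ ≤ B * ε := by
    intro ε hε
    have h1 : ∀ᶠ y in cocompact (Euc n), ‖A y‖ < ε := by
      have := hA0.norm
      rw [norm_zero] at this
      exact this.eventually_lt_const hε
    obtain ⟨r, hr⟩ : ∃ r : ℝ, ∀ y : Euc n, r < ‖y‖ → ‖A y‖ < ε := by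
      rw [← Metric.cobounded_eq_cocompact, ← comap_norm_atTop, eventually_comap] at h1
      obtain ⟨r, hr⟩ := eventually_atTop.1 h1
      exact ⟨r, fun y hy => hr _ hy.le y rfl⟩
    have h2 : ∀ᶠ j : ℕ in atTop, max r (2 * ‖x‖) < (j : ℝ) :=
      tendsto_natCast_atTop_atTop.eventually_gt_atTop _
    filter_upwards [h2] with j hj
    obtain ⟨hjr, hjx⟩ := max_lt_iff.1 hj
    set ρ : ℝ := (j : ℝ) + 1 with hρ
    have hρ0 : 0 < ρ := by positivity
    have hn1 : n - 2 + 1 = n - 1 := by omega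
    rw [(hadm j).newtonGrad_apply hn]
    have hzero : ∀ y ∉ Metric.closedBall (0 : Euc n) (2 * ρ),
        fderiv ℝ newton (x - y) v •
          firstOrderSymbol a ((fderiv ℝ (cutoff n j) y).smulRight (A y)) = 0 := by
      intro y hy
      rw [mem_closedBall_zero_iff, not_le] at hy
      have : ((0 : Euc n →L[ℝ] ℝ).smulRight (A y)) = 0 := by ext; simp
      simp [fderiv_cutoff_eq_zero (Or.inr hy), this]
    rw [← setIntegral_eq_integral_of_forall_compl_eq_zero hzero]
    have hle := norm_setIntegral_le_of_norm_le_const (μ := volume)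
      (s := Metric.closedBall (0 : Euc n) (2 * ρ))
      (f := fun y => fderiv ℝ newton (x - y) v •
          firstOrderSymbol a ((fderiv ℝ (cutoff n j) y).smulRight (A y)))
      (C := (C₁ * 2 ^ (n - 1) * (ρ ^ (n - 1))⁻¹ * ‖v‖) *
        (‖firstOrderSymbol a‖ * (C₂ * ρ⁻¹ * ε)))
      measure_closedBall_lt_top (fun y _ => ?_)
    · refine hle.trans (le_of_eq ?_)
      have hvol : volume.real (Metric.closedBall (0 : Euc n) (2 * ρ)) =
          (2 * ρ) ^ n * volume.real (Metric.ball (0 : Euc n) 1) := by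
        have h := Measure.addHaar_real_closedBall (volume : Measure (Euc n)) 0
          (by positivity : 0 ≤ 2 * ρ)
        simpa using h
      rw [hvol, hB, mul_pow]
      have hpow : ρ ^ n = ρ ^ (n - 1) * ρ := by
        rw [← pow_succ]
        congr 1
        omega
      rw [hpow]
      field_simp
    · rcases lt_or_ge ‖y‖ ρ with hy | hy
      · have : ((0 : Euc n →L[ℝ] ℝ).smulRight (A y)) = 0 := by ext; simp
        rw [fderiv_cutoff_eq_zero (Or.inl hy), this, map_zero, smul_zero, norm_zero]
        positivity
      · have hxy : ρ / 2 ≤ ‖x - y‖ := by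
          have h := norm_sub_norm_le y x
          rw [norm_sub_rev] at h
          linarith
        have hxy0 : 0 < ‖x - y‖ := lt_of_lt_of_le (by positivity) hxy
        have hk : ‖fderiv ℝ newton (x - y)‖ ≤ C₁ * 2 ^ (n - 1) * (ρ ^ (n - 1))⁻¹ := by
          refine (hC₁ _ (norm_pos_iff.1 hxy0)).trans ?_
          rw [hn1, mul_assoc]
          gcongr
          rw [← div_eq_mul_inv, ← inv_div, ← div_pow]
          gcongr
        rw [norm_smul]
        have hAy : ‖A y‖ ≤ ε := (hr y (by linarith)).le
        have hT : ‖(fderiv ℝ (cutoff n j) y).smulRight (A y)‖ ≤ C₂ * ρ⁻¹ * ε := by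
          rw [ContinuousLinearMap.norm_smulRight_apply]
          have := hC₂ j y
          gcongr
        gcongr
        · exact (ContinuousLinearMap.le_opNorm _ _).trans (by gcongr)
        · exact (ContinuousLinearMap.le_opNorm _ _).trans (by gcongr)
  rw [NormedAddGroup.tendsto_nhds_zero]
  intro ε hε
  filter_upwards [hbound (ε / (B + 1)) (by positivity)] with j hj
  refine hj.trans_lt ?_
  rw [← mul_div_assoc, div_lt_iff₀ (by positivity)]
  nlinarith

theorem tendsto_newtonGrad_cutoff_smul [CompleteSpace Y] (hn : 3 ≤ n) {g : Euc n → Y}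
    (hg : Continuous g) (hadm : IsAdmissible g) (x v : Euc n) :
    Tendsto (fun j : ℕ => newtonGrad (fun y => cutoff n j y • g y) x v) atTop
      (𝓝 (newtonGrad g x v)) := by
  have hj : ∀ j, IsAdmissible (fun y => cutoff n j y • g y) := fun j =>
    .of_hasCompactSupport ((contDiff_cutoff n j).continuous.smul hg)
      (hasCompactSupport_cutoff n j).smul_right
  have hi := hadm.integrable_fderiv_newton_smul hn x v
  rw [hadm.newtonGrad_apply hn]
  simp only [(hj _).newtonGrad_apply hn]
  refine tendsto_integral_of_dominated_convergence
    (fun y => ‖fderiv ℝ newton (x - y) v • g y‖)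
    (fun j => ((hj j).integrable_fderiv_newton_smul hn x v).1) hi.norm
    (fun j => .of_forall fun y => ?_) (.of_forall fun y => ?_)
  · rw [smul_comm, norm_smul, Real.norm_of_nonneg (cutoff_mem_Icc n j y).1]
    exact mul_le_of_le_one_left (norm_nonneg _) (cutoff_mem_Icc n j y).2
  · refine tendsto_const_nhds.congr' ?_
    filter_upwards [tendsto_natCast_atTop_atTop.eventually_gt_atTop ‖y‖] with j hj
    rw [cutoff_eq_one (by linarith), one_smul]

theorem contDiff_cutoff_smul (j : ℕ) {A : Euc n → V} (hA : ContDiff ℝ 1 A) :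
    ContDiff ℝ 1 fun y => cutoff n j y • A y :=
  (contDiff_cutoff n j).smul hA

theorem hasCompactSupport_cutoff_smul (j : ℕ) (A : Euc n → V) :
    HasCompactSupport fun y => cutoff n j y • A y :=
  (hasCompactSupport_cutoff n j).smul_right

theorem tendsto_newtonGrad_firstOrder_cutoff [CompleteSpace Y] (hn : 3 ≤ n)
    (a : Fin n → V →L[ℝ] Y) {A : Euc n → V} (hA : ContDiff ℝ 1 A)
    (hA0 : Tendsto A (cocompact (Euc n)) (𝓝 0)) (hadm : IsAdmissible (firstOrder a A))
    (x v : Euc n) :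
    Tendsto (fun j : ℕ => newtonGrad (firstOrder a fun y => cutoff n j y • A y) x v) atTop
      (𝓝 (newtonGrad (firstOrder a A) x v)) := by
  have hc := continuous_firstOrder a hA
  have h := (tendsto_newtonGrad_cutoff_smul hn hc hadm x v).add
    (tendsto_newtonGrad_fderiv_cutoff hn a hA.continuous hA0 x v)
  rw [add_zero] at h
  refine h.congr fun j => ?_
  have hsum : firstOrder a (fun y => cutoff n j y • A y) =
      (fun y => cutoff n j y • firstOrder a A y) +
        fun y => firstOrderSymbol a ((fderiv ℝ (cutoff n j) y).smulRight (A y)) := by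
    ext1 y
    exact firstOrder_smul a ((contDiff_cutoff n j).differentiable one_ne_zero y)
      (hA.differentiable one_ne_zero y)
  have h1 : IsAdmissible (fun y => cutoff n j y • firstOrder a A y) :=
    .of_hasCompactSupport ((contDiff_cutoff n j).continuous.smul hc)
      (hasCompactSupport_cutoff n j).smul_right
  have h2 : (fun y => firstOrderSymbol a ((fderiv ℝ (cutoff n j) y).smulRight (A y))) =
      firstOrder a (fun y => cutoff n j y • A y) - fun y => cutoff n j y • firstOrder a A y := by
    rw [hsum, add_sub_cancel_left]
  have h3 : IsAdmissible
      (fun y => firstOrderSymbol a ((fderiv ℝ (cutoff n j) y).smulRight (A y))) := by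
    rw [h2]
    exact .of_hasCompactSupport
      ((continuous_firstOrder a (contDiff_cutoff_smul j hA)).sub
        ((contDiff_cutoff n j).continuous.smul hc))
      ((hasCompactSupport_firstOrder a (hasCompactSupport_cutoff_smul j A)).sub
        (hasCompactSupport_cutoff n j).smul_right)
  rw [hsum, newtonGrad_add hn h1 h3]
  rfl

/-- A function that vanishes at infinity is approximated by its products with cutoff functions, with
convergence of the derivatives of the potentials. -/
theorem tendsto_firstOrder_newtonPot_cutoff [CompleteSpace Y] (hn : 3 ≤ n)
    (a : Fin n → V →L[ℝ] Y) (b : Fin n → Y →L[ℝ] U) {A : Euc n → V} (hA : ContDiff ℝ 1 A)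
    (hA0 : Tendsto A (cocompact (Euc n)) (𝓝 0)) (hadm : IsAdmissible (firstOrder a A))
    (x : Euc n) :
    Tendsto (fun j : ℕ =>
        firstOrder b (newtonPot (firstOrder a fun y => cutoff n j y • A y)) x) atTop
      (𝓝 (firstOrder b (newtonPot (firstOrder a A)) x)) := by
  have hadmj : ∀ j, IsAdmissible (firstOrder a fun y => cutoff n j y • A y) := fun j =>
    .of_hasCompactSupport (continuous_firstOrder a (contDiff_cutoff_smul j hA))
      (hasCompactSupport_firstOrder a (hasCompactSupport_cutoff_smul j A))
  simp only [firstOrder_newtonPot hn b (hadmj _)]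
  rw [firstOrder_newtonPot hn b hadm]
  exact tendsto_finsetSum _ fun i _ => ((b i).continuous.tendsto _).comp
    (tendsto_newtonGrad_firstOrder_cutoff hn a hA hA0 hadm x (basisVec i))

theorem firstOrder_newtonPot_firstOrder [CompleteSpace V] [CompleteSpace Y] (hn : 3 ≤ n)
    (a : Fin n → V →L[ℝ] Y) (b : Fin n → Y →L[ℝ] U) {A : Euc n → V} (hA : ContDiff ℝ 1 A)
    (hs : HasCompactSupport A) (x : Euc n) :
    firstOrder b (newtonPot (firstOrder a A)) x =
      ∑ i, ∑ h, b i (a h (newtonGrad (fderiv ℝ A) x (basisVec i) (basisVec h))) := by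
  rw [firstOrder_newtonPot hn b (.of_hasCompactSupport (continuous_firstOrder a hA)
    (hasCompactSupport_firstOrder a hs))]
  simp only [newtonGrad_firstOrder hn a hA hs, map_sum]

/-- A differential operator `b a + e c` equal to the Laplacian, applied under the integral sign to
the potential of a function that vanishes at infinity, reproduces the function. -/
theorem firstOrder_newtonPot_add_eq [CompleteSpace V] [CompleteSpace Y] [CompleteSpace Y']
    (hn : 3 ≤ n) {a : Fin n → V →L[ℝ] Y} {b : Fin n → Y →L[ℝ] V} {c : Fin n → V →L[ℝ] Y'}
    {e : Fin n → Y' →L[ℝ] V}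
    (hrel : ∀ i h w, b i (a h w) + e h (c i w) = if i = h then w else 0)
    {A : Euc n → V} (hA : ContDiff ℝ 1 A) (hA0 : Tendsto A (cocompact (Euc n)) (𝓝 0))
    (hadm : IsAdmissible (firstOrder a A)) (hadm' : IsAdmissible (firstOrder c A)) (x : Euc n) :
    firstOrder b (newtonPot (firstOrder a A)) x + firstOrder e (newtonPot (firstOrder c A)) x =
      -(((n : ℝ) - 2) * solidAngle n) • A x := by
  -- with compact support, the second derivatives of the potential are symmetric, and by `hrel` only
  -- their trace survives
  have hcompact : ∀ {A : Euc n → V}, ContDiff ℝ 1 A → HasCompactSupport A →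
      firstOrder b (newtonPot (firstOrder a A)) x + firstOrder e (newtonPot (firstOrder c A)) x =
        -(((n : ℝ) - 2) * solidAngle n) • A x := by
    intro A hA hs
    rw [firstOrder_newtonPot_firstOrder hn a b hA hs, firstOrder_newtonPot_firstOrder hn c e hA hs,
      Finset.sum_comm (f := fun i h => e i (c h _)), ← Finset.sum_add_distrib,
      ← sum_newtonGrad_fderiv hn hA hs x]
    refine Finset.sum_congr rfl fun i _ => ?_
    rw [← Finset.sum_add_distrib]
    have : ∀ h, b i (a h (newtonGrad (fderiv ℝ A) x (basisVec i) (basisVec h))) +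
        e h (c i (newtonGrad (fderiv ℝ A) x (basisVec h) (basisVec i))) =
        if i = h then newtonGrad (fderiv ℝ A) x (basisVec i) (basisVec h) else 0 := fun h => by
      rw [newtonGrad_fderiv_symm hn hA hs x (basisVec h), hrel]
    simp [this]
  refine tendsto_nhds_unique
    ((tendsto_firstOrder_newtonPot_cutoff hn a b hA hA0 hadm x).add
      (tendsto_firstOrder_newtonPot_cutoff hn c e hA hA0 hadm' x)) ?_
  simp only [hcompact (contDiff_cutoff_smul _ hA) (hasCompactSupport_cutoff_smul _ A)]
  refine tendsto_const_nhds.congr' ?_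
  filter_upwards [tendsto_natCast_atTop_atTop.eventually_gt_atTop ‖x‖] with j hj
  rw [cutoff_eq_one (by linarith), one_smul]

/-- An antisymmetric symbol contracts to zero with symmetric second derivatives. -/
theorem sum_sum_eq_zero_of_antisymm {p : Fin n → Y →L[ℝ] U} {a : Fin n → V →L[ℝ] Y}
    (hrel : ∀ i h w, p i (a h w) + p h (a i w) = 0) {T : Fin n → Fin n → V}
    (hT : ∀ i h, T i h = T h i) : ∑ i, ∑ h, p i (a h (T i h)) = 0 := by
  have h1 : ∑ i, ∑ h, p i (a h (T i h)) = -∑ i, ∑ h, p i (a h (T i h)) := by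
    conv_lhs => rw [Finset.sum_comm]
    rw [← Finset.sum_neg_distrib]
    refine Finset.sum_congr rfl fun i _ => ?_
    rw [← Finset.sum_neg_distrib]
    refine Finset.sum_congr rfl fun h _ => ?_
    rw [hT h i]
    exact eq_neg_of_add_eq_zero_right (hrel i h _)
  have h2 := eq_neg_iff_add_eq_zero.1 h1
  rw [← two_smul ℝ] at h2
  exact (smul_eq_zero.1 h2).resolve_left two_ne_zero

/-- If `p a = 0` as a differential operator of second order, then `p` annihilates the potential of
`a A`, although `A` need not have second derivatives. -/
theorem firstOrder_newtonPot_eq_zero [CompleteSpace V] [CompleteSpace Y]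
    (hn : 3 ≤ n) {a : Fin n → V →L[ℝ] Y} {p : Fin n → Y →L[ℝ] U}
    (hrel : ∀ i h w, p i (a h w) + p h (a i w) = 0)
    {A : Euc n → V} (hA : ContDiff ℝ 1 A) (hA0 : Tendsto A (cocompact (Euc n)) (𝓝 0))
    (hadm : IsAdmissible (firstOrder a A)) (x : Euc n) :
    firstOrder p (newtonPot (firstOrder a A)) x = 0 := by
  refine tendsto_nhds_unique (tendsto_firstOrder_newtonPot_cutoff hn a p hA hA0 hadm x) ?_
  refine tendsto_const_nhds.congr fun j => ?_
  rw [firstOrder_newtonPot_firstOrder hn a p (contDiff_cutoff_smul j hA)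
    (hasCompactSupport_cutoff_smul j A)]
  exact (sum_sum_eq_zero_of_antisymm hrel fun i h => newtonGrad_fderiv_symm hn
    (contDiff_cutoff_smul j hA) (hasCompactSupport_cutoff_smul j A) x _ _).symm

end Representation

/-! ### Graph patches -/

section Patches

variable {n : ℕ} {R : Set (Euc n)}

/-- The coordinates `(y, t) ↦ frame y + t • up` of a patch as a linear isometry. -/
def GraphPatch.coordIsometry (P : GraphPatch R) :
    WithLp 2 (Euc (n - 1) × ℝ) →ₗᵢ[ℝ] Euc n where
  toLinearMap := ((P.frame.toLinearMap.coprod (LinearMap.toSpanSingleton ℝ _ P.up))).comp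
    (WithLp.linearEquiv 2 ℝ (Euc (n - 1) × ℝ)).toLinearMap
  norm_map' p := by
    have h : ‖P.frame p.fst + p.snd • P.up‖ ^ 2 = ‖p‖ ^ 2 := by
      rw [WithLp.prod_norm_sq_eq_of_L2, norm_add_sq_real, inner_smul_right, P.orthogonal,
        P.frame.norm_map, norm_smul, P.norm_up]
      simp
    exact (pow_left_inj₀ (norm_nonneg _) (norm_nonneg _) two_ne_zero).1 h

/-- The coordinates of a patch as a continuous linear equivalence. -/
def GraphPatch.coord (hn : 0 < n) (P : GraphPatch R) : (Euc (n - 1) × ℝ) ≃L[ℝ] Euc n :=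
  (WithLp.prodContinuousLinearEquiv 2 ℝ (Euc (n - 1)) ℝ).symm.trans
    (P.coordIsometry.toLinearIsometryEquiv (by
      rw [(WithLp.linearEquiv 2 ℝ (Euc (n - 1) × ℝ)).finrank_eq]
      simp
      omega)).toContinuousLinearEquiv

theorem GraphPatch.coord_apply (hn : 0 < n) (P : GraphPatch R) (p : Euc (n - 1) × ℝ) :
    P.coord hn p = P.frame p.1 + p.2 • P.up := rfl

theorem GraphPatch.measurePreserving_coord (hn : 0 < n) (P : GraphPatch R) :
    MeasurePreserving (P.coord hn) := by
  have h1 := (P.coordIsometry.toLinearIsometryEquiv (by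
      rw [(WithLp.linearEquiv 2 ℝ (Euc (n - 1) × ℝ)).finrank_eq]
      simp
      omega)).measurePreserving
  exact h1.comp (WithLp.volume_preserving_toLp (Euc (n - 1)) ℝ)

/-- The shear `(y, s) ↦ (y, γ y + s)`. -/
def GraphPatch.shear (P : GraphPatch R) : (Euc (n - 1) × ℝ) ≃ₜ (Euc (n - 1) × ℝ) where
  toFun p := (p.1, P.γ p.1 + p.2)
  invFun p := (p.1, p.2 - P.γ p.1)
  left_inv p := by simp
  right_inv p := by simp
  continuous_toFun := by
    have := P.contDiff.continuous
    fun_prop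
  continuous_invFun := by
    have := P.contDiff.continuous
    fun_prop

/-- Coordinates that flatten the boundary: `(y, s) ↦ frame y + (γ y + s) • up`. -/
def GraphPatch.flat (hn : 0 < n) (P : GraphPatch R) : (Euc (n - 1) × ℝ) ≃ₜ Euc n :=
  P.shear.trans (P.coord hn).toHomeomorph

theorem GraphPatch.flat_apply (hn : 0 < n) (P : GraphPatch R) (y : Euc (n - 1)) (s : ℝ) :
    P.flat hn (y, s) = P.frame y + (P.γ y + s) • P.up := rfl

theorem GraphPatch.flat_zero (hn : 0 < n) (P : GraphPatch R) (y : Euc (n - 1)) :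
    P.flat hn (y, 0) = P.param y := by
  rw [P.flat_apply, add_zero]
  rfl

/-- The flattening is volume preserving, as an isometry composed with a shear. -/
theorem GraphPatch.measurePreserving_flat (hn : 0 < n) (P : GraphPatch R) :
    MeasurePreserving (P.flat hn) := by
  refine (P.measurePreserving_coord hn).comp ?_
  exact (MeasurePreserving.id (volume : Measure (Euc (n - 1)))).skew_product
    (g := fun y s => P.γ y + s) (by
      have := P.contDiff.continuous.measurable
      unfold Function.uncurry
      fun_prop)
    (.of_forall fun y => map_add_left_eq_self volume (P.γ y))

theorem GraphPatch.hasFDerivAt_flat (hn : 0 < n) (P : GraphPatch R) (p : Euc (n - 1) × ℝ) :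
    HasFDerivAt (P.flat hn) ((P.coord hn : (Euc (n - 1) × ℝ) →L[ℝ] Euc n).comp
      ((ContinuousLinearMap.fst ℝ _ _).prod
        ((fderiv ℝ P.γ p.1).comp (ContinuousLinearMap.fst ℝ _ _) +
          ContinuousLinearMap.snd ℝ _ _))) p := by
  have h1 : HasFDerivAt (fun q : Euc (n - 1) × ℝ => P.γ q.1)
      ((fderiv ℝ P.γ p.1).comp (ContinuousLinearMap.fst ℝ _ _)) p :=
    (P.contDiff.differentiable one_ne_zero p.1).hasFDerivAt.comp p hasFDerivAt_fst
  exact (P.coord hn).hasFDerivAt.comp p (hasFDerivAt_fst.prodMk (h1.add hasFDerivAt_snd))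

theorem GraphPatch.flat_mem_iff (hn : 0 < n) (P : GraphPatch R) {p : Euc (n - 1) × ℝ}
    (h : P.flat hn p ∈ P.U) : P.flat hn p ∈ R ↔ p.2 ≤ 0 := by
  have := P.mem_iff p.1 (P.γ p.1 + p.2) h
  rw [show P.flat hn p = P.frame p.1 + (P.γ p.1 + p.2) • P.up from rfl, this]
  constructor <;> intro h <;> linarith

theorem GraphPatch.flat_mem_interior (hn : 0 < n) (P : GraphPatch R) {p : Euc (n - 1) × ℝ}
    (h : P.flat hn p ∈ P.U) (hp : p.2 < 0) : P.flat hn p ∈ interior R := by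
  have ho : IsOpen (P.flat hn '' (P.flat hn ⁻¹' P.U ∩ {p | p.2 < 0})) :=
    (P.flat hn).isOpenMap _
      ((P.isOpen.preimage (P.flat hn).continuous).inter (isOpen_lt continuous_snd continuous_const))
  refine mem_interior.2 ⟨_, ?_, ho, ⟨p, ⟨h, hp⟩, rfl⟩⟩
  rintro _ ⟨q, ⟨hq, hq0⟩, rfl⟩
  exact (P.flat_mem_iff hn hq).2 (le_of_lt hq0)

theorem BoundaryPatches.exists_mem_patch (P : BoundaryPatches R) {x : Euc n}
    (hx : x ∈ frontier R) : ∃ j, x ∈ (P.patch j).U := by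
  have h1 := P.sum_eq_one.self_of_nhdsSet x hx
  by_contra! h
  have : ∀ j, P.ρ j x = 0 := fun j => by
    by_contra hne
    exact h j (P.subordinate j (subset_tsupport _ hne))
  simp [this] at h1

theorem subset_closure_interior (hn : 0 < n) (hR : IsClosed R) (P : BoundaryPatches R) :
    R ⊆ closure (interior R) := by
  intro x hx
  by_cases hxi : x ∈ interior R
  · exact subset_closure hxi
  obtain ⟨j, hj⟩ := P.exists_mem_patch (x := x) (by rw [hR.frontier_eq]; exact ⟨hx, hxi⟩)
  set Q := P.patch j
  obtain ⟨p, rfl⟩ := (Q.flat hn).surjective x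
  have hp := (Q.flat_mem_iff hn hj).1 hx
  have hc : ContinuousAt (fun s : ℝ => Q.flat hn (p.1, s)) p.2 :=
    ((Q.flat hn).continuous.comp (by fun_prop)).continuousAt
  have ht : Tendsto (fun s : ℝ => Q.flat hn (p.1, s)) (𝓝[<] p.2) (𝓝 (Q.flat hn p)) :=
    hc.tendsto.mono_left nhdsWithin_le_nhds
  refine mem_closure_of_tendsto ht ?_
  filter_upwards [ht.eventually (Q.isOpen.mem_nhds hj), self_mem_nhdsWithin] with s hs hs'
  exact Q.flat_mem_interior hn hs (lt_of_lt_of_le hs' hp)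

/-- The half space has unique derivatives, and the flattening maps it onto `R` near a boundary point. -/
theorem uniqueDiffOn_region (hn : 0 < n) (hR : IsClosed R) (P : BoundaryPatches R) :
    UniqueDiffOn ℝ R := by
  intro x hx
  by_cases hxi : x ∈ interior R
  · exact uniqueDiffWithinAt_of_mem_nhds (mem_interior_iff_mem_nhds.1 hxi)
  obtain ⟨j, hj⟩ := P.exists_mem_patch (x := x) (by rw [hR.frontier_eq]; exact ⟨hx, hxi⟩)
  set Q := P.patch j
  obtain ⟨p, rfl⟩ := (Q.flat hn).surjective x
  have hp := (Q.flat_mem_iff hn hj).1 hx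
  have hS : UniqueDiffOn ℝ {p : Euc (n - 1) × ℝ | p.2 ≤ 0} := by
    have : {p : Euc (n - 1) × ℝ | p.2 ≤ 0} = univ ×ˢ Iic 0 := by ext; simp
    rw [this]
    exact uniqueDiffOn_univ.prod (uniqueDiffOn_Iic 0)
  have h1 := (Q.hasFDerivAt_flat hn p).hasFDerivWithinAt.uniqueDiffWithinAt (hS p hp) (by
    refine Function.Surjective.denseRange fun v => ?_
    obtain ⟨q, rfl⟩ := (Q.coord hn).surjective v
    exact ⟨(q.1, q.2 - fderiv ℝ Q.γ p.1 q.1), by simp⟩)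
  refine (h1.inter (Q.isOpen.mem_nhds hj)).mono ?_
  rintro _ ⟨⟨q, hq, rfl⟩, hqU⟩
  exact (Q.flat_mem_iff hn hqU).2 hq

end Patches

/-! ### The divergence theorem -/

section Divergence

variable {n : ℕ} {R : Set (Euc n)} {V : Type*} [NormedAddCommGroup V] [NormedSpace ℝ V]

/-- Integration by parts against the constant `1`. -/
theorem integral_lineDeriv_eq_zero {E : Type*} [NormedAddCommGroup E] [NormedSpace ℝ E]
    [MeasurableSpace E] [BorelSpace E] [FiniteDimensional ℝ E] {μ : Measure E}
    [μ.IsAddHaarMeasure] {g g' : E → V} {v : E} (hg' : Integrable g' μ) (hg : Integrable g μ)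
    (h : ∀ x, HasLineDerivAt ℝ g (g' x) x v) : ∫ x, g' x ∂μ = 0 := by
  have := integral_bilinear_hasLineDerivAt_right_eq_neg_left_of_integrable (μ := μ)
    (f := fun _ => (1 : ℝ)) (f' := fun _ => 0) (g := g) (g' := g') (v := v)
    (B := (ContinuousLinearMap.lsmul ℝ ℝ : ℝ →L[ℝ] V →L[ℝ] V)) (by simp) (by simpa using hg') (by simpa using hg)
    (fun x _ => by
      have := (hasFDerivAt_const (𝕜 := ℝ) (1 : ℝ) x).hasLineDerivAt v
      simpa using this) (fun x _ => h x)
  simpa using this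

/-- A function `g` on `R`, extended by zero, together with its derivative `g'`, both continuous up
to the boundary of `R` and carried by `K`. -/
structure IsSmoothUpTo (R K : Set (Euc n)) (g : Euc n → V) (g' : Euc n → Euc n →L[ℝ] V) :
    Prop where
  continuousOn : ContinuousOn g R
  continuousOn_deriv : ContinuousOn g' R
  hasFDerivAt : ∀ x ∈ interior R, HasFDerivAt g (g' x) x
  eq_zero : ∀ x ∉ K, g x = 0
  deriv_eq_zero : ∀ x ∉ K, g' x = 0
  deriv_eq_zero_of_notMem : ∀ x ∉ R, g' x = 0

variable {K : Set (Euc n)} {g : Euc n → V} {g' : Euc n → Euc n →L[ℝ] V}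

theorem IsSmoothUpTo.integrable_deriv (hR : IsCompact R) (h : IsSmoothUpTo R K g g') :
    Integrable g' := by
  have h1 : R.indicator g' = g' := by
    ext1 x
    by_cases hx : x ∈ R
    · simp [hx]
    · simp [hx, h.deriv_eq_zero_of_notMem x hx]
  exact ((h.continuousOn_deriv.integrableOn_compact hR).integrable_indicator
    hR.measurableSet).congr (.of_forall (congrFun h1))

section patch

variable {P : GraphPatch R}

theorem IsSmoothUpTo.hasFDerivAt_flat (hn : 0 < n) (h : IsSmoothUpTo R K g g')
    (hK : IsClosed K) (hKU : K ⊆ P.U) {p : Euc (n - 1) × ℝ} (hp : p.2 < 0) :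
    HasFDerivAt g (g' (P.flat hn p)) (P.flat hn p) := by
  by_cases hU : P.flat hn p ∈ P.U
  · exact h.hasFDerivAt _ (P.flat_mem_interior hn hU hp)
  · have hx : P.flat hn p ∉ K := fun hx => hU (hKU hx)
    rw [h.deriv_eq_zero _ hx]
    refine (hasFDerivAt_const (0 : V) _).congr_of_eventuallyEq ?_
    filter_upwards [hK.isOpen_compl.mem_nhds hx] with y hy
    exact h.eq_zero y hy

theorem IsSmoothUpTo.deriv_flat_eq_zero (hn : 0 < n) (h : IsSmoothUpTo R K g g')
    (hKU : K ⊆ P.U) {p : Euc (n - 1) × ℝ} (hp : 0 < p.2) : g' (P.flat hn p) = 0 := by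
  by_cases hU : P.flat hn p ∈ P.U
  · refine h.deriv_eq_zero_of_notMem _ fun hx => ?_
    exact absurd ((P.flat_mem_iff hn hU).1 hx) (not_le.2 hp)
  · exact h.deriv_eq_zero _ fun hx => hU (hKU hx)

theorem IsSmoothUpTo.continuousWithinAt_flat (hn : 0 < n) (h : IsSmoothUpTo R K g g')
    (hK : IsClosed K) (hKU : K ⊆ P.U) (y : Euc (n - 1)) :
    ContinuousWithinAt (fun s : ℝ => g (P.flat hn (y, s))) (Iic 0) 0 := by
  have hc : Continuous fun s : ℝ => P.flat hn (y, s) := (P.flat hn).continuous.comp (by fun_prop)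
  by_cases hU : P.flat hn (y, 0) ∈ P.U
  · have hR : P.flat hn (y, 0) ∈ R := (P.flat_mem_iff hn hU).2 le_rfl
    have h1 : ContinuousWithinAt (fun s : ℝ => g (P.flat hn (y, s)))
        (Iic 0 ∩ (fun s : ℝ => P.flat hn (y, s)) ⁻¹' P.U) 0 :=
      ContinuousWithinAt.comp (f := fun s : ℝ => P.flat hn (y, s)) (x := (0 : ℝ)) (t := R)
        (h.continuousOn _ hR) hc.continuousAt.continuousWithinAt
        fun s hs => (P.flat_mem_iff hn hs.2).2 hs.1
    exact (continuousWithinAt_inter (hc.continuousAt.preimage_mem_nhds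
      (P.isOpen.mem_nhds hU))).1 h1
  · have hx : P.flat hn (y, 0) ∉ K := fun hx => hU (hKU hx)
    have h1 : (fun s : ℝ => g (P.flat hn (y, s))) =ᶠ[𝓝 0] fun _ => 0 := by
      filter_upwards [hc.continuousAt.preimage_mem_nhds (hK.isOpen_compl.mem_nhds hx)] with s hs
      exact h.eq_zero _ hs
    exact (continuousAt_const.congr h1.symm).continuousWithinAt

/-- The integral of a tangential derivative over a parallel surface vanishes. -/
theorem IsSmoothUpTo.integral_tangential (hn : 0 < n) (h : IsSmoothUpTo R K g g')
    (hK : IsCompact K) (hKU : K ⊆ P.U) (a : Euc (n - 1)) {s : ℝ} (hs : s ≠ 0)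
    (hi : Integrable fun y => g' (P.flat hn (y, s)) (P.coord hn (a, fderiv ℝ P.γ y a))) :
    ∫ y, g' (P.flat hn (y, s)) (P.coord hn (a, fderiv ℝ P.γ y a)) = 0 := by
  rcases lt_or_gt_of_ne hs with hs | hs
  · have hd : ∀ y, HasFDerivAt (fun y => g (P.flat hn (y, s))) _ y := fun y =>
      (h.hasFDerivAt_flat hn hK.isClosed hKU (p := (y, s)) hs).comp y
        ((P.hasFDerivAt_flat hn (y, s)).comp y (hasFDerivAt_prodMk_left y s))
    refine integral_lineDeriv_eq_zero (v := a) (g := fun y => g (P.flat hn (y, s))) hi ?_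
      fun y => ?_
    · refine Continuous.integrable_of_hasCompactSupport
        (continuous_iff_continuousAt.2 fun y => (hd y).continuousAt) ?_
      have hKc : IsCompact (Prod.fst '' (P.flat hn ⁻¹' K)) :=
        ((P.flat hn).isCompact_preimage.2 hK).image continuous_fst
      refine HasCompactSupport.intro hKc fun y hy => h.eq_zero _ fun hyK => hy ?_
      exact ⟨(y, s), hyK, rfl⟩
    · have := (hd y).hasLineDerivAt a
      simpa using this
  · simp [h.deriv_flat_eq_zero hn hKU (p := (_, s)) hs]

/-- The integral of the derivative transversal to the boundary along a coordinate line. -/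
theorem IsSmoothUpTo.integral_transversal [CompleteSpace V] (hn : 0 < n)
    (h : IsSmoothUpTo R K g g') (hK : IsCompact K) (hKU : K ⊆ P.U) (y : Euc (n - 1))
    (hi : Integrable fun s : ℝ => g' (P.flat hn (y, s)) P.up) :
    ∫ s : ℝ, g' (P.flat hn (y, s)) P.up = g (P.param y) := by
  have hz : ∀ s ∉ Iic (0 : ℝ), g' (P.flat hn (y, s)) P.up = 0 := fun s hs => by
    rw [h.deriv_flat_eq_zero hn hKU (p := (y, s)) (not_le.1 hs), zero_apply]
  rw [← setIntegral_eq_integral_of_forall_compl_eq_zero hz]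
  have hd : ∀ s ∈ Iio (0 : ℝ), HasDerivAt (fun s => g (P.flat hn (y, s)))
      (g' (P.flat hn (y, s)) P.up) s := fun s hs => by
    have h1 : HasDerivAt (fun s : ℝ => P.flat hn (y, s)) P.up s := by
      have := (((hasDerivAt_id s).const_add (P.γ y)).smul_const P.up).const_add (P.frame y)
      rwa [one_smul] at this
    exact (h.hasFDerivAt_flat hn hK.isClosed hKU (p := (y, s)) hs).comp_hasDerivAt s h1
  have hlim : Tendsto (fun s : ℝ => g (P.flat hn (y, s))) atBot (𝓝 0) := by
    have hKc : IsCompact (Prod.snd '' (P.flat hn ⁻¹' K)) :=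
      ((P.flat hn).isCompact_preimage.2 hK).image continuous_snd
    obtain ⟨m, hm⟩ := hKc.bddBelow
    refine tendsto_const_nhds.congr' ?_
    filter_upwards [eventually_lt_atBot m] with s hs
    refine (h.eq_zero _ fun hsK => ?_).symm
    exact absurd (hm ⟨(y, s), hsK, rfl⟩) (not_le.2 hs)
  rw [integral_Iic_of_hasDerivAt_of_tendsto (h.continuousWithinAt_flat hn hK.isClosed hKU y) hd
    hi.integrableOn hlim, sub_zero, P.flat_zero]

theorem GraphPatch.inner_areaElement (hn : 0 < n) (P : GraphPatch R) (y a : Euc (n - 1)) (b : ℝ) :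
    inner ℝ (P.areaElement y) (P.coord hn (a, b)) = b - fderiv ℝ P.γ y a := by
  rw [P.coord_apply, areaElement, inner_sub_left, inner_add_right, inner_add_right,
    inner_smul_right, inner_smul_right, P.orthogonal, real_inner_self_eq_norm_sq, P.norm_up,
    P.frame.inner_map_map, real_inner_comm, P.orthogonal, gradient,
    InnerProductSpace.toDual_symm_apply]
  ring

/-- The divergence theorem for a function carried by a patch: the vector is split into a part
tangential to the boundary and a multiple of `up`. -/
theorem IsSmoothUpTo.integral_deriv_eq [CompleteSpace V] (hn : 0 < n) (hR : IsCompact R)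
    (h : IsSmoothUpTo R K g g') (hK : IsCompact K) (hKU : K ⊆ P.U) (v : Euc n) :
    ∫ x, g' x v = ∫ y, inner ℝ (P.areaElement y) v • g (P.param y) := by
  obtain ⟨⟨a, b⟩, rfl⟩ := (P.coord hn).surjective v
  have hmp := P.measurePreserving_flat hn
  have hemb := (P.flat hn).measurableEmbedding
  have hint : Integrable fun p => g' (P.flat hn p) :=
    (hmp.integrable_comp_emb hemb).2 (h.integrable_deriv hR)
  have hiv : ∀ w, Integrable fun p => g' (P.flat hn p) w := fun w =>
    (ContinuousLinearMap.apply ℝ V w).integrable_comp hint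
  -- the coefficient of `up`
  let c : Euc (n - 1) → ℝ := fun y => b - fderiv ℝ P.γ y a
  have hc : Continuous c :=
    continuous_const.sub ((P.contDiff.continuous_fderiv one_ne_zero).clm_apply continuous_const)
  have hi2 : Integrable fun p : Euc (n - 1) × ℝ => c p.1 • g' (P.flat hn p) P.up := by
    have hKc : IsCompact (P.flat hn ⁻¹' K) := (P.flat hn).isCompact_preimage.2 hK
    have h1 : IntegrableOn (fun p : Euc (n - 1) × ℝ => c p.1 • g' (P.flat hn p) P.up)
        (P.flat hn ⁻¹' K) :=
      (hiv P.up).integrableOn.continuousOn_smul (hc.comp continuous_fst).continuousOn hKc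
    refine (integrableOn_iff_integrable_of_support_subset fun p hp => ?_).1 h1
    by_contra hpK
    exact hp (by simp [h.deriv_eq_zero _ hpK])
  have hsplit : ∀ p : Euc (n - 1) × ℝ, g' (P.flat hn p) (P.coord hn (a, b)) =
      g' (P.flat hn p) (P.coord hn (a, fderiv ℝ P.γ p.1 a)) + c p.1 • g' (P.flat hn p) P.up := by
    intro p
    rw [← map_smul, ← map_add]
    congr 1
    simp only [P.coord_apply, c, sub_smul]
    abel
  have hi1 : Integrable fun p : Euc (n - 1) × ℝ =>
      g' (P.flat hn p) (P.coord hn (a, fderiv ℝ P.γ p.1 a)) := by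
    refine ((hiv (P.coord hn (a, b))).sub hi2).congr (.of_forall fun p => ?_)
    simp [hsplit p]
  rw [← hmp.integral_comp hemb]
  simp only [hsplit]
  rw [integral_add hi1 hi2]
  have h1 : ∫ p : Euc (n - 1) × ℝ, g' (P.flat hn p) (P.coord hn (a, fderiv ℝ P.γ p.1 a)) = 0 := by
    rw [Measure.volume_eq_prod, integral_prod_symm _ hi1]
    refine integral_eq_zero_of_ae ?_
    filter_upwards [Measure.ae_ne volume (0 : ℝ), hi1.prod_left_ae] with s hs his
    exact h.integral_tangential hn hK hKU a hs his
  have h2 : ∫ p : Euc (n - 1) × ℝ, c p.1 • g' (P.flat hn p) P.up =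
      ∫ y, c y • g (P.param y) := by
    rw [Measure.volume_eq_prod, integral_prod _ hi2]
    refine integral_congr_ae ?_
    filter_upwards [(hiv P.up).prod_right_ae] with y hy
    rw [integral_smul, h.integral_transversal hn hK hKU y hy]
  rw [h1, h2, zero_add]
  simp only [P.inner_areaElement, c]

end patch

theorem isSmoothUpTo_indicator_smul (hu : UniqueDiffOn ℝ R) {ρ : Euc n → ℝ} (hρ : ContDiff ℝ 1 ρ)
    {h : Euc n → V} (hh : ContDiffOn ℝ 1 h R) :
    IsSmoothUpTo R (tsupport ρ) (R.indicator fun x => ρ x • h x)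
      (R.indicator (fderivWithin ℝ (fun x => ρ x • h x) R)) where
  continuousOn := (hρ.contDiffOn.smul hh).continuousOn.congr fun x hx => indicator_of_mem hx _
  continuousOn_deriv := ((hρ.contDiffOn.smul hh).continuousOn_fderivWithin hu le_rfl).congr
    fun x hx => indicator_of_mem hx _
  hasFDerivAt x hx := by
    have hR := mem_interior_iff_mem_nhds.1 hx
    rw [indicator_of_mem (interior_subset hx), fderivWithin_of_mem_nhds hR]
    have hd : DifferentiableAt ℝ (fun x => ρ x • h x) x :=
      ((hρ.contDiffOn.smul hh).contDiffAt hR).differentiableAt one_ne_zero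
    refine hd.hasFDerivAt.congr_of_eventuallyEq ?_
    filter_upwards [hR] with y hy
    exact indicator_of_mem hy _
  eq_zero x hx := by
    by_cases hR : x ∈ R <;> simp [hR, image_eq_zero_of_notMem_tsupport hx]
  deriv_eq_zero x hx := by
    refine indicator_apply_eq_zero.2 fun _ => ?_
    have h0 : (fun x => ρ x • h x) =ᶠ[𝓝 x] fun _ => 0 := by
      filter_upwards [(isClosed_tsupport ρ).isOpen_compl.mem_nhds hx] with y hy
      rw [image_eq_zero_of_notMem_tsupport hy, zero_smul]
    rw [h0.fderivWithin_eq_of_nhds, fderivWithin_fun_const, Pi.zero_apply]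
  deriv_eq_zero_of_notMem x hx := indicator_of_notMem hx _

theorem inner_basisVec (x : Euc n) (i : Fin n) : inner ℝ x (basisVec i) = x i := by
  simp [basisVec, EuclideanSpace.inner_single_right]

/-- The divergence theorem for `h` multiplied by a function carried by a patch. -/
theorem integral_patch [CompleteSpace V] (hn : 0 < n) (hR : IsCompact R) (hu : UniqueDiffOn ℝ R)
    (P : GraphPatch R) {ρ : Euc n → ℝ} (hρ : ContDiff ℝ 1 ρ) (hs : HasCompactSupport ρ)
    (hU : tsupport ρ ⊆ P.U) {h : Euc n → V} (hh : ContDiffOn ℝ 1 h R) (i : Fin n) :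
    ∫ x in R, fderivWithin ℝ (fun x => ρ x • h x) R x (basisVec i) =
      ∫ y, (ρ (P.param y) * P.areaElement y i) • h (P.param y) := by
  have h1 := (isSmoothUpTo_indicator_smul hu hρ hh).integral_deriv_eq hn hR hs hU (basisVec i)
  rw [← integral_indicator hR.measurableSet]
  have h2 : R.indicator (fun x => fderivWithin ℝ (fun x => ρ x • h x) R x (basisVec i)) =
      fun x => (R.indicator (fderivWithin ℝ (fun x => ρ x • h x) R) x) (basisVec i) := by
    ext1 x
    by_cases hx : x ∈ R <;> simp [hx]
  rw [h2, h1]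
  refine integral_congr_ae (.of_forall fun y => ?_)
  dsimp only
  rw [inner_basisVec]
  by_cases hy : P.param y ∈ R
  · rw [indicator_of_mem hy, smul_smul, mul_comm]
  · -- off `R` the extension by zero is harmless, since there the graph lies outside the patch
    have hρ0 : ρ (P.param y) = 0 := by
      by_contra hne
      refine hy ?_
      have hU' := hU (subset_tsupport _ hne)
      rw [← P.flat_zero hn] at hU' ⊢
      exact (P.flat_mem_iff hn hU').2 le_rfl
    rw [indicator_of_notMem hy, hρ0, smul_zero, zero_mul, zero_smul]

/-- A function that vanishes near the boundary has derivatives of integral zero. -/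
theorem setIntegral_fderivWithin_eq_zero (hR : IsCompact R) (hu : UniqueDiffOn ℝ R)
    {ρ : Euc n → ℝ} (hρ : ContDiff ℝ 1 ρ) (h0 : ∀ᶠ x in 𝓝ˢ (frontier R), ρ x = 0)
    {h : Euc n → V} (hh : ContDiffOn ℝ 1 h R) (v : Euc n) :
    ∫ x in R, fderivWithin ℝ (fun x => ρ x • h x) R x v = 0 := by
  have hsm := isSmoothUpTo_indicator_smul hu hρ hh
  set g := R.indicator fun x => ρ x • h x with hg
  set g' := R.indicator (fderivWithin ℝ (fun x => ρ x • h x) R) with hg'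
  have hd : ∀ x, HasFDerivAt g (g' x) x := by
    intro x
    by_cases hxi : x ∈ interior R
    · exact hsm.hasFDerivAt x hxi
    by_cases hx : x ∈ R
    · have hxf : x ∈ frontier R := by rw [hR.isClosed.frontier_eq]; exact ⟨hx, hxi⟩
      have h1 : ∀ᶠ y in 𝓝 x, ρ y = 0 :=
        h0.filter_mono (nhds_le_nhdsSet hxf)
      have h2 : x ∉ tsupport ρ := by
        rw [notMem_tsupport_iff_eventuallyEq]
        exact h1
      rw [hsm.deriv_eq_zero x h2]
      refine (hasFDerivAt_const (0 : V) _).congr_of_eventuallyEq ?_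
      filter_upwards [h1] with y hy
      by_cases hyR : y ∈ R <;> simp [hg, hyR, hy]
    · rw [hsm.deriv_eq_zero_of_notMem x hx]
      refine (hasFDerivAt_const (0 : V) _).congr_of_eventuallyEq ?_
      filter_upwards [hR.isClosed.isOpen_compl.mem_nhds hx] with y hy
      exact indicator_of_notMem hy _
  have hgi : Integrable g := by
    refine Continuous.integrable_of_hasCompactSupport
      (continuous_iff_continuousAt.2 fun x => (hd x).continuousAt) ?_
    exact HasCompactSupport.intro hR fun x hx => indicator_of_notMem hx _
  have h1 : ∫ x, g' x v = 0 :=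
    integral_lineDeriv_eq_zero (v := v)
      ((ContinuousLinearMap.apply ℝ V v).integrable_comp (hsm.integrable_deriv hR)) hgi
      fun x => (hd x).hasLineDerivAt v
  rw [← integral_indicator hR.measurableSet, ← h1]
  refine integral_congr_ae (.of_forall fun x => ?_)
  by_cases hx : x ∈ R <;> simp [hg', hx]

/-- The divergence theorem for a region with boundary of class `C^1`. -/
theorem setIntegral_fderivWithin_eq [CompleteSpace V] (hn : 0 < n) (hR : IsCompact R)
    (P : BoundaryPatches R) {h : Euc n → V} (hh : ContDiffOn ℝ 1 h R) (i : Fin n) :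
    ∫ x in R, fderivWithin ℝ h R x (basisVec i) = P.integral i h := by
  have hu := uniqueDiffOn_region hn hR.isClosed P
  have hρ : ∀ j, ContDiff ℝ 1 (P.ρ j) := fun j => (P.smooth j).of_le (by exact_mod_cast le_top)
  -- the remaining member of the partition of unity, which vanishes near the boundary
  let ρ₀ : Euc n → ℝ := fun x => 1 - ∑ j, P.ρ j x
  have hρ₀ : ContDiff ℝ 1 ρ₀ := contDiff_const.sub (ContDiff.sum fun j _ => hρ j)
  have h0 : ∀ᶠ x in 𝓝ˢ (frontier R), ρ₀ x = 0 := by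
    filter_upwards [P.sum_eq_one] with x hx
    simp [ρ₀, hx]
  have hint : ∀ {ρ : Euc n → ℝ}, ContDiff ℝ 1 ρ →
      IntegrableOn (fun x => fderivWithin ℝ (fun x => ρ x • h x) R x (basisVec i)) R := fun hρ =>
    (((hρ.contDiffOn.smul hh).continuousOn_fderivWithin hu le_rfl).clm_apply
      continuousOn_const).integrableOn_compact hR
  have hdiff : ∀ {ρ : Euc n → ℝ}, ContDiff ℝ 1 ρ → ∀ x ∈ R,
      DifferentiableWithinAt ℝ (fun x => ρ x • h x) R x := fun hρ x hx =>
    (hρ.contDiffOn.smul hh).differentiableOn one_ne_zero x hx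
  have hsum : ∀ x ∈ R, fderivWithin ℝ h R x (basisVec i) =
      ∑ j, fderivWithin ℝ (fun x => P.ρ j x • h x) R x (basisVec i) +
        fderivWithin ℝ (fun x => ρ₀ x • h x) R x (basisVec i) := by
    intro x hx
    have he : h = (fun x => ∑ j, P.ρ j x • h x) + fun x => ρ₀ x • h x := by
      ext1 x
      simp only [Pi.add_apply, ρ₀]
      rw [← Finset.sum_smul, ← add_smul, add_sub_cancel, one_smul]
    conv_lhs => rw [he]
    rw [fderivWithin_add (hu x hx) (DifferentiableWithinAt.fun_sum fun j _ => hdiff (hρ j) x hx)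
      (hdiff hρ₀ x hx), fderivWithin_fun_sum (hu x hx) fun j _ => hdiff (hρ j) x hx]
    simp
  rw [setIntegral_congr_fun hR.measurableSet hsum,
    integral_add (integrable_finsetSum _ fun j _ => hint (hρ j)) (hint hρ₀),
    setIntegral_fderivWithin_eq_zero hR hu hρ₀ h0 hh, add_zero,
    integral_finsetSum _ fun j _ => hint (hρ j), BoundaryPatches.integral]
  exact Finset.sum_congr rfl fun j _ => integral_patch hn hR hu (P.patch j) (hρ j)
    (P.compact_support j) (P.subordinate j) hh i

end Divergence

/-! ### Potentials of a region and integrals over its boundary -/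

section Boundary

variable {n : ℕ} {R : Set (Euc n)} {V : Type*} [NormedAddCommGroup V] [NormedSpace ℝ V]

theorem IsAdmissible.of_continuousOn (hR : IsCompact R) {f : Euc n → V} (hf : ContinuousOn f R) :
    IsAdmissible (R.indicator f) where
  integrable := by
    have h1 : IntegrableOn (fun y => ((1 + ‖y‖) ^ (n - 2))⁻¹ • f y) R :=
      (continuous_weight.continuousOn.smul hf).integrableOn_compact hR
    refine (h1.integrable_indicator hR.measurableSet).congr (.of_forall fun y => ?_)
    by_cases hy : y ∈ R <;> simp [hy]
  bounded r := by
    obtain ⟨M, hM⟩ := hR.exists_bound_of_continuousOn hf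
    refine ⟨max M 0, fun y _ => ?_⟩
    by_cases hy : y ∈ R
    · rw [indicator_of_mem hy]
      exact (hM y hy).trans (le_max_left _ _)
    · simp [hy]

theorem GraphPatch.param_notMem_interior (hn : 0 < n) (P : GraphPatch R) {y : Euc (n - 1)}
    (hy : P.param y ∈ P.U) : P.param y ∉ interior R := by
  intro hi
  have hc : Continuous fun s : ℝ => P.flat hn (y, s) := (P.flat hn).continuous.comp (by fun_prop)
  have hn' : P.U ∩ interior R ∈ 𝓝 (P.flat hn (y, 0)) := by
    rw [P.flat_zero]
    exact (P.isOpen.inter isOpen_interior).mem_nhds ⟨hy, hi⟩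
  have h1 : ∀ᶠ s in 𝓝[>] (0 : ℝ), P.flat hn (y, s) ∈ P.U ∩ interior R :=
    (hc.continuousAt.eventually hn').filter_mono nhdsWithin_le_nhds
  obtain ⟨s, ⟨hs1, hs2⟩, hs3⟩ := (h1.and self_mem_nhdsWithin).exists
  exact absurd ((P.flat_mem_iff hn hs1).1 (interior_subset hs2)) (not_le.2 hs3)

theorem GraphPatch.param_mem (hn : 0 < n) (P : GraphPatch R) {y : Euc (n - 1)}
    (hy : P.param y ∈ P.U) : P.param y ∈ R := by
  rw [← P.flat_zero hn] at hy ⊢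
  exact (P.flat_mem_iff hn hy).2 le_rfl

/-- The integral over the boundary depends only on the values at the boundary. -/
theorem BoundaryPatches.integral_congr (hn : 0 < n) (P : BoundaryPatches R) (i : Fin n)
    {f f' : Euc n → V} (h : ∀ y ∈ R, y ∉ interior R → f y = f' y) :
    P.integral i f = P.integral i f' := by
  refine Finset.sum_congr rfl fun j _ => integral_congr_ae (.of_forall fun y => ?_)
  dsimp only
  by_cases hρ : P.ρ j ((P.patch j).param y) = 0
  · simp [hρ]
  · have hU := P.subordinate j (subset_tsupport _ hρ)
    rw [h _ ((P.patch j).param_mem hn hU) ((P.patch j).param_notMem_interior hn hU)]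

theorem hasFDerivAt_newton_sub {x y : Euc n} (h : y ≠ x) :
    HasFDerivAt (fun y => newton (x - y)) (-fderiv ℝ newton (x - y)) y := by
  have h1 := (isHomKernel_newton.differentiableAt (sub_ne_zero.2 h.symm)).hasFDerivAt.comp y
    ((hasFDerivAt_id y).const_sub x)
  refine h1.congr_fderiv ?_
  ext v
  simp

/-- Differentiation of the potential of a region: the derivative can be moved to the density at the
cost of a potential carried by the boundary. The density is split as `θ g + (1 - θ) g` with a bump
function `θ` at `x`: the first part has compact support in the interior, and to the second, on which
the kernel is smooth, the divergence theorem applies. -/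
theorem newtonGrad_indicator [CompleteSpace V] (hn : 3 ≤ n) (hR : IsCompact R)
    (P : BoundaryPatches R) {g : Euc n → V} (hg : ContDiffOn ℝ 1 g R) {x : Euc n}
    (hx : x ∈ interior R) (i : Fin n) :
    newtonGrad (R.indicator g) x (basisVec i) =
      (∫ y in R, newton (x - y) • fderivWithin ℝ g R y (basisVec i)) -
        P.integral i (fun y => newton (x - y) • g y) := by
  have hnt := nontrivial_euc (n := n) (by omega)
  have hn0 : 0 < n := by omega
  have hu := uniqueDiffOn_region hn0 hR.isClosed P
  have hRm := hR.measurableSet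
  obtain ⟨r, hr, hball⟩ := Metric.isOpen_iff.1 isOpen_interior x hx
  -- a cutoff that isolates the singularity
  let θ : ContDiffBump x := ⟨r / 4, r / 2, by positivity, by linarith⟩
  have hθc : ContDiff ℝ 1 θ := θ.contDiff
  have hθs : tsupport θ ⊆ interior R := by
    rw [θ.tsupport_eq]
    exact (Metric.closedBall_subset_ball (by simp [θ]; linarith)).trans hball
  have hθ0 : ∀ y ∉ interior R, θ y = 0 := fun y hy =>
    image_eq_zero_of_notMem_tsupport fun h => hy (hθs h)
  have hθ1 : ∀ᶠ y in 𝓝 x, θ y = 1 := θ.eventuallyEq_one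
  let G : Euc n → V := fun y => θ y • g y
  have hGts : tsupport G ⊆ tsupport θ := closure_mono fun y hy h0 => hy (by simp [G, h0])
  have hG : ContDiff ℝ 1 G := contDiff_iff_contDiffAt.2 fun y => by
    by_cases hy : y ∈ tsupport G
    · exact hθc.contDiffAt.smul (hg.contDiffAt (mem_interior_iff_mem_nhds.1 (hθs (hGts hy))))
    · exact contDiffAt_const.congr_of_eventuallyEq (notMem_tsupport_iff_eventuallyEq.1 hy)
  have hGs : HasCompactSupport G := θ.hasCompactSupport.smul_right
  have hGadm : IsAdmissible G := .of_hasCompactSupport hG.continuous hGs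
  have h1 : newtonGrad G x (basisVec i) =
      ∫ y in R, newton (x - y) • fderivWithin ℝ G R y (basisVec i) := by
    rw [(hGadm.hasFDerivAt_newtonPot hn x).unique (hasFDerivAt_newtonPot_of_contDiff hn hG hGs x),
      newtonPot, ContinuousLinearMap.integral_apply
        ((isAdmissible_fderiv hG hGs).integrable_newton_smul hn x),
      ← setIntegral_eq_integral_of_forall_compl_eq_zero (s := R) fun y hy => ?_]
    · refine setIntegral_congr_fun hRm fun y hy => ?_
      rw [fderivWithin_eq_fderiv (hu y hy) (hG.differentiable one_ne_zero y)]
      rfl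
    · have : y ∉ tsupport G := fun h => hy (interior_subset (hθs (hGts h)))
      simp [fderiv_of_notMem_tsupport ℝ this]
  let G₂ : Euc n → V := fun y => (1 - θ y) • g y
  have hG₂ : ContDiffOn ℝ 1 G₂ R := (contDiff_const.sub hθc).contDiffOn.smul hg
  have hG₂adm : IsAdmissible (R.indicator G₂) := .of_continuousOn hR hG₂.continuousOn
  -- the product of `G₂` with the kernel has no singularity
  let χ : Euc n → ℝ := fun y => (1 - θ y) * newton (x - y)
  have hχ : ContDiff ℝ 1 χ := by
    refine contDiff_iff_contDiffAt.2 fun y => ?_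
    rcases eq_or_ne y x with rfl | hy
    · have : χ =ᶠ[𝓝 y] fun _ => 0 := by
        filter_upwards [hθ1] with z hz
        simp [χ, hz]
      exact contDiffAt_const.congr_of_eventuallyEq this
    · have h2 : ContDiffAt ℝ 1 newton (x - y) :=
        (isHomKernel_newton.contDiffOn.contDiffAt
          (isOpen_compl_singleton.mem_nhds (sub_ne_zero.2 hy.symm))).of_le
            (by exact_mod_cast le_top)
      exact (contDiffAt_const.sub hθc.contDiffAt).mul
        (h2.comp y (contDiffAt_const.sub contDiffAt_id))
  let H : Euc n → V := fun y => χ y • g y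
  have hH : ContDiffOn ℝ 1 H R := hχ.contDiffOn.smul hg
  have hHint : IntegrableOn (fun y => fderivWithin ℝ H R y (basisVec i)) R :=
    ((hH.continuousOn_fderivWithin hu le_rfl).clm_apply continuousOn_const).integrableOn_compact hR
  have hint : ∀ {f : Euc n → V}, ContDiffOn ℝ 1 f R →
      IntegrableOn (fun y => newton (x - y) • fderivWithin ℝ f R y (basisVec i)) R := by
    intro f hf
    have hadm : IsAdmissible (R.indicator fun y => fderivWithin ℝ f R y (basisVec i)) :=
      .of_continuousOn hR ((hf.continuousOn_fderivWithin hu le_rfl).clm_apply continuousOn_const)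
    rw [← integrable_indicator_iff hRm]
    refine (hadm.integrable_newton_smul hn x).congr (.of_forall fun y => ?_)
    by_cases hy : y ∈ R <;> simp [hy]
  have hdiv : ∫ y in R, fderivWithin ℝ H R y (basisVec i) =
      P.integral i (fun y => newton (x - y) • g y) := by
    rw [setIntegral_fderivWithin_eq hn0 hR P hH]
    refine P.integral_congr hn0 i fun y _ hy => ?_
    simp [H, χ, hθ0 y hy]
  have h2 : newtonGrad (R.indicator G₂) x (basisVec i) =
      (∫ y in R, newton (x - y) • fderivWithin ℝ G₂ R y (basisVec i)) -
        ∫ y in R, fderivWithin ℝ H R y (basisVec i) := by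
    rw [hG₂adm.newtonGrad_apply hn, ← integral_sub (hint hG₂) hHint,
      ← setIntegral_eq_integral_of_forall_compl_eq_zero (s := R) fun y hy => by simp [hy]]
    refine integral_congr_ae ?_
    filter_upwards [ae_restrict_mem hRm, ae_restrict_of_ae (Measure.ae_ne volume x)] with y hy hyx
    have hH' : H = fun y => newton (x - y) • G₂ y := by
      ext1 y
      simp only [H, χ, G₂]
      rw [smul_smul, mul_comm]
    have hd := ((hasFDerivAt_newton_sub hyx).hasFDerivWithinAt (s := R)).smul
      ((hG₂.differentiableOn one_ne_zero y hy).hasFDerivWithinAt)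
    have hd' : HasFDerivWithinAt H (newton (x - y) • fderivWithin ℝ G₂ R y +
        (-fderiv ℝ newton (x - y)).smulRight (G₂ y)) R y := by
      rw [hH']
      exact hd
    rw [indicator_of_mem hy, hd'.fderivWithin (hu y hy)]
    simp
  have hsum : R.indicator g = G + R.indicator G₂ := by
    ext1 y
    by_cases hy : y ∈ R
    · simp only [hy, indicator_of_mem, Pi.add_apply, G, G₂]
      rw [← add_smul, add_sub_cancel, one_smul]
    · simp [hy, G, hθ0 y fun h => hy (interior_subset h)]
  have hgsum : ∀ y ∈ R, newton (x - y) • fderivWithin ℝ g R y (basisVec i) =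
      newton (x - y) • fderivWithin ℝ G R y (basisVec i) +
        newton (x - y) • fderivWithin ℝ G₂ R y (basisVec i) := by
    intro y hy
    have he : g = G + G₂ := by
      ext1 y
      simp only [Pi.add_apply, G, G₂]
      rw [← add_smul, add_sub_cancel, one_smul]
    conv_lhs => rw [he]
    rw [fderivWithin_add (hu y hy) (hG.differentiable one_ne_zero y).differentiableWithinAt
      (hG₂.differentiableOn one_ne_zero y hy), add_apply, smul_add]
  rw [hsum, newtonGrad_add hn hGadm hG₂adm, add_apply, h1, h2, hdiv,
    setIntegral_congr_fun hRm hgsum, integral_add (hint hG.contDiffOn) (hint hG₂)]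
  abel

theorem GraphPatch.continuous_param (P : GraphPatch R) : Continuous P.param := by
  have := P.contDiff.continuous
  have := P.frame.continuous
  unfold GraphPatch.param
  fun_prop

theorem GraphPatch.continuous_areaElement (P : GraphPatch R) : Continuous P.areaElement := by
  have h := P.contDiff.continuous_fderiv one_ne_zero
  unfold GraphPatch.areaElement gradient
  exact continuous_const.sub (P.frame.continuous.comp
    ((InnerProductSpace.toDual ℝ (Euc (n - 1))).symm.continuous.comp h))

/-- Differentiation of a potential carried by the boundary. -/
theorem BoundaryPatches.fderiv_integral [CompleteSpace V] (hn : 3 ≤ n) (P : BoundaryPatches R)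
    {f : Euc n → V} (hf : Continuous f) (i : Fin n) {x : Euc n} (hx : x ∈ interior R) :
    DifferentiableAt ℝ (fun x => P.integral i fun y => newton (x - y) • f y) x ∧
    ∀ v, fderiv ℝ (fun x => P.integral i fun y => newton (x - y) • f y) x v =
      P.integral i fun y => fderiv ℝ newton (x - y) v • f y := by
  have hn0 : 0 < n := by omega
  obtain ⟨r, hr, hball⟩ := Metric.isOpen_iff.1 isOpen_interior x hx
  let τ : Fin P.m → Euc (n - 1) → Euc n := fun j => (P.patch j).param
  let β : Fin P.m → Euc (n - 1) → V := fun j y =>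
    (P.ρ j (τ j y) * (P.patch j).areaElement y i) • f (τ j y)
  have hτ : ∀ j, Continuous (τ j) := fun j => (P.patch j).continuous_param
  have hβc : ∀ j, Continuous (β j) := fun j => by
    have h1 : Continuous fun y => (P.patch j).areaElement y i :=
      (EuclideanSpace.proj i : Euc n →L[ℝ] ℝ).continuous.comp (P.patch j).continuous_areaElement
    exact (((P.smooth j).continuous.comp (hτ j)).mul h1).smul (hf.comp (hτ j))
  have hβs : ∀ j, HasCompactSupport (β j) := fun j => by
    have hKc : IsCompact (Prod.fst '' ((P.patch j).flat hn0 ⁻¹' tsupport (P.ρ j))) :=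
      (((P.patch j).flat hn0).isCompact_preimage.2 (P.compact_support j)).image continuous_fst
    refine HasCompactSupport.intro hKc fun y hy => ?_
    have h0 : P.ρ j (τ j y) = 0 := by
      by_contra hne
      refine hy ⟨(y, 0), ?_, rfl⟩
      rw [mem_preimage, (P.patch j).flat_zero]
      exact subset_tsupport _ hne
    simp [β, h0]
  have hβi : ∀ j, Integrable fun y => ((1 + ‖τ j y‖) ^ (n - 2))⁻¹ • β j y := fun j =>
    ((continuous_weight.comp (hτ j)).smul (hβc j)).integrable_of_hasCompactSupport
      (hβs j).smul_left
  have hfar : ∀ j y, β j y ≠ 0 → r ≤ ‖x - τ j y‖ := by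
    intro j y hy
    have hρ : P.ρ j (τ j y) ≠ 0 := fun h0 => hy (by simp [β, h0])
    have h1 := (P.patch j).param_notMem_interior hn0 (P.subordinate j (subset_tsupport _ hρ))
    by_contra! h
    exact h1 (hball (by rwa [Metric.mem_ball', dist_eq_norm]))
  have hd : ∀ j, HasFDerivAt (fun x => ∫ y, newtonOp V (x - τ j y) (β j y))
      (∫ y, (fderiv ℝ (newtonOp V) (x - τ j y)).flip (β j y)) x := fun j =>
    isHomKernel_newtonOp.hasFDerivAt_integral le_rfl (hτ j).measurable (hβi j) hr (hfar j)
  have hTi : ∀ j, Integrable fun y => (fderiv ℝ (newtonOp V) (x - τ j y)).flip (β j y) := fun j =>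
    IsHomKernel.integrable_apply (κ := fun z => (fderiv ℝ (newtonOp V) z).flip)
      isHomKernel_newtonOp.fderiv_flip (Nat.le_succ _) (hτ j).measurable (hβi j) hr (hfar j)
  have hI : (fun x => P.integral i fun y => newton (x - y) • f y) =
      fun x => ∑ j, ∫ y, newtonOp V (x - τ j y) (β j y) := by
    ext1 x
    refine Finset.sum_congr rfl fun j _ => integral_congr_ae (.of_forall fun y => ?_)
    simp only [newtonOp, β, smul_apply, ContinuousLinearMap.id_apply]
    exact smul_comm _ _ _
  have hsum := HasFDerivAt.fun_sum (u := Finset.univ) fun j _ => hd j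
  rw [hI]
  refine ⟨hsum.differentiableAt, fun v => ?_⟩
  rw [hsum.fderiv, sum_apply]
  refine Finset.sum_congr rfl fun j _ => ?_
  rw [ContinuousLinearMap.integral_apply (hTi j)]
  refine integral_congr_ae (.of_forall fun y => ?_)
  dsimp only
  rcases eq_or_ne (β j y) 0 with h0 | h0
  · have h0' : (P.ρ j ((P.patch j).param y) * (P.patch j).areaElement y i) •
        f ((P.patch j).param y) = 0 := h0
    rw [h0, map_zero, zero_apply, smul_comm, h0', smul_zero]
  · rw [fderiv_newtonOp_flip (norm_pos_iff.1 (hr.trans_le (hfar j y h0)))]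
    simp only [ContinuousLinearMap.smulRight_apply, β]
    exact smul_comm _ _ _

end Boundary

/-! ### Operators of second order and the exterior potential -/

section Exterior

variable {n : ℕ} {R : Set (Euc n)}

section secondOrder

variable {V Y Z U : Type*} [NormedAddCommGroup V] [NormedSpace ℝ V]
  [NormedAddCommGroup Y] [NormedSpace ℝ Y] [NormedAddCommGroup Z] [NormedSpace ℝ Z]
  [NormedAddCommGroup U] [NormedSpace ℝ U]

theorem differentiableAt_fderiv_of_contDiffAt {ω : Euc n → V} {x : Euc n}
    (hω : ContDiffAt ℝ 2 ω x) : DifferentiableAt ℝ (fderiv ℝ ω) x :=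
  (hω.fderiv_right (m := 1) (by norm_num)).differentiableAt one_ne_zero

theorem firstOrder_firstOrder (a : Fin n → V →L[ℝ] Y) (b : Fin n → Y →L[ℝ] Z) {ω : Euc n → V}
    {x : Euc n} (hω : ContDiffAt ℝ 2 ω x) :
    firstOrder b (firstOrder a ω) x =
      ∑ i, ∑ h, b i (a h (fderiv ℝ (fderiv ℝ ω) x (basisVec i) (basisVec h))) := by
  have hd := (differentiableAt_fderiv_of_contDiffAt hω).hasFDerivAt
  have h : HasFDerivAt (firstOrder a ω)
      ((firstOrderSymbol a).comp (fderiv ℝ (fderiv ℝ ω) x)) x := by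
    rw [firstOrder_eq]
    exact (firstOrderSymbol a).hasFDerivAt.comp x hd
  rw [firstOrder, h.fderiv]
  simp only [ContinuousLinearMap.comp_apply, firstOrderSymbol_apply, map_sum]

theorem fderiv_fderiv_symm {ω : Euc n → V} {x : Euc n} (hω : ContDiffAt ℝ 2 ω x) (v w : Euc n) :
    fderiv ℝ (fderiv ℝ ω) x v w = fderiv ℝ (fderiv ℝ ω) x w v :=
  hω.isSymmSndFDerivAt (by simp) v w

/-- If the symbol `p_i a_h` is antisymmetric, then `p a = 0` on functions of class `C^2`. -/
theorem firstOrder_firstOrder_eq_zero {a : Fin n → V →L[ℝ] Y} {p : Fin n → Y →L[ℝ] Z}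
    (hrel : ∀ i h w, p i (a h w) + p h (a i w) = 0) {ω : Euc n → V} {x : Euc n}
    (hω : ContDiffAt ℝ 2 ω x) : firstOrder p (firstOrder a ω) x = 0 := by
  rw [firstOrder_firstOrder a p hω]
  exact sum_sum_eq_zero_of_antisymm hrel fun i h => fderiv_fderiv_symm hω _ _

/-- If `q p + r s` is the Laplacian, then `r s = -q p` on harmonic functions. -/
theorem firstOrder_firstOrder_of_harmonic {p : Fin n → Y →L[ℝ] Z} {q : Fin n → Z →L[ℝ] Y}
    {s : Fin n → Y →L[ℝ] U} {r : Fin n → U →L[ℝ] Y}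
    (hrel : ∀ i h w, q i (p h w) + r h (s i w) = if i = h then w else 0)
    {φ : Euc n → Y} {x : Euc n} (hφ : ContDiffAt ℝ 2 φ x)
    (hΔ : ∑ i, fderiv ℝ (fderiv ℝ φ) x (basisVec i) (basisVec i) = 0) :
    firstOrder r (firstOrder s φ) x = -firstOrder q (firstOrder p φ) x := by
  rw [eq_neg_iff_add_eq_zero, firstOrder_firstOrder s r hφ, firstOrder_firstOrder p q hφ,
    Finset.sum_comm (f := fun i h => r i (s h _)), ← Finset.sum_add_distrib, ← hΔ]
  refine Finset.sum_congr rfl fun i _ => ?_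
  rw [← Finset.sum_add_distrib]
  have : ∀ h, r h (s i (fderiv ℝ (fderiv ℝ φ) x (basisVec h) (basisVec i))) +
      q i (p h (fderiv ℝ (fderiv ℝ φ) x (basisVec i) (basisVec h))) =
      if i = h then fderiv ℝ (fderiv ℝ φ) x (basisVec i) (basisVec h) else 0 := fun h => by
    rw [fderiv_fderiv_symm hφ (basisVec h), add_comm, hrel]
  simp [this]

theorem contDiffOn_firstOrder {O : Set (Euc n)} (hO : IsOpen O) (a : Fin n → V →L[ℝ] Y)
    {ω : Euc n → V} {N : ℕ} (hω : ContDiffOn ℝ (N + 1 : ℕ) ω O) :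
    ContDiffOn ℝ N (firstOrder a ω) O := by
  rw [firstOrder_eq]
  exact (firstOrderSymbol a).contDiff.comp_contDiffOn
    (hω.fderiv_of_isOpen hO (by exact_mod_cast le_rfl))

theorem firstOrder_add (a : Fin n → V →L[ℝ] Y) {ω ω' : Euc n → V} {x : Euc n}
    (hω : DifferentiableAt ℝ ω x) (hω' : DifferentiableAt ℝ ω' x) :
    firstOrder a (ω + ω') x = firstOrder a ω x + firstOrder a ω' x := by
  simp only [firstOrder_eq]
  rw [fderiv_add hω hω', map_add]

theorem firstOrder_neg (a : Fin n → V →L[ℝ] Y) (ω : Euc n → V) (x : Euc n) :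
    firstOrder a (fun y => -ω y) x = -firstOrder a ω x := by
  simp only [firstOrder_eq]
  rw [fderiv_fun_neg, map_neg]

theorem firstOrder_congr (a : Fin n → V →L[ℝ] Y) {ω ω' : Euc n → V} {x : Euc n}
    (h : ω =ᶠ[𝓝 x] ω') : firstOrder a ω x = firstOrder a ω' x := by
  simp only [firstOrder_eq]
  rw [h.fderiv_eq]

theorem firstOrder_eq_within {a : Fin n → V →L[ℝ] Y} {A : Euc n → V} (hA : ContDiff ℝ 1 A)
    (hu : UniqueDiffOn ℝ R) {x : Euc n} (hx : x ∈ R) :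
    firstOrder a A x = firstOrderSymbol a (fderivWithin ℝ A R x) := by
  rw [firstOrder_eq, fderivWithin_eq_fderiv (hu x hx) (hA.differentiable one_ne_zero x)]

theorem contDiffOn_firstOrder_within (hu : UniqueDiffOn ℝ R) {a : Fin n → V →L[ℝ] Y}
    {A : Euc n → V} (hA : ContDiff ℝ 1 A) (hAR : ContDiffOn ℝ 2 A R) :
    ContDiffOn ℝ 1 (firstOrder a A) R :=
  ((firstOrderSymbol a).contDiff.comp_contDiffOn
    (hAR.fderivWithin (m := 1) hu (by norm_num))).congr fun _ hx => firstOrder_eq_within hA hu hx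

/-- Up to the boundary, `p a = 0` on functions with two derivatives. -/
theorem sum_fderivWithin_firstOrder_eq_zero (hu : UniqueDiffOn ℝ R)
    (hcl : R ⊆ closure (interior R)) {a : Fin n → V →L[ℝ] Y} {p : Fin n → Y →L[ℝ] Z}
    (hrel : ∀ i h w, p i (a h w) + p h (a i w) = 0) {A : Euc n → V} (hA : ContDiff ℝ 1 A)
    (hAR : ContDiffOn ℝ 2 A R) {x : Euc n} (hx : x ∈ R) :
    ∑ i, p i (fderivWithin ℝ (firstOrder a A) R x (basisVec i)) = 0 := by
  have hsymm : IsSymmSndFDerivWithinAt ℝ A R x :=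
    (hAR x hx).isSymmSndFDerivWithinAt (by simp) hu (hcl hx) hx
  have hd : DifferentiableWithinAt ℝ (fderivWithin ℝ A R) R x :=
    (hAR.fderivWithin (m := 1) hu (by norm_num)).differentiableOn one_ne_zero x hx
  have h1 : HasFDerivWithinAt (firstOrder a A)
      ((firstOrderSymbol a).comp (fderivWithin ℝ (fderivWithin ℝ A R) R x)) R x :=
    ((firstOrderSymbol a).hasFDerivAt.comp_hasFDerivWithinAt x hd.hasFDerivWithinAt).congr
      (fun _ hy => firstOrder_eq_within hA hu hy) (firstOrder_eq_within hA hu hx)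
  rw [h1.fderivWithin (hu x hx)]
  simp only [ContinuousLinearMap.comp_apply, firstOrderSymbol_apply, map_sum]
  exact sum_sum_eq_zero_of_antisymm hrel fun i h => hsymm _ _

end secondOrder

theorem basisVec_self (i : Fin n) : (basisVec i : Euc n) i = 1 := by
  simp [basisVec]

/-- The Laplacian of `1 / |z| ^ (n - 2)` vanishes off the origin. -/
theorem laplacian_newton (hn : 3 ≤ n) {z : Euc n} (hz : z ≠ 0) :
    ∑ i, fderiv ℝ (fun z => fderiv ℝ newton z (basisVec i)) z (basisVec i) = 0 := by
  have h0 : ‖z‖ ≠ 0 := norm_ne_zero_iff.2 hz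
  have h1 := hasFDerivAt_norm_of_ne_zero hz
  have hd : ∀ i, fderiv ℝ (fun z => fderiv ℝ newton z (basisVec i)) z (basisVec i) =
      (n - 2 : ℕ) * n * (‖z‖ ^ (n + 1))⁻¹ * ‖z‖⁻¹ * (z i * z i) -
        (n - 2 : ℕ) * (‖z‖ ^ n)⁻¹ := by
    intro i
    have he : (fun z => fderiv ℝ newton z (basisVec i)) =ᶠ[𝓝 z]
        fun z => -(n - 2 : ℕ) * ((‖z‖ ^ n)⁻¹ * z i) := by
      filter_upwards [isOpen_compl_singleton.mem_nhds hz] with w hw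
      rw [fderiv_newton_apply hw, inner_basisVec]
      have hn2 : ‖w‖ ^ n = ‖w‖ ^ (n - 2 + 1) * ‖w‖ := by
        rw [← pow_succ]
        congr 1
        omega
      rw [hn2, mul_inv]
      ring
    have h2 := ((((hasDerivAt_inv_pow h0 n).comp_hasFDerivAt z h1).mul
      (EuclideanSpace.proj i : Euc n →L[ℝ] ℝ).hasFDerivAt).const_mul (-((n - 2 : ℕ) : ℝ)))
    rw [he.fderiv_eq]
    refine (congrArg (fun T : Euc n →L[ℝ] ℝ => T (basisVec i)) h2.fderiv).trans ?_
    simp [inner_basisVec, basisVec_self]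
    ring
  simp only [hd, Finset.sum_sub_distrib, ← Finset.mul_sum]
  have h2 : ∑ i, z i * z i = ‖z‖ ^ 2 := by
    rw [EuclideanSpace.norm_sq_eq]
    simp [sq]
  rw [h2]
  simp
  field_simp
  ring

theorem BoundaryPatches.integral_neg {V : Type*} [NormedAddCommGroup V] [NormedSpace ℝ V]
    (P : BoundaryPatches R) (i : Fin n) (f : Euc n → V) :
    P.integral i (fun y => -f y) = -P.integral i f := by
  simp only [BoundaryPatches.integral, smul_neg, MeasureTheory.integral_neg,
    Finset.sum_neg_distrib]

section exterior

variable {V Y Z U : Type} [NormedAddCommGroup V] [NormedSpace ℝ V]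
  [NormedAddCommGroup Y] [NormedSpace ℝ Y] [NormedAddCommGroup Z] [NormedSpace ℝ Z]
  [NormedAddCommGroup U] [NormedSpace ℝ U]

theorem contDiffOn_newtonPot {β : Euc n → V} (hβ : IsAdmissible β) {O : Set (Euc n)}
    (hO : IsOpen O) (h0 : ∀ y ∈ O, β y = 0) (N : ℕ) : ContDiffOn ℝ N (newtonPot β) O :=
  isHomKernel_newtonOp.contDiffOn_integral le_rfl measurable_id hβ.integrable hO
    (fun y hy hyO => hy (h0 y hyO)) N

variable [CompleteSpace V] [CompleteSpace Y] [CompleteSpace Z]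

/-- The Newtonian potential is harmonic off the closure of the carrier of its density. -/
theorem laplacian_newtonPot (hn : 3 ≤ n) {β : Euc n → V} (hβ : IsAdmissible β)
    {O : Set (Euc n)} (hO : IsOpen O) (h0 : ∀ y ∈ O, β y = 0) {x : Euc n} (hx : x ∈ O) :
    ∑ i, fderiv ℝ (fderiv ℝ (newtonPot β)) x (basisVec i) (basisVec i) = 0 := by
  obtain ⟨r, hr, hball⟩ := Metric.isOpen_iff.1 hO x hx
  have hfar : ∀ y, β y ≠ 0 → r ≤ ‖x - y‖ := fun y hy => by
    by_contra! h
    exact hy (h0 y (hball (by rwa [Metric.mem_ball', dist_eq_norm])))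
  have hz : ∀ y, β y ≠ 0 → x - y ≠ 0 := fun y hy => norm_pos_iff.1 (hr.trans_le (hfar y hy))
  have hC : ContDiffAt ℝ 2 (newtonPot β) x :=
    (contDiffOn_newtonPot hβ hO h0 2).contDiffAt (hO.mem_nhds hx)
  have hgrad : fderiv ℝ (newtonPot β) = newtonGrad β :=
    funext fun x => (hβ.hasFDerivAt_newtonPot hn x).fderiv
  let κ : Fin n → Euc n → V →L[ℝ] V := fun i z =>
    fderiv ℝ newton z (basisVec i) • ContinuousLinearMap.id ℝ V
  have hκ : ∀ i, IsHomKernel (n - 2 + 1) (κ i) := fun i =>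
    (isHomKernel_newton.fderiv.clm_comp (ContinuousLinearMap.apply ℝ ℝ (basisVec i))).clm_comp
      ((ContinuousLinearMap.id ℝ ℝ).smulRight (ContinuousLinearMap.id ℝ V))
  have hd : ∀ i, HasFDerivAt (fun x => newtonGrad β x (basisVec i))
      (∫ y, (fderiv ℝ (κ i) (x - y)).flip (β y)) x := fun i => by
    have h := (hκ i).hasFDerivAt_integral (Nat.le_succ _) measurable_id hβ.integrable hr hfar
    convert! h using 1
    ext1 x
    rw [hβ.newtonGrad_apply hn]
    rfl
  have hint : ∀ i, Integrable fun y => (fderiv ℝ (κ i) (x - y)).flip (β y) := fun i =>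
    IsHomKernel.integrable_apply (κ := fun z => (fderiv ℝ (κ i) z).flip) (hκ i).fderiv_flip
      ((Nat.le_succ _).trans (Nat.le_succ _)) measurable_id hβ.integrable hr hfar
  have hκd : ∀ i y, (fderiv ℝ (κ i) (x - y)).flip (β y) (basisVec i) =
      fderiv ℝ (fun z => fderiv ℝ newton z (basisVec i)) (x - y) (basisVec i) • β y := by
    intro i y
    rcases eq_or_ne (β y) 0 with h | h
    · simp [h]
    · have h1 : DifferentiableAt ℝ (fun z => fderiv ℝ newton z (basisVec i)) (x - y) :=
        (isHomKernel_newton.fderiv.clm_comp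
          (ContinuousLinearMap.apply ℝ ℝ (basisVec i))).differentiableAt (hz y h)
      have h2 : HasFDerivAt (κ i) _ (x - y) :=
        HasFDerivAt.smul_const (𝕜' := ℝ) (F := V →L[ℝ] V) h1.hasFDerivAt _
      rw [h2.fderiv]
      simp
  have h2 : ∀ i, fderiv ℝ (fderiv ℝ (newtonPot β)) x (basisVec i) (basisVec i) =
      ∫ y, fderiv ℝ (fun z => fderiv ℝ newton z (basisVec i)) (x - y) (basisVec i) • β y := by
    intro i
    have hD := (differentiableAt_fderiv_of_contDiffAt hC).hasFDerivAt
    rw [hgrad] at hD ⊢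
    have h3 := (ContinuousLinearMap.apply ℝ V (basisVec i)).hasFDerivAt.comp x hD
    have h4 := (hd i).unique h3
    have h5 := congrArg (fun T : Euc n →L[ℝ] V => T (basisVec i)) h4
    refine h5.symm.trans ?_
    rw [ContinuousLinearMap.integral_apply (hint i)]
    simp only [hκd]
  have hi : ∀ i, Integrable fun y =>
      fderiv ℝ (fun z => fderiv ℝ newton z (basisVec i)) (x - y) (basisVec i) • β y := fun i => by
    have := (ContinuousLinearMap.apply ℝ V (basisVec i)).integrable_comp (hint i)
    simpa [hκd] using! this
  simp only [h2]
  rw [← integral_finsetSum _ fun i _ => hi i]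
  refine integral_eq_zero_of_ae (.of_forall fun y => ?_)
  rcases eq_or_ne (β y) 0 with h | h
  · simp [h]
  · dsimp only
    rw [← Finset.sum_smul, laplacian_newton hn (hz y h), zero_smul]
    rfl

variable {a : Fin n → V →L[ℝ] Y} {p : Fin n → Y →L[ℝ] Z} {A : Euc n → V}

/-- If `p a = 0`, then `p` turns the potential of `a A` outside `R` into a potential carried by the
boundary: as `p` annihilates the potential of `a A` over the whole space, only the potential over
`R` matters up to sign, and there the derivatives of `p` are moved to `a A`, which they annihilate. -/
theorem firstOrder_newtonPot_compl (hn : 3 ≤ n) (hR : IsCompact R) (P : BoundaryPatches R)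
    (hrel : ∀ i h w, p i (a h w) + p h (a i w) = 0) (hA : ContDiff ℝ 1 A)
    (hAR : ContDiffOn ℝ 2 A R) (hA0 : Tendsto A (cocompact (Euc n)) (𝓝 0))
    (hadm : IsAdmissible (firstOrder a A)) {x : Euc n} (hx : x ∈ interior R) :
    firstOrder p (newtonPot (Rᶜ.indicator (firstOrder a A))) x =
      ∑ i, p i (P.integral i fun y => newton (x - y) • firstOrder a A y) := by
  have hu := uniqueDiffOn_region (by omega) hR.isClosed P
  have hcl := subset_closure_interior (by omega) hR.isClosed P
  have hRm := hR.measurableSet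
  have hB := contDiffOn_firstOrder_within (a := a) hu hA hAR
  have h1 := firstOrder_newtonPot_eq_zero hn hrel hA hA0 hadm x
  rw [← indicator_self_add_compl R (firstOrder a A),
    firstOrder_newtonPot hn p ((hadm.indicator hRm).add (hadm.indicator hRm.compl)),
    newtonGrad_add hn (hadm.indicator hRm) (hadm.indicator hRm.compl)] at h1
  simp only [add_apply, map_add, Finset.sum_add_distrib] at h1
  rw [firstOrder_newtonPot hn p (hadm.indicator hRm.compl), eq_comm, ← sub_eq_zero, ← neg_eq_zero,
    neg_sub, sub_eq_add_neg, add_comm, ← h1, add_left_inj]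
  simp only [newtonGrad_indicator hn hR P hB hx, map_sub, Finset.sum_sub_distrib]
  rw [eq_comm, sub_eq_neg_self]
  have hint : ∀ i, IntegrableOn
      (fun y => newton (x - y) • fderivWithin ℝ (firstOrder a A) R y (basisVec i)) R := by
    intro i
    have hadm : IsAdmissible
        (R.indicator fun y => fderivWithin ℝ (firstOrder a A) R y (basisVec i)) :=
      .of_continuousOn hR ((hB.continuousOn_fderivWithin hu le_rfl).clm_apply continuousOn_const)
    rw [← integrable_indicator_iff hRm]
    refine (hadm.integrable_newton_smul hn x).congr (.of_forall fun y => ?_)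
    by_cases hy : y ∈ R <;> simp [hy]
  have h2 : ∀ i, p i (∫ y in R,
      newton (x - y) • fderivWithin ℝ (firstOrder a A) R y (basisVec i)) =
      ∫ y in R, newton (x - y) • p i (fderivWithin ℝ (firstOrder a A) R y (basisVec i)) := by
    intro i
    rw [← (p i).integral_comp_comm (hint i)]
    simp
  simp only [h2]
  rw [← integral_finsetSum _ fun i _ => by
    simpa using (p i).integrable_comp (hint i)]
  refine setIntegral_eq_zero_of_forall_eq_zero fun y hy => ?_
  rw [← Finset.smul_sum, sum_fderivWithin_firstOrder_eq_zero hu hcl hrel hA hAR hy, smul_zero]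

/-- The boundary form of `r s` on the potential of `a A` outside `R`, when `p a = 0` and
`q p + r s` is the Laplacian. -/
theorem firstOrder_firstOrder_newtonPot_compl (hn : 3 ≤ n) (hR : IsCompact R)
    (P : BoundaryPatches R) (hrel : ∀ i h w, p i (a h w) + p h (a i w) = 0)
    {q : Fin n → Z →L[ℝ] Y} {s : Fin n → Y →L[ℝ] U} {r : Fin n → U →L[ℝ] Y}
    (hrel' : ∀ i h w, q i (p h w) + r h (s i w) = if i = h then w else 0)
    (hA : ContDiff ℝ 1 A) (hAR : ContDiffOn ℝ 2 A R) (hA0 : Tendsto A (cocompact (Euc n)) (𝓝 0))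
    (hadm : IsAdmissible (firstOrder a A)) {x : Euc n} (hx : x ∈ interior R) :
    firstOrder r (firstOrder s (newtonPot (Rᶜ.indicator (firstOrder a A)))) x =
      ∑ i, ∑ l, q l (p i (P.integral i fun y =>
        fderiv ℝ (kernel x) y (basisVec l) • firstOrder a A y)) := by
  have hadm' := hadm.indicator hR.measurableSet.compl
  have h0 : ∀ y ∈ interior R, Rᶜ.indicator (firstOrder a A) y = 0 := fun y hy =>
    indicator_of_notMem (notMem_compl_iff.2 (interior_subset hy)) _
  have hO : IsOpen (interior R) := isOpen_interior
  have hf : Continuous (firstOrder a A) := continuous_firstOrder a hA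
  rw [firstOrder_firstOrder_of_harmonic hrel'
    ((contDiffOn_newtonPot hadm' hO h0 2).contDiffAt (hO.mem_nhds hx))
    (laplacian_newtonPot hn hadm' hO h0 hx)]
  have he : firstOrder p (newtonPot (Rᶜ.indicator (firstOrder a A))) =ᶠ[𝓝 x]
      fun x => ∑ i, p i (P.integral i fun y => newton (x - y) • firstOrder a A y) := by
    filter_upwards [hO.mem_nhds hx] with y hy
    exact firstOrder_newtonPot_compl hn hR P hrel hA hAR hA0 hadm hy
  have hd : HasFDerivAt (fun x => ∑ i, p i (P.integral i fun y => newton (x - y) • firstOrder a A y))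
      (∑ i, (p i).comp (fderiv ℝ (fun x => P.integral i fun y =>
        newton (x - y) • firstOrder a A y) x)) x :=
    HasFDerivAt.fun_sum fun i _ =>
      (p i).hasFDerivAt.comp x (P.fderiv_integral hn hf i hx).1.hasFDerivAt
  -- the sign from the change of variable in the derivative of the kernel cancels the one from
  -- `r s = -q p`
  have hk : ∀ i l, P.integral i (fun y => fderiv ℝ (kernel x) y (basisVec l) • firstOrder a A y) =
      -P.integral i fun y => fderiv ℝ newton (x - y) (basisVec l) • firstOrder a A y := by
    intro i l
    rw [← P.integral_neg]
    refine P.integral_congr (by omega) i fun y _ hy => ?_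
    have hne : y ≠ x := fun h => hy (h ▸ hx)
    have := (hasFDerivAt_newton_sub hne).fderiv
    change fderiv ℝ (kernel x) y = _ at this
    rw [this, neg_apply, neg_smul]
  rw [firstOrder_congr q he, firstOrder, hd.fderiv, Finset.sum_comm, ← Finset.sum_neg_distrib]
  refine Finset.sum_congr rfl fun l _ => ?_
  simp only [sum_apply, ContinuousLinearMap.comp_apply, map_sum, ← Finset.sum_neg_distrib, hk,
    map_neg, (P.fderiv_integral hn hf _ hx).2]

end exterior

end Exterior

/-! ### The prolongation term -/

section Prolongation

section forms

variable {n k : ℕ} {R D : Set (Euc n)}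

theorem IsAdmissible.integrableOn_kernel_smul (hn : 3 ≤ n) {β : Euc n → Form n k}
    (hD : MeasurableSet D) (hβ : IsAdmissible (D.indicator β)) (x : Euc n) :
    IntegrableOn (fun y => kernel x y • β y) D := by
  refine (integrable_indicator_iff (μ := volume) (f := fun y => kernel x y • β y) hD).1 ?_
  refine (hβ.integrable_newton_smul hn x).congr (.of_forall fun y => ?_)
  by_cases hy : y ∈ D <;> simp [hy, kernel, newton]

theorem potential_eq_newtonPot (hD : MeasurableSet D) (β : Euc n → Form n k) :
    potential D β = newtonPot (D.indicator β) := by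
  ext1 x
  rw [potential, newtonPot, ← integral_indicator hD]
  congr 1
  ext1 y
  by_cases hy : y ∈ D <;> simp [hy, kernel, newton]

/-- On `R`, up to the boundary, `δα` taken within `R` is `δA`. -/
theorem intDerivWithinPred_eq (hu : UniqueDiffOn ℝ R) {α A : Euc n → Form n k}
    (hA : ContDiff ℝ 1 A) (hAα : EqOn A α R) {x : Euc n} (hx : x ∈ R) :
    intDerivWithinPred k α R x = intDerivPred k A x := by
  have h : fderivWithin ℝ α R x = fderiv ℝ A x := by
    rw [← fderivWithin_congr hAα (hAα hx),
      fderivWithin_eq_fderiv (hu x hx) (hA.differentiable one_ne_zero x)]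
  cases k with
  | zero => rfl
  | succ k => simp only [intDerivWithinPred, intDerivWithin, intDerivPred, intDeriv, h]

/-- On `R`, up to the boundary, `dα` taken within `R` is `dA`. -/
theorem extDerivWithin_eq (hu : UniqueDiffOn ℝ R) {α A : Euc n → Form n k}
    (hA : ContDiff ℝ 1 A) (hAα : EqOn A α R) {x : Euc n} (hx : x ∈ R) :
    extDerivWithin α R x = extDeriv A x := by
  rw [extDerivWithin, extDeriv, ← fderivWithin_congr hAα (hAα hx),
    fderivWithin_eq_fderiv (hu x hx) (hA.differentiable one_ne_zero x)]

/-- The term `F` in terms of the Newtonian potentials of `δA` and `dA` outside `R`. -/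
theorem prolongationTerm_eq (hR : IsCompact R) (A : Euc n → Form n k) :
    prolongationTerm k R A =
      firstOrder (wedgePredL k) (newtonPot (Rᶜ.indicator (firstOrder (dotPredL k) A))) +
        firstOrder dotL (newtonPot (Rᶜ.indicator (firstOrder wedgeL A))) := by
  ext1 x
  rw [prolongationTerm, potential_eq_newtonPot hR.measurableSet.compl,
    potential_eq_newtonPot hR.measurableSet.compl, extDerivPred_eq_firstOrder,
    intDeriv_eq_firstOrder, intDerivPred_eq_firstOrder, extDeriv_eq_firstOrder]
  rfl

end forms

section smooth

variable {n k : ℕ} {O : Set (Euc n)} {φ : Euc n → Form n (k - 1)} {ψ : Euc n → Form n (k + 1)}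

/-- On the sum `dφ + δψ`, `d` acts as `dδψ`. -/
theorem firstOrder_wedgeL_add (hO : IsOpen O) (hφ : ContDiffOn ℝ (4 : ℕ) φ O)
    (hψ : ContDiffOn ℝ (4 : ℕ) ψ O) {x : Euc n} (hx : x ∈ O) :
    firstOrder wedgeL (firstOrder (wedgePredL k) φ + firstOrder dotL ψ) x =
      firstOrder wedgeL (firstOrder dotL ψ) x := by
  have hxO := hO.mem_nhds hx
  rw [firstOrder_add _
    ((contDiffOn_firstOrder hO (wedgePredL k) hφ).differentiableOn (by simp) |>.differentiableAt hxO)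
    ((contDiffOn_firstOrder hO dotL hψ).differentiableOn (by simp) |>.differentiableAt hxO),
    firstOrder_firstOrder_eq_zero (wedgeL_wedgePredL_add k)
      ((hφ.contDiffAt hxO).of_le (by norm_num)), zero_add]

/-- On the sum `dφ + δψ`, `δ` acts as `δdφ`. -/
theorem firstOrder_dotPredL_add (hO : IsOpen O) (hφ : ContDiffOn ℝ (4 : ℕ) φ O)
    (hψ : ContDiffOn ℝ (4 : ℕ) ψ O) {x : Euc n} (hx : x ∈ O) :
    firstOrder (dotPredL k) (firstOrder (wedgePredL k) φ + firstOrder dotL ψ) x =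
      firstOrder (dotPredL k) (firstOrder (wedgePredL k) φ) x := by
  have hxO := hO.mem_nhds hx
  rw [firstOrder_add _
    ((contDiffOn_firstOrder hO (wedgePredL k) hφ).differentiableOn (by simp) |>.differentiableAt hxO)
    ((contDiffOn_firstOrder hO dotL hψ).differentiableOn (by simp) |>.differentiableAt hxO),
    firstOrder_firstOrder_eq_zero (dotPredL_dotL_add k)
      ((hψ.contDiffAt hxO).of_le (by norm_num)), add_zero]

theorem dotL_wedgeL_add (i h : Fin n) (w : Form n (k + 1)) :
    dotL i (wedgeL h w) + wedgeL h (dotL i w) = if i = h then w else 0 := by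
  rw [add_comm (dotL i _)]
  simpa [eq_comm] using! wedgePredL_dotPredL_add (k + 1) h i w

/-- If `ψ` is harmonic, then `δdδψ = 0`. -/
theorem dotL_wedgeL_dotL_eq_zero (hO : IsOpen O) (hψ : ContDiffOn ℝ (4 : ℕ) ψ O)
    (hΔ : ∀ x ∈ O, ∑ i, fderiv ℝ (fderiv ℝ ψ) x (basisVec i) (basisVec i) = 0) {x : Euc n}
    (hx : x ∈ O) : firstOrder dotL (firstOrder wedgeL (firstOrder dotL ψ)) x = 0 := by
  have he : firstOrder wedgeL (firstOrder dotL ψ) =ᶠ[𝓝 x]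
      fun y => -firstOrder dotL (firstOrder wedgeL ψ) y := by
    filter_upwards [hO.mem_nhds hx] with y hy
    exact firstOrder_firstOrder_of_harmonic dotL_wedgeL_add
      ((hψ.contDiffAt (hO.mem_nhds hy)).of_le (by norm_num)) (hΔ y hy)
  have h1 : ContDiffOn ℝ (3 : ℕ) (firstOrder wedgeL ψ) O := contDiffOn_firstOrder hO wedgeL hψ
  rw [firstOrder_congr _ he, firstOrder_neg, firstOrder_firstOrder_eq_zero dotL_dotL_add
    ((h1.contDiffAt (hO.mem_nhds hx)).of_le (by norm_num)), neg_zero]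

/-- If `φ` is harmonic, then `dδdφ = 0`. -/
theorem wedgePredL_dotPredL_wedgePredL_eq_zero (hO : IsOpen O)
    (hφ : ContDiffOn ℝ (4 : ℕ) φ O)
    (hΔ : ∀ x ∈ O, ∑ i, fderiv ℝ (fderiv ℝ φ) x (basisVec i) (basisVec i) = 0) {x : Euc n}
    (hx : x ∈ O) :
    firstOrder (wedgePredL k) (firstOrder (dotPredL k) (firstOrder (wedgePredL k) φ)) x = 0 := by
  cases k with
  | zero => simp [firstOrder, wedgePredL]
  | succ k =>
  change Euc n → Form n k at φ
  change firstOrder wedgeL (firstOrder dotL (firstOrder wedgeL φ)) x = 0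
  have he : firstOrder dotL (firstOrder wedgeL φ) =ᶠ[𝓝 x]
      fun y => -firstOrder (wedgePredL k) (firstOrder (dotPredL k) φ) y := by
    filter_upwards [hO.mem_nhds hx] with y hy
    exact firstOrder_firstOrder_of_harmonic (wedgePredL_dotPredL_add k)
      ((hφ.contDiffAt (hO.mem_nhds hy)).of_le (by norm_num)) (hΔ y hy)
  have h1 : ContDiffOn ℝ (3 : ℕ) (firstOrder (dotPredL k) φ) O := contDiffOn_firstOrder hO _ hφ
  rw [firstOrder_congr _ he, firstOrder_neg, firstOrder_firstOrder_eq_zero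
    (wedgeL_wedgePredL_add k) ((h1.contDiffAt (hO.mem_nhds hx)).of_le (by norm_num)), neg_zero]

end smooth

section prolongation

variable {n k : ℕ} {R : Set (Euc n)} {A : Euc n → Form n k}

/-- The potentials of densities carried by the complement of `R` are smooth inside `R`. -/
theorem contDiffOn_newtonPot_compl (hR : IsCompact R) {β : Euc n → Form n k}
    (hβ : IsAdmissible β) :
    ContDiffOn ℝ (4 : ℕ) (newtonPot (Rᶜ.indicator β)) (interior R) :=
  contDiffOn_newtonPot (hβ.indicator hR.measurableSet.compl) isOpen_interior
    (fun _ hy => indicator_of_notMem (notMem_compl_iff.2 (interior_subset hy)) _) 4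

/-- The potentials of densities carried by the complement of `R` are harmonic inside `R`. -/
theorem laplacian_newtonPot_compl (hn : 3 ≤ n) (hR : IsCompact R) {β : Euc n → Form n k}
    (hβ : IsAdmissible β) : ∀ x ∈ interior R, ∑ i, fderiv ℝ
      (fderiv ℝ (newtonPot (Rᶜ.indicator β))) x (basisVec i) (basisVec i) = 0 := fun _ hx =>
  laplacian_newtonPot hn (hβ.indicator hR.measurableSet.compl) isOpen_interior
    (fun _ hy => indicator_of_notMem (notMem_compl_iff.2 (interior_subset hy)) _) hx

theorem firstOrder_newtonPot_eq_add_compl (hn : 3 ≤ n) (hR : IsCompact R) {j : ℕ}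
    (a : Fin n → Form n k →L[ℝ] Form n j) {β : Euc n → Form n k} (hβ : IsAdmissible β)
    (x : Euc n) : firstOrder a (newtonPot β) x =
      firstOrder a (newtonPot (R.indicator β)) x + firstOrder a (newtonPot (Rᶜ.indicator β)) x := by
  have h := hβ.indicator hR.measurableSet
  have h' := hβ.indicator hR.measurableSet.compl
  rw [← firstOrder_add a (h.hasFDerivAt_newtonPot hn x).differentiableAt
    (h'.hasFDerivAt_newtonPot hn x).differentiableAt]
  congr 1
  ext1 y
  rw [Pi.add_apply, ← newtonPot_add hn h h', indicator_self_add_compl]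

theorem contDiffOn_prolongationTerm (hR : IsCompact R)
    (hδ : IsAdmissible (firstOrder (dotPredL k) A)) (hd : IsAdmissible (firstOrder wedgeL A)) :
    ContDiffOn ℝ 2 (prolongationTerm k R A) (interior R) := by
  rw [prolongationTerm_eq hR]
  exact ((contDiffOn_firstOrder isOpen_interior _ (contDiffOn_newtonPot_compl hR hδ)).add
    (contDiffOn_firstOrder isOpen_interior _ (contDiffOn_newtonPot_compl hR hd))).of_le
      (by norm_num)

/-- In the interior of `R`, `δF` is `δd` of the potential of `δA`. -/
theorem intDerivPred_prolongationTerm (hR : IsCompact R)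
    (hδ : IsAdmissible (firstOrder (dotPredL k) A)) (hd : IsAdmissible (firstOrder wedgeL A))
    {x : Euc n} (hx : x ∈ interior R) :
    intDerivPred k (prolongationTerm k R A) x = firstOrder (dotPredL k) (firstOrder (wedgePredL k)
      (newtonPot (Rᶜ.indicator (firstOrder (dotPredL k) A)))) x := by
  rw [intDerivPred_eq_firstOrder, prolongationTerm_eq hR,
    firstOrder_dotPredL_add isOpen_interior (contDiffOn_newtonPot_compl hR hδ)
      (contDiffOn_newtonPot_compl hR hd) hx]

/-- In the interior of `R`, `dF` is `dδ` of the potential of `dA`. -/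
theorem extDeriv_prolongationTerm (hR : IsCompact R)
    (hδ : IsAdmissible (firstOrder (dotPredL k) A)) (hd : IsAdmissible (firstOrder wedgeL A))
    {x : Euc n} (hx : x ∈ interior R) :
    extDeriv (prolongationTerm k R A) x = firstOrder wedgeL (firstOrder dotL
      (newtonPot (Rᶜ.indicator (firstOrder wedgeL A)))) x := by
  rw [extDeriv_eq_firstOrder, prolongationTerm_eq hR,
    firstOrder_wedgeL_add isOpen_interior (contDiffOn_newtonPot_compl hR hδ)
      (contDiffOn_newtonPot_compl hR hd) hx]

theorem intDeriv_extDeriv_prolongationTerm (hn : 3 ≤ n) (hR : IsCompact R)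
    (hδ : IsAdmissible (firstOrder (dotPredL k) A)) (hd : IsAdmissible (firstOrder wedgeL A))
    {x : Euc n} (hx : x ∈ interior R) :
    intDeriv (extDeriv (prolongationTerm k R A)) x = 0 := by
  have he : extDeriv (prolongationTerm k R A) =ᶠ[𝓝 x] firstOrder wedgeL (firstOrder dotL
      (newtonPot (Rᶜ.indicator (firstOrder wedgeL A)))) := by
    filter_upwards [isOpen_interior.mem_nhds hx] with y hy
    exact extDeriv_prolongationTerm hR hδ hd hy
  rw [intDeriv_eq_firstOrder, firstOrder_congr _ he]
  exact dotL_wedgeL_dotL_eq_zero isOpen_interior (contDiffOn_newtonPot_compl hR hd)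
    (laplacian_newtonPot_compl hn hR hd) hx

theorem extDerivPred_intDerivPred_prolongationTerm (hn : 3 ≤ n) (hR : IsCompact R)
    (hδ : IsAdmissible (firstOrder (dotPredL k) A)) (hd : IsAdmissible (firstOrder wedgeL A))
    {x : Euc n} (hx : x ∈ interior R) :
    extDerivPred k (intDerivPred k (prolongationTerm k R A)) x = 0 := by
  have he : intDerivPred k (prolongationTerm k R A) =ᶠ[𝓝 x] firstOrder (dotPredL k)
      (firstOrder (wedgePredL k) (newtonPot (Rᶜ.indicator (firstOrder (dotPredL k) A)))) := by
    filter_upwards [isOpen_interior.mem_nhds hx] with y hy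
    exact intDerivPred_prolongationTerm hR hδ hd hy
  rw [extDerivPred_eq_firstOrder, firstOrder_congr _ he]
  exact wedgePredL_dotPredL_wedgePredL_eq_zero isOpen_interior
    (contDiffOn_newtonPot_compl hR hδ) (laplacian_newtonPot_compl hn hR hδ) hx

theorem intDerivPred_prolongationTerm_eq_boundary (hn : 3 ≤ n) (hR : IsCompact R)
    (P : BoundaryPatches R) {α : Euc n → Form n k} (hA : ContDiff ℝ 1 A)
    (hAR : ContDiffOn ℝ 2 A R) (hAα : EqOn A α R) (hA0 : Tendsto A (cocompact (Euc n)) (𝓝 0))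
    (hδ : IsAdmissible (firstOrder (dotPredL k) A)) (hd : IsAdmissible (firstOrder wedgeL A))
    {x : Euc n} (hx : x ∈ interior R) :
    intDerivPred k (prolongationTerm k R A) x =
      ∑ i : Fin n, ∑ l : Fin n, wedgePred (k - 1) l (dotPred (k - 1) i (P.integral i fun y =>
        fderiv ℝ (kernel x) y (basisVec l) • intDerivWithinPred k α R y)) := by
  cases k with
  | zero => simp [intDerivPred, wedgePred]
  | succ k =>
    rw [intDerivPred_prolongationTerm hR hδ hd hx]
    refine (firstOrder_firstOrder_newtonPot_compl hn hR P
      (dotPredL_dotL_add k) (wedgePredL_dotPredL_add k) hA hAR hA0 hδ hx).trans ?_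
    refine Finset.sum_congr rfl fun i _ => Finset.sum_congr rfl fun l _ => ?_
    rw [wedgePred_eq_wedgePredL, dotPred_eq_dotPredL]
    refine congrArg (fun w => wedgePredL k l (dotPredL k i w)) ?_
    refine P.integral_congr (by omega) i fun y hy _ => ?_
    rw [intDerivWithinPred_eq (uniqueDiffOn_region (by omega) hR.isClosed P) hA hAα hy,
      intDerivPred_eq_firstOrder]
    rfl

theorem extDeriv_prolongationTerm_eq_boundary (hn : 3 ≤ n) (hR : IsCompact R)
    (P : BoundaryPatches R) {α : Euc n → Form n k} (hA : ContDiff ℝ 1 A)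
    (hAR : ContDiffOn ℝ 2 A R) (hAα : EqOn A α R) (hA0 : Tendsto A (cocompact (Euc n)) (𝓝 0))
    (hδ : IsAdmissible (firstOrder (dotPredL k) A)) (hd : IsAdmissible (firstOrder wedgeL A))
    {x : Euc n} (hx : x ∈ interior R) :
    extDeriv (prolongationTerm k R A) x =
      ∑ i : Fin n, ∑ l : Fin n, dot l (wedge i (P.integral i fun y =>
        fderiv ℝ (kernel x) y (basisVec l) • extDerivWithin α R y)) := by
  rw [extDeriv_prolongationTerm hR hδ hd hx, firstOrder_firstOrder_newtonPot_compl hn hR P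
    wedgeL_wedgeL_add dotL_wedgeL_add hA hAR hA0 hd hx]
  refine Finset.sum_congr rfl fun i _ => Finset.sum_congr rfl fun l _ => ?_
  rw [dot_eq_dotL, wedge_eq_wedgeL]
  refine congrArg (fun w => dotL l (wedgeL i w)) ?_
  refine P.integral_congr (by omega) i fun y hy _ => ?_
  rw [extDerivWithin_eq (uniqueDiffOn_region (by omega) hR.isClosed P) hA hAα hy,
    extDeriv_eq_firstOrder]

end prolongation

end Prolongation

end HodgeRegion

end

theorem mainTheorem3 (n : ℕ) (hn : 3 ≤ n) (k : ℕ)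
    (R : Set (HodgeRegion.Euc n)) (hR : IsCompact R) (P : HodgeRegion.BoundaryPatches R)
    (α : HodgeRegion.Euc n → HodgeRegion.Form n k) (hα : ContDiffOn ℝ 2 α R)
    -- a prolongation of `α` that vanishes sufficiently fast at infinity
    (A : HodgeRegion.Euc n → HodgeRegion.Form n k) (hA : ContDiff ℝ 1 A) (hAα : EqOn A α R)
    (hA_lim : Tendsto A (cocompact (HodgeRegion.Euc n)) (𝓝 0))
    (hA_d : Integrable (fun x => ((1 + ‖x‖) ^ (n - 2))⁻¹ • extDeriv A x))
    (hA_δ : Integrable (fun x => ((1 + ‖x‖) ^ (n - 2))⁻¹ • HodgeRegion.intDerivPred k A x)) :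
    -- the integrals converge
    (∀ x, IntegrableOn
        (fun y => HodgeRegion.kernel x y • HodgeRegion.intDerivWithinPred k α R y) R ∧
      IntegrableOn (fun y => HodgeRegion.kernel x y • extDerivWithin α R y) R ∧
      IntegrableOn (fun y => HodgeRegion.kernel x y • HodgeRegion.intDerivPred k A y) Rᶜ ∧
      IntegrableOn (fun y => HodgeRegion.kernel x y • extDeriv A y) Rᶜ) ∧
    -- and can be differentiated
    Differentiable ℝ (HodgeRegion.potential R (HodgeRegion.intDerivWithinPred k α R)) ∧
    Differentiable ℝ (HodgeRegion.potential R (extDerivWithin α R)) ∧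
    Differentiable ℝ (HodgeRegion.potential Rᶜ (HodgeRegion.intDerivPred k A)) ∧
    Differentiable ℝ (HodgeRegion.potential Rᶜ (extDeriv A)) ∧
    -- the decomposition of `α` on `R`
    (∀ x ∈ R, -(((n : ℝ) - 2) * HodgeRegion.solidAngle n) • α x =
      HodgeRegion.extDerivPred k
          (HodgeRegion.potential R (HodgeRegion.intDerivWithinPred k α R)) x +
        HodgeRegion.intDeriv (HodgeRegion.potential R (extDerivWithin α R)) x +
        HodgeRegion.prolongationTerm k R A x) ∧
    -- the boundary-integral system for `F`
    ContDiffOn ℝ 2 (HodgeRegion.prolongationTerm k R A) (interior R) ∧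
    (∀ x ∈ interior R,
      HodgeRegion.intDerivPred k (HodgeRegion.prolongationTerm k R A) x =
        ∑ i : Fin n, ∑ l : Fin n,
          HodgeRegion.wedgePred (k - 1) l (HodgeRegion.dotPred (k - 1) i
            (P.integral i (fun y =>
              fderiv ℝ (HodgeRegion.kernel x) y (HodgeRegion.basisVec l) •
                HodgeRegion.intDerivWithinPred k α R y)))) ∧
    (∀ x ∈ interior R,
      extDeriv (HodgeRegion.prolongationTerm k R A) x =
        ∑ i : Fin n, ∑ l : Fin n,
          HodgeRegion.dot l (HodgeRegion.wedge i
            (P.integral i (fun y =>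
              fderiv ℝ (HodgeRegion.kernel x) y (HodgeRegion.basisVec l) •
                extDerivWithin α R y)))) ∧
    -- `F` is hyper-harmonic
    (∀ x ∈ interior R,
      HodgeRegion.intDeriv (extDeriv (HodgeRegion.prolongationTerm k R A)) x = 0 ∧
      HodgeRegion.extDerivPred k
        (HodgeRegion.intDerivPred k (HodgeRegion.prolongationTerm k R A)) x = 0) := by
  have hRm := hR.measurableSet
  have hu := HodgeRegion.uniqueDiffOn_region (by omega) hR.isClosed P
  have hAR : ContDiffOn ℝ 2 A R := hα.congr hAα
  have hδ := HodgeRegion.intDerivPred_eq_firstOrder k A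
  have hd := HodgeRegion.extDeriv_eq_firstOrder A
  have hadmδ : HodgeRegion.IsAdmissible (HodgeRegion.firstOrder (HodgeRegion.dotPredL k) A) :=
    .of_continuous (HodgeRegion.continuous_firstOrder _ hA) (by rwa [← hδ])
  have hadmd : HodgeRegion.IsAdmissible (HodgeRegion.firstOrder HodgeRegion.wedgeL A) :=
    .of_continuous (HodgeRegion.continuous_firstOrder _ hA) (by rwa [← hd])
  -- within `R` the derivatives of `α` are those of `A`
  have hδR : R.indicator (HodgeRegion.intDerivWithinPred k α R) =
      R.indicator (HodgeRegion.firstOrder (HodgeRegion.dotPredL k) A) :=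
    indicator_congr fun y hy => by rw [HodgeRegion.intDerivWithinPred_eq hu hA hAα hy, hδ]
  have hdR : R.indicator (extDerivWithin α R) =
      R.indicator (HodgeRegion.firstOrder HodgeRegion.wedgeL A) :=
    indicator_congr fun y hy => by rw [HodgeRegion.extDerivWithin_eq hu hA hAα hy, hd]
  -- the densities of the four potentials are admissible
  have h1 := hadmδ.indicator hRm
  have h2 := hadmd.indicator hRm
  have h3 := hadmδ.indicator hRm.compl
  have h4 := hadmd.indicator hRm.compl
  refine ⟨fun x => ⟨?_, ?_, ?_, ?_⟩, ?_, ?_, ?_, ?_, fun x hx => ?_,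
    HodgeRegion.contDiffOn_prolongationTerm hR hadmδ hadmd,
    fun x hx => HodgeRegion.intDerivPred_prolongationTerm_eq_boundary hn hR P hA hAR hAα hA_lim
      hadmδ hadmd hx,
    fun x hx => HodgeRegion.extDeriv_prolongationTerm_eq_boundary hn hR P hA hAR hAα hA_lim
      hadmδ hadmd hx,
    fun x hx => ⟨HodgeRegion.intDeriv_extDeriv_prolongationTerm hn hR hadmδ hadmd hx,
      HodgeRegion.extDerivPred_intDerivPred_prolongationTerm hn hR hadmδ hadmd hx⟩⟩
  · exact HodgeRegion.IsAdmissible.integrableOn_kernel_smul hn hRm (hδR ▸ h1) x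
  · exact HodgeRegion.IsAdmissible.integrableOn_kernel_smul hn hRm (hdR ▸ h2) x
  · exact HodgeRegion.IsAdmissible.integrableOn_kernel_smul hn hRm.compl (hδ ▸ h3) x
  · exact HodgeRegion.IsAdmissible.integrableOn_kernel_smul hn hRm.compl (hd ▸ h4) x
  · rw [HodgeRegion.potential_eq_newtonPot hRm, hδR]
    exact fun x => (h1.hasFDerivAt_newtonPot hn x).differentiableAt
  · rw [HodgeRegion.potential_eq_newtonPot hRm, hdR]
    exact fun x => (h2.hasFDerivAt_newtonPot hn x).differentiableAt
  · rw [HodgeRegion.potential_eq_newtonPot hRm.compl, hδ]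
    exact fun x => (h3.hasFDerivAt_newtonPot hn x).differentiableAt
  · rw [HodgeRegion.potential_eq_newtonPot hRm.compl, hd]
    exact fun x => (h4.hasFDerivAt_newtonPot hn x).differentiableAt
  · -- the representation of `A` over the whole space, split into the parts over `R` and `Rᶜ`
    have h := HodgeRegion.firstOrder_newtonPot_add_eq hn
      (HodgeRegion.wedgePredL_dotPredL_add k) hA hA_lim hadmδ hadmd x
    rw [HodgeRegion.firstOrder_newtonPot_eq_add_compl hn hR _ hadmδ,
      HodgeRegion.firstOrder_newtonPot_eq_add_compl hn hR _ hadmd] at h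
    rw [← hAα hx, ← h, HodgeRegion.prolongationTerm_eq hR, HodgeRegion.extDerivPred_eq_firstOrder,
      HodgeRegion.intDeriv_eq_firstOrder, HodgeRegion.potential_eq_newtonPot hRm,
      HodgeRegion.potential_eq_newtonPot hRm, hδR, hdR, Pi.add_apply]
    abel
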